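/- Let $L>0$, $\sigma\in(0,1)$, and let $(k_n)_{n\ge1}$ be integers with $0\le k_n\le Ln^2$ and $\lim_{n\to\infty} k_n/(Ln^2)=\sigma$. Put $L_n=\lfloor Ln^2\rfloor/n^2$ and let $\mathcal A_n(L,k_n)$ be the set of functions $u:(0,L_n]\to\{0,1\}$ that are constant on each interval $(\frac{i-1}{n^2},\frac{i}{n^2}]$, $i=1,\dots,\lfloor Ln^2\rfloor$, and satisfy $\#\{i\in\{1,\dots,\lfloor Ln^2\rfloor\}:u_i=1\}=k_n$, where $u_i=u(i/n^2)$; such functions are extended by $0$ to the rest of $(0,L)$. For $u\in\mathcal A_n(L,k_n)$ let $$F_n^{L,k_n}(u)=\frac1n\sum_{\{i,j\}\in\mathcal E_n(L)}(u_i-u_j)^2,\qquad \mathcal E_n(L)=\bigl\{\{i,j\}: i,j\in\{1,\dots,\lfloor Ln^2\rfloor\},\ |i-j|=1\text{ or }|i-j|=n\bigr\},$$ and let $F_n^{L,k_n}(u)=+\infty$ for all other $u\in L^\infty(0,L)$. Define $F^{L,\sigma}:L^\infty(0,L)\to[0,+\infty]$ by $$F^{L,\sigma}(u)=2\,\bigl|\{x\in(0,L):0<u(x)<1\}\bigr|+|Du|(0,L)$$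 if $u\in BV(0,L)$, $0\le u\le1$ a.e. and $\int_0^Lu\,dx=L\sigma$, and $F^{L,\sigma}(u)=+\infty$ otherwise. Here $|\cdot|$ of a set is Lebesgue measure and $|Du|(0,L)$ is the total variation of the distributional derivative of $u$. Then $F_n^{L,k_n}$ $\Gamma$-converges to $F^{L,\sigma}$ with respect to weak-$*$ convergence in $L^\infty(0,L)$. That is, for every $u\in L^\infty(0,L)$: (i) $F^{L,\sigma}(u)\le\liminf_{n\to\infty}F_n^{L,k_n}(u_n)$ for every sequence $u_n\to u$ weakly-$*$ in $L^\infty(0,L)$; (ii) there is a sequence $u_n\to u$ weakly-$*$ in $L^\infty(0,L)$ with $\limsup_{n\to\infty}F_n^{L,k_n}(u_n)\le F^{L,\sigma}(u)$. -/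

import Mathlib

open MeasureTheory Filter Set
open scoped Topology ENNReal

noncomputable section

namespace SpinChain

/-- Lebesgue measure on the open interval `(0, L)`. -/
abbrev mu (L : ℝ) : Measure ℝ := volume.restrict (Ioo 0 L)

/-- The space `L^∞(0, L)` of real functions modulo a.e. equality. -/
abbrev LInfty (L : ℝ) : Type := Lp ℝ ∞ (mu L)

/-- Weak-`*` convergence of sequences in `L^∞(0, L) = (L^1(0, L))^*`. -/
def WeakStarTendsto (L : ℝ) (u : ℕ → LInfty L) (v : LInfty L) : Prop :=
  ∀ g : ℝ → ℝ, Integrable g (mu L) →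
    Tendsto (fun n => ∫ x, (u n : ℝ → ℝ) x * g x ∂(mu L)) atTop
      (𝓝 (∫ x, (v : ℝ → ℝ) x * g x ∂(mu L)))

/-- (Sequential) `Γ`-convergence of a sequence of `[0, ∞]`-valued functionals with respect to a
notion `conv` of convergence of sequences: the liminf inequality along every convergent sequence,
and the existence of a recovery sequence for every point. -/
def GammaConverges {X : Type*} (conv : (ℕ → X) → X → Prop)
    (F : ℕ → X → ℝ≥0∞) (F₀ : X → ℝ≥0∞) : Prop :=
  (∀ (x : X) (u : ℕ → X), conv u x → F₀ x ≤ liminf (fun n => F n (u n)) atTop) ∧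
  (∀ x : X, ∃ u : ℕ → X, conv u x ∧ limsup (fun n => F n (u n)) atTop ≤ F₀ x)

/-- The number `⌊L n²⌋` of sites. -/
def numSites (L : ℝ) (n : ℕ) : ℕ := ⌊L * (n : ℝ) ^ 2⌋₊

/-- The value `u_i = u(i / n²)` at the site `i`. -/
def site (n : ℕ) (u : ℝ → ℝ) (i : ℕ) : ℝ := u ((i : ℝ) / (n : ℝ) ^ 2)

/-- The class `A_n(L, k)`: functions with values in `{0, 1}` on `(0, L_n]`, `L_n = ⌊L n²⌋ / n²`,
constant on each cell `((i - 1) / n², i / n²]`, `1 ≤ i ≤ ⌊L n²⌋`, extended by `0` outside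
`(0, L_n]`, and taking the value `1` at exactly `k` sites. -/
def spinFunctions (L : ℝ) (n k : ℕ) : Set (ℝ → ℝ) :=
  {u | (∀ x ∈ Ioc (0 : ℝ) ((numSites L n : ℝ) / (n : ℝ) ^ 2), u x = 0 ∨ u x = 1) ∧
    (∀ x ∉ Ioc (0 : ℝ) ((numSites L n : ℝ) / (n : ℝ) ^ 2), u x = 0) ∧
    (∀ i ∈ Finset.Icc 1 (numSites L n),
      ∀ x ∈ Ioc (((i : ℝ) - 1) / (n : ℝ) ^ 2) ((i : ℝ) / (n : ℝ) ^ 2), u x = site n u i) ∧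
    Set.ncard {i : ℕ | i ∈ Finset.Icc 1 (numSites L n) ∧ site n u i = 1} = k}

/-- The bonds `{i, j}` between sites in `{1, …, ⌊L n²⌋}` with `|i - j| = 1` or `|i - j| = n`; each
unordered pair is listed once, as `(i, j)` with `i < j`. -/
def bonds (L : ℝ) (n : ℕ) : Finset (ℕ × ℕ) :=
  (Finset.Icc 1 (numSites L n) ×ˢ Finset.Icc 1 (numSites L n)).filter
    (fun p => p.1 < p.2 ∧ (p.2 = p.1 + 1 ∨ p.2 = p.1 + n))

/-- The discrete energy `(1 / n) ∑_{ {i, j} } (u_i - u_j)²`. -/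
def energy (L : ℝ) (n : ℕ) (u : ℝ → ℝ) : ℝ :=
  1 / (n : ℝ) * ∑ p ∈ bonds L n, (site n u p.1 - site n u p.2) ^ 2

/-- The functional `F_n^{L, k}` on `L^∞(0, L)`: the energy of `v` on the class of an element `v` of
`A_n(L, k)`, and `+∞` on classes without such a representative. Two elements of `A_n(L, k)` that
agree a.e. on `(0, L)` coincide (for `n ≥ 1`), so the infimum is over at most one `v`. -/
def discreteFunctional (L : ℝ) (n k : ℕ) (u : LInfty L) : ℝ≥0∞ :=
  ⨅ v ∈ {v : ℝ → ℝ | v ∈ spinFunctions L n k ∧ (u : ℝ → ℝ) =ᵐ[mu L] v},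
    ENNReal.ofReal (energy L n v)

/-- The total variation `|Du|(0, L)` of the distributional derivative of `u`: the supremum of
`∫ u φ'` over `φ ∈ C_c^1((0, L))` with `|φ| ≤ 1`. -/
def totalVar (L : ℝ) (u : ℝ → ℝ) : ℝ≥0∞ :=
  ⨆ φ ∈ {φ : ℝ → ℝ | ContDiff ℝ 1 φ ∧ HasCompactSupport φ ∧ tsupport φ ⊆ Ioo 0 L ∧
      ∀ x, |φ x| ≤ 1},
    ENNReal.ofReal (∫ x, u x * deriv φ x ∂(mu L))

/-- `u ∈ BV(0, L)`. -/
def IsBV (L : ℝ) (u : ℝ → ℝ) : Prop :=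
  Integrable u (mu L) ∧ totalVar L u < ∞

open Classical in
/-- The limit functional `F^{L, σ}`. -/
def limitFunctional (L σ : ℝ) (u : LInfty L) : ℝ≥0∞ :=
  if IsBV L u ∧ (∀ᵐ x ∂(mu L), 0 ≤ (u : ℝ → ℝ) x ∧ (u : ℝ → ℝ) x ≤ 1) ∧
      ∫ x, (u : ℝ → ℝ) x ∂(mu L) = L * σ then
    2 * volume {x : ℝ | x ∈ Ioo 0 L ∧ 0 < (u : ℝ → ℝ) x ∧ (u : ℝ → ℝ) x < 1} + totalVar L u
  else ∞

end SpinChain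

end

open MeasureTheory Filter Set
open scoped Topology ENNReal

noncomputable section

namespace SpinChain

/-! ### Splitting the bonds -/

/-! Cut the chain into about `L n` consecutive columns of `n` sites, each of length `1 / n`. Bonds
of length `n` join equal rows of neighbouring columns, and bonds of length one run along a column
and from its top to the bottom of the next. The density of ones in a column plays the role of `u`.

Lower bound. For spins in `{0, 1}` the long energy is `n ∫ |v(x + 1/n) - v(x)|`, a difference
quotient which by duality with test functions controls `|Du|` in the limit
(`integral_mul_diff_quotient_le`). For the short energy, consider windows of `n + 1` consecutive
sites. The number of jumps in a window has the parity of the difference of its end values, so a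
window with a jump contributes at least 2 to the number of jumps plus that difference. Averaging
over windows (`card_jumpWindows_le`) bounds twice the measure of the jump windows by the short
energy plus only `1 / n` of the long one, so almost nothing is taken from the variation term. Off
the jump windows the mean of `v` over length `1 / n` is 0 or 1. This mean is close in measure to the
mean over a small fixed length `h` (`slidingMean_sub_mean_le`, `volume_shift_diff_le`), which passes
to the weak limit; then `h → 0` by Lebesgue differentiation. Hence `{0 < u < 1}` is charged with
weight 2 (`two_mul_volume_add_integral_le`).

Upper bound. A BV function has pointwise variation at most `|Du|` on a set of full measure
(`exists_good_set`). Sample it there once per group of `m` columns, at a point with value 0 or 1 if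
the group has one, and fill each column from the bottom to the height `⌊n f⌋`. The long energy is
then the variation of the heights over `n`. The short energy is about `2 / n` per partially filled
column, and the sampling rule puts those columns, apart from a few, inside `{0 < f < 1}`. Rounding
costs one unit per group, so `L / m` in the energy. The number of ones is made exactly `k` by
changing heights only on a short window whose mean is strictly between 0 and 1; replacing samples by
that mean does not increase the variation (`IsRegular.exists_abs_mean_le`, `exists_heights`).
Convergence of column integrals gives weak-* convergence, and a diagonal choice removes the small
parameters. -/

theorem sum_bonds {n : ℕ} (hn : 2 ≤ n) (L : ℝ) (f : ℕ → ℕ → ℝ) :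
    ∑ p ∈ bonds L n, f p.1 p.2 =
      ∑ i ∈ Finset.Ico 1 (numSites L n), f i (i + 1) +
        ∑ i ∈ Finset.Ico 1 (numSites L n + 1 - n), f i (i + n) := by
  have h : bonds L n = (Finset.Ico 1 (numSites L n)).image (fun i => (i, i + 1)) ∪
      (Finset.Ico 1 (numSites L n + 1 - n)).image (fun i => (i, i + n)) := by
    ext ⟨p, q⟩
    simp only [bonds, Finset.mem_filter, Finset.mem_product, Finset.mem_Icc, Finset.mem_union,
      Finset.mem_image, Finset.mem_Ico, Prod.mk.injEq]
    constructor
    · rintro ⟨h1, h2, h3 | h3⟩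
      · exact Or.inl ⟨p, by omega, rfl, h3.symm⟩
      · exact Or.inr ⟨p, by omega, rfl, h3.symm⟩
    · rintro (⟨i, h1, h2, h3⟩ | ⟨i, h1, h2, h3⟩) <;> omega
  rw [h, Finset.sum_union, Finset.sum_image, Finset.sum_image]
  · intro x _ y _ hxy
    simpa using hxy
  · intro x _ y _ hxy
    simpa using hxy
  -- For `n = 1` the two families would coincide; `2 ≤ n` makes them disjoint.
  · rw [Finset.disjoint_left]
    rintro ⟨p, q⟩ h1 h2
    simp only [Finset.mem_image, Prod.mk.injEq] at h1 h2
    obtain ⟨i, _, h1, h1'⟩ := h1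
    obtain ⟨j, _, h2, h2'⟩ := h2
    omega

/-- The contribution of the bonds of length one to the energy. -/
def shortEnergy (n N : ℕ) (a : ℕ → ℝ) : ℝ :=
  1 / (n : ℝ) * ∑ i ∈ Finset.Ico 1 N, (a i - a (i + 1)) ^ 2

/-- The contribution of the bonds of length `n` to the energy. -/
def longEnergy (n N : ℕ) (a : ℕ → ℝ) : ℝ :=
  1 / (n : ℝ) * ∑ i ∈ Finset.Ico 1 (N + 1 - n), (a i - a (i + n)) ^ 2

theorem energy_eq {n : ℕ} (hn : 2 ≤ n) (L : ℝ) (u : ℝ → ℝ) :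
    energy L n u = shortEnergy n (numSites L n) (site n u) +
      longEnergy n (numSites L n) (site n u) := by
  rw [energy, sum_bonds hn L (fun i j => (site n u i - site n u j) ^ 2), mul_add]
  rfl

theorem shortEnergy_nonneg (n N : ℕ) (a : ℕ → ℝ) : 0 ≤ shortEnergy n N a :=
  mul_nonneg (by positivity) (Finset.sum_nonneg fun _ _ => sq_nonneg _)

theorem longEnergy_nonneg (n N : ℕ) (a : ℕ → ℝ) : 0 ≤ longEnergy n N a :=
  mul_nonneg (by positivity) (Finset.sum_nonneg fun _ _ => sq_nonneg _)

/-! ### Counting the jumps in a window -/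

/-- Each jump flips the spin, so the number of jumps is odd exactly when the end values differ. -/
theorem even_window_sum {a : ℕ → ℝ} {i : ℕ} (m : ℕ)
    (ha : ∀ j ∈ Finset.Icc i (i + m), a j = 0 ∨ a j = 1) :
    ∃ z : ℤ, ∑ j ∈ Finset.Ico i (i + m), (a j - a (j + 1)) ^ 2 + (a i - a (i + m)) ^ 2 =
      2 * (z : ℝ) := by
  induction m with
  | zero => exact ⟨0, by simp⟩
  | succ m ih =>
    obtain ⟨z, hz⟩ := ih fun j hj => ha j (by simp only [Finset.mem_Icc] at hj ⊢; omega)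
    have h0 := ha i (by simp)
    have h1 := ha (i + m) (by simp)
    have h2 := ha (i + m + 1) (by simp only [Finset.mem_Icc]; omega)
    rw [← add_assoc, Finset.sum_Ico_succ_top (by omega)]
    rcases h0 with h0 | h0 <;> rcases h1 with h1 | h1 <;> rcases h2 with h2 | h2 <;>
      rw [h0, h1] at hz <;> rw [h0, h1, h2]
    · exact ⟨z, by linarith⟩
    · exact ⟨z + 1, by push_cast; linarith⟩
    · exact ⟨z, by linarith⟩
    · exact ⟨z, by linarith⟩
    · exact ⟨z, by linarith⟩
    · exact ⟨z, by linarith⟩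
    · exact ⟨z + 1, by push_cast; linarith⟩
    · exact ⟨z, by linarith⟩

/-- A positive even integer is at least 2. This is the origin of the factor 2 in the limit
functional. -/
theorem two_le_window_sum {a : ℕ → ℝ} {i m : ℕ}
    (ha : ∀ j ∈ Finset.Icc i (i + m), a j = 0 ∨ a j = 1)
    (hj : ∃ j ∈ Finset.Ico i (i + m), a j ≠ a (j + 1)) :
    2 ≤ ∑ j ∈ Finset.Ico i (i + m), (a j - a (j + 1)) ^ 2 + (a i - a (i + m)) ^ 2 := by
  obtain ⟨z, hz⟩ := even_window_sum m ha
  obtain ⟨j, hj, hne⟩ := hj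
  have h1 : (a j - a (j + 1)) ^ 2 ≤ ∑ j ∈ Finset.Ico i (i + m), (a j - a (j + 1)) ^ 2 :=
    Finset.single_le_sum (f := fun j => (a j - a (j + 1)) ^ 2) (fun _ _ => sq_nonneg _) hj
  have h2 : 0 < (a j - a (j + 1)) ^ 2 := by
    have := sub_ne_zero.2 hne
    positivity
  have h3 : 0 < (z : ℝ) := by nlinarith [sq_nonneg (a i - a (i + m))]
  have h4 : 1 ≤ z := by exact_mod_cast h3
  have h5 : (1 : ℝ) ≤ z := by exact_mod_cast h4
  linarith

theorem eq_of_no_jump {a : ℕ → ℝ} {i m : ℕ}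
    (h : ¬ ∃ j ∈ Finset.Ico i (i + m), a j ≠ a (j + 1)) :
    ∀ j ∈ Finset.Icc i (i + m), a j = a i := by
  push Not at h
  intro j hj
  obtain ⟨h1, h2⟩ := Finset.mem_Icc.1 hj
  induction j, h1 using Nat.le_induction with
  | base => rfl
  | succ j hij ih =>
    rw [← h j (Finset.mem_Ico.2 ⟨hij, by omega⟩), ih (Finset.mem_Icc.2 ⟨hij, by omega⟩) (by omega)]

/-- A short bond lies in at most `n` windows: exchange the sums over the window and over the
position inside it. -/
theorem sum_windows_le {s : ℕ → ℝ} (hs : ∀ j, 0 ≤ s j) (n N : ℕ) :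
    ∑ i ∈ Finset.Ico 1 (N + 1 - n), ∑ j ∈ Finset.Ico i (i + n), s j ≤
      n * ∑ j ∈ Finset.Ico 1 N, s j := by
  have h : ∀ i, ∑ j ∈ Finset.Ico i (i + n), s j = ∑ k ∈ Finset.range n, s (i + k) := fun i => by
    rw [Finset.sum_Ico_eq_sum_range, Nat.add_sub_cancel_left]
  simp_rw [h]
  rw [Finset.sum_comm]
  calc ∑ k ∈ Finset.range n, ∑ i ∈ Finset.Ico 1 (N + 1 - n), s (i + k)
      ≤ ∑ _k ∈ Finset.range n, ∑ j ∈ Finset.Ico 1 N, s j := by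
        refine Finset.sum_le_sum fun k hk => ?_
        rw [Finset.sum_Ico_add' s]
        refine Finset.sum_le_sum_of_subset_of_nonneg ?_ fun _ _ _ => hs _
        intro j hj
        simp only [Finset.mem_Ico, Finset.mem_range] at hj hk ⊢
        omega
    _ = _ := by simp

open Classical in
/-- The sites at which a window of `n + 1` consecutive sites with a jump begins. -/
def jumpWindows (n N : ℕ) (a : ℕ → ℝ) : Finset ℕ :=
  (Finset.Ico 1 (N + 1 - n)).filter fun i => ∃ j ∈ Finset.Ico i (i + n), a j ≠ a (j + 1)

/-- Sum the parity bound over all windows. Short bonds are counted up to `n` times but long bonds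
only once, so after division by `n²` the long energy carries an extra factor `1 / n` and stays
available for the variation. -/
theorem card_jumpWindows_le {n N : ℕ} (hn : 1 ≤ n) {a : ℕ → ℝ}
    (ha : ∀ j ∈ Finset.Icc 1 N, a j = 0 ∨ a j = 1) :
    2 * (1 / (n : ℝ) ^ 2 * (jumpWindows n N a).card) ≤
      shortEnergy n N a + 1 / (n : ℝ) * longEnergy n N a := by
  classical
  have hn' : (0 : ℝ) < n := by exact_mod_cast hn
  have h1 : 2 * ((jumpWindows n N a).card : ℝ) ≤ ∑ i ∈ Finset.Ico 1 (N + 1 - n),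
      (∑ j ∈ Finset.Ico i (i + n), (a j - a (j + 1)) ^ 2 + (a i - a (i + n)) ^ 2) := by
    have : 2 * ((jumpWindows n N a).card : ℝ) = ∑ _i ∈ jumpWindows n N a, (2 : ℝ) := by
      simp [mul_comm]
    rw [this]
    calc ∑ _i ∈ jumpWindows n N a, (2 : ℝ) ≤ ∑ i ∈ jumpWindows n N a,
          (∑ j ∈ Finset.Ico i (i + n), (a j - a (j + 1)) ^ 2 + (a i - a (i + n)) ^ 2) := by
          refine Finset.sum_le_sum fun i hi => ?_
          obtain ⟨hi1, hi2⟩ := Finset.mem_filter.1 hi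
          refine two_le_window_sum (fun j hj => ha j ?_) hi2
          simp only [Finset.mem_Icc, Finset.mem_Ico] at hi1 hj ⊢
          omega
      _ ≤ _ := Finset.sum_le_sum_of_subset_of_nonneg (Finset.filter_subset _ _) fun _ _ _ =>
          add_nonneg (Finset.sum_nonneg fun _ _ => sq_nonneg _) (sq_nonneg _)
  rw [Finset.sum_add_distrib] at h1
  have h2 := sum_windows_le (s := fun j => (a j - a (j + 1)) ^ 2) (fun _ => sq_nonneg _) n N
  have h3 : 1 / (n : ℝ) ^ 2 * (2 * ((jumpWindows n N a).card : ℝ)) ≤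
      1 / (n : ℝ) ^ 2 * (n * ∑ j ∈ Finset.Ico 1 N, (a j - a (j + 1)) ^ 2 +
        ∑ i ∈ Finset.Ico 1 (N + 1 - n), (a i - a (i + n)) ^ 2) := by
    refine mul_le_mul_of_nonneg_left ?_ (by positivity)
    linarith
  calc _ = 1 / (n : ℝ) ^ 2 * (2 * ((jumpWindows n N a).card : ℝ)) := by ring
    _ ≤ _ := h3
    _ = _ := by
      rw [shortEnergy, longEnergy]
      field_simp

/-! ### Integrals of functions that are constant on cells -/

theorem integral_cells {w : ℝ} (hw : 0 ≤ w) {f : ℝ → ℝ} {c : ℕ → ℝ} {p q : ℕ} (hpq : p ≤ q)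
    (h : ∀ i ∈ Finset.Ico p q, ∀ x ∈ Ioc ((i : ℝ) * w) (((i : ℝ) + 1) * w), f x = c i) :
    IntervalIntegrable f volume (p * w) (q * w) ∧
      ∫ x in (p * w : ℝ)..(q * w), f x = w * ∑ i ∈ Finset.Ico p q, c i := by
  have hle : ∀ i : ℕ, (i : ℝ) * w ≤ ((i : ℝ) + 1) * w := fun i => by nlinarith
  have hc : ∀ i ∈ Finset.Ico p q, EqOn (fun _ => c i) f (uIoc ((i : ℝ) * w) (((i : ℝ) + 1) * w)) :=
    fun i hi x hx => by
      rw [uIoc_of_le (hle i)] at hx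
      exact (h i hi x hx).symm
  have hint : ∀ i ∈ Ico p q,
      IntervalIntegrable f volume ((fun i : ℕ => (i : ℝ) * w) i)
        ((fun i : ℕ => (i : ℝ) * w) (i + 1)) := fun i hi => by
    have h2 : IntervalIntegrable (fun _ : ℝ => c i) volume ((i : ℝ) * w) (((i : ℝ) + 1) * w) :=
      intervalIntegrable_const
    simpa using h2.congr (hc i (by simpa using hi))
  refine ⟨IntervalIntegrable.trans_iterate_Ico hpq hint, ?_⟩
  have := intervalIntegral.sum_integral_adjacent_intervals_Ico hpq hint
  rw [← this, Finset.mul_sum]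
  refine Finset.sum_congr rfl fun i hi => ?_
  push_cast
  rw [← intervalIntegral.integral_congr_ae (ae_of_all _ (hc i hi)),
    intervalIntegral.integral_const, smul_eq_mul]
  ring

/-! ### Spin functions -/

theorem mem_cell_ceil {n N : ℕ} (hn : 1 ≤ n) {x : ℝ} (hx : x ∈ Ioc (0 : ℝ) (N / (n : ℝ) ^ 2)) :
    ⌈x * (n : ℝ) ^ 2⌉₊ ∈ Finset.Icc 1 N ∧
      x ∈ Ioc (((⌈x * (n : ℝ) ^ 2⌉₊ : ℝ) - 1) / (n : ℝ) ^ 2)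
        ((⌈x * (n : ℝ) ^ 2⌉₊ : ℝ) / (n : ℝ) ^ 2) := by
  have hn' : (0 : ℝ) < (n : ℝ) ^ 2 := by positivity
  have h0 : 0 < x * (n : ℝ) ^ 2 := mul_pos hx.1 hn'
  refine ⟨Finset.mem_Icc.2 ⟨Nat.one_le_ceil_iff.2 h0, Nat.ceil_le.2 ?_⟩, ?_, ?_⟩
  · exact (le_div_iff₀ hn').1 hx.2
  · rw [div_lt_iff₀ hn']
    linarith [Nat.ceil_lt_add_one h0.le]
  · rw [le_div_iff₀ hn']
    exact Nat.le_ceil _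

variable {L : ℝ} {n k : ℕ} {v : ℝ → ℝ}

theorem spin_eq_zero_or_one (hv : v ∈ spinFunctions L n k) (x : ℝ) : v x = 0 ∨ v x = 1 := by
  by_cases hx : x ∈ Ioc (0 : ℝ) ((numSites L n : ℝ) / (n : ℝ) ^ 2)
  · exact hv.1 x hx
  · exact Or.inl (hv.2.1 x hx)

theorem spin_nonneg (hv : v ∈ spinFunctions L n k) (x : ℝ) : 0 ≤ v x := by
  rcases spin_eq_zero_or_one hv x with h | h <;> simp [h]

theorem spin_le_one (hv : v ∈ spinFunctions L n k) (x : ℝ) : v x ≤ 1 := by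
  rcases spin_eq_zero_or_one hv x with h | h <;> simp [h]

theorem site_eq_zero_or_one (hv : v ∈ spinFunctions L n k) (i : ℕ) :
    site n v i = 0 ∨ site n v i = 1 :=
  spin_eq_zero_or_one hv _

/-- Measurability is not part of `spinFunctions`; it follows because on the chain `v` is a function
of the cell index, a ceiling since the cells are closed on the right. -/
theorem measurable_spin (hn : 1 ≤ n) (hv : v ∈ spinFunctions L n k) : Measurable v := by
  have h : v = (Ioc (0 : ℝ) ((numSites L n : ℝ) / (n : ℝ) ^ 2)).indicator
      (fun x => site n v ⌈x * (n : ℝ) ^ 2⌉₊) := by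
    ext x
    by_cases hx : x ∈ Ioc (0 : ℝ) ((numSites L n : ℝ) / (n : ℝ) ^ 2)
    · obtain ⟨h1, h2⟩ := mem_cell_ceil hn hx
      rw [indicator_of_mem hx, hv.2.2.1 _ h1 _ h2]
    · rw [indicator_of_notMem hx, hv.2.1 x hx]
  rw [h]
  refine Measurable.indicator ?_ measurableSet_Ioc
  exact (measurable_from_nat (f := site n v)).comp
    (Nat.measurable_ceil.comp (measurable_id.mul_const _))

theorem integrable_spin (hn : 1 ≤ n) (hv : v ∈ spinFunctions L n k) : Integrable v := by
  have h : IntegrableOn v (Ioc (0 : ℝ) ((numSites L n : ℝ) / (n : ℝ) ^ 2)) := by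
    refine Measure.integrableOn_of_bounded (M := 1) (by simp)
      (measurable_spin hn hv).aestronglyMeasurable (ae_of_all _ fun x => ?_)
    rw [Real.norm_of_nonneg (spin_nonneg hv x)]
    exact spin_le_one hv x
  exact h.integrable_of_forall_notMem_eq_zero hv.2.1

theorem spin_cell (hv : v ∈ spinFunctions L n k) {i : ℕ}
    (hi : i < numSites L n) {x : ℝ}
    (hx : x ∈ Ioc ((i : ℝ) * (1 / (n : ℝ) ^ 2)) (((i : ℝ) + 1) * (1 / (n : ℝ) ^ 2))) :
    v x = site n v (i + 1) := by
  refine hv.2.2.1 (i + 1) (Finset.mem_Icc.2 ⟨by omega, hi⟩) x ?_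
  push_cast
  simpa [div_eq_mul_inv] using hx

theorem integral_spin_cells (hv : v ∈ spinFunctions L n k) {p q : ℕ} (hpq : p ≤ q)
    (hq : q ≤ numSites L n) :
    ∫ x in (p * (1 / (n : ℝ) ^ 2) : ℝ)..(q * (1 / (n : ℝ) ^ 2)), v x =
      1 / (n : ℝ) ^ 2 * ∑ i ∈ Finset.Ico p q, site n v (i + 1) :=
  (integral_cells (c := fun i => site n v (i + 1)) (by positivity) hpq fun i hi x hx =>
    spin_cell hv (by have := Finset.mem_Ico.1 hi; omega) hx).2

theorem numSites_le (hL : 0 ≤ L) (n : ℕ) : (numSites L n : ℝ) ≤ L * (n : ℝ) ^ 2 :=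
  Nat.floor_le (by positivity)

theorem lt_numSites_add_one (L : ℝ) (n : ℕ) : L * (n : ℝ) ^ 2 < numSites L n + 1 :=
  Nat.lt_floor_add_one _

theorem integral_spin (hL : 0 < L) (hn : 1 ≤ n) (hv : v ∈ spinFunctions L n k) :
    ∫ x, v x ∂(mu L) = k / (n : ℝ) ^ 2 := by
  have hn' : (0 : ℝ) < (n : ℝ) ^ 2 := by positivity
  have h1 : ∫ x, v x ∂(mu L) = ∫ x in Ioc 0 L, v x := integral_Ioc_eq_integral_Ioo.symm
  have hle : (numSites L n : ℝ) / (n : ℝ) ^ 2 ≤ L :=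
    (div_le_iff₀ hn').2 (numSites_le hL.le n)
  have h2 : ∫ x in Ioc 0 L, v x = ∫ x in Ioc (0 : ℝ) ((numSites L n : ℝ) / (n : ℝ) ^ 2), v x := by
    refine setIntegral_eq_of_subset_of_forall_sdiff_eq_zero measurableSet_Ioc ?_ ?_
    · exact Ioc_subset_Ioc_right hle
    · exact fun x hx => hv.2.1 x hx.2
  have h3 := integral_spin_cells hv (Nat.zero_le _) le_rfl
  rw [Nat.cast_zero, zero_mul, mul_one_div, intervalIntegral.integral_of_le (by positivity)] at h3
  rw [h1, h2, h3]
  have h4 : ∑ i ∈ Finset.Ico 0 (numSites L n), site n v (i + 1) = k := by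
    have h5 : ∑ i ∈ Finset.Icc 1 (numSites L n), site n v i =
        ((Finset.Icc 1 (numSites L n)).filter fun i => site n v i = 1).card := by
      rw [Finset.card_filter]
      push_cast
      refine Finset.sum_congr rfl fun i _ => ?_
      rcases site_eq_zero_or_one hv i with h | h <;> simp [h]
    have h6 : ((Finset.Icc 1 (numSites L n)).filter fun i => site n v i = 1).card = k := by
      rw [← hv.2.2.2, ← Set.ncard_coe_finset]
      congr 1
      ext i
      simp
    rw [Finset.sum_Ico_add' (fun i => site n v i), ← h6, ← h5]
    exact Finset.sum_congr (by ext i; simp only [Finset.mem_Ico, Finset.mem_Icc]; omega)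
      fun _ _ => rfl
  rw [h4]
  ring

/-! ### Sliding means -/

/-- The mean of `v` on `(x, x + 1 / n)`. -/
def slidingMean (n : ℕ) (v : ℝ → ℝ) (x : ℝ) : ℝ := n * ∫ y in x..(x + 1 / n), v y

/-- The right end of the set of points at which the increment of length `1 / n` lies in the
chain. -/
def shiftEnd (L : ℝ) (n : ℕ) : ℝ := ((numSites L n - n : ℕ) : ℝ) * (1 / (n : ℝ) ^ 2)

theorem shiftEnd_nonneg (L : ℝ) (n : ℕ) : 0 ≤ shiftEnd L n := by
  unfold shiftEnd
  positivity

/-- For values in `{0, 1}` the square of a difference equals its absolute value, so the long energy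
is an `L¹` difference quotient at scale `1 / n`. -/
theorem shiftEnd_integral (hn : 1 ≤ n) (hv : v ∈ spinFunctions L n k) :
    n * ∫ x in 0..shiftEnd L n, |v (x + 1 / n) - v x| =
      longEnergy n (numSites L n) (site n v) := by
  have hn' : (0 : ℝ) < n := by exact_mod_cast hn
  have h := (integral_cells (w := 1 / (n : ℝ) ^ 2) (f := fun x => |v (x + 1 / n) - v x|)
    (c := fun i => |site n v (i + n + 1) - site n v (i + 1)|) (p := 0) (q := numSites L n - n)
    (by positivity) (Nat.zero_le _) (fun i hi x hx => by
      have hi' := Finset.mem_Ico.1 hi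
      have h1 : v (x + 1 / n) = site n v (i + n + 1) := by
        refine spin_cell hv (by omega) ?_
        have : (1 : ℝ) / n = n * (1 / (n : ℝ) ^ 2) := by field_simp
        rw [this]
        push_cast
        constructor <;> nlinarith [hx.1, hx.2]
      rw [h1, spin_cell hv (by omega) hx])).2
  rw [Nat.cast_zero, zero_mul] at h
  rw [shiftEnd, h, longEnergy]
  have h2 : ∑ i ∈ Finset.Ico 0 (numSites L n - n), |site n v (i + n + 1) - site n v (i + 1)| =
      ∑ i ∈ Finset.Ico 1 (numSites L n + 1 - n), (site n v i - site n v (i + n)) ^ 2 := by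
    have h3 : Finset.Ico 1 (numSites L n + 1 - n) =
        Finset.Ico (0 + 1) (numSites L n - n + 1) := by
      ext i
      simp only [Finset.mem_Ico]
      omega
    rw [h3, ← Finset.sum_Ico_add' (fun i => (site n v i - site n v (i + n)) ^ 2)]
    refine Finset.sum_congr rfl fun i _ => ?_
    rw [add_right_comm i 1 n]
    rcases site_eq_zero_or_one hv (i + 1) with h | h <;>
      rcases site_eq_zero_or_one hv (i + n + 1) with h' | h' <;> rw [h, h'] <;> norm_num
  rw [h2]
  field_simp

/-- For `x` in cell `i`, the interval from `x` to `x + 1 / n` meets only the cells `i, …, i + n`.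
This is why windows have `n + 1` sites. -/
theorem slidingMean_of_notMem_jumpWindows (hn : 1 ≤ n) (hv : v ∈ spinFunctions L n k) {i : ℕ}
    (hi : i ∈ Finset.Ico 1 (numSites L n + 1 - n)) (hj : i ∉ jumpWindows n (numSites L n) (site n v))
    {x : ℝ} (hx : x ∈ Ioc (((i : ℝ) - 1) / (n : ℝ) ^ 2) ((i : ℝ) / (n : ℝ) ^ 2)) :
    slidingMean n v x = site n v i := by
  classical
  have hn' : (0 : ℝ) < n := by exact_mod_cast hn
  have hi' := Finset.mem_Ico.1 hi
  have hconst : ¬ ∃ j ∈ Finset.Ico i (i + n), site n v j ≠ site n v (j + 1) := fun h =>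
    hj (Finset.mem_filter.2 ⟨hi, h⟩)
  have h1 : ∀ y ∈ uIcc x (x + 1 / n), v y = site n v i := by
    intro y hy
    rw [uIcc_of_le (by linarith [one_div_pos.2 hn'])] at hy
    have h1n : (1 : ℝ) / n = n / (n : ℝ) ^ 2 := by field_simp
    have hy0 : y ∈ Ioc (0 : ℝ) ((numSites L n : ℝ) / (n : ℝ) ^ 2) := by
      constructor
      · refine lt_of_lt_of_le (lt_of_le_of_lt ?_ hx.1) hy.1
        exact div_nonneg (sub_nonneg.2 (by exact_mod_cast hi'.1)) (by positivity)
      · calc y ≤ (i : ℝ) / (n : ℝ) ^ 2 + n / (n : ℝ) ^ 2 := by linarith [hy.2, hx.2]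
          _ = ((i + n : ℕ) : ℝ) / (n : ℝ) ^ 2 := by push_cast; ring
          _ ≤ _ := by
            gcongr
            omega
    obtain ⟨h2, h3⟩ := mem_cell_ceil hn hy0
    rw [hv.2.2.1 _ h2 _ h3]
    refine eq_of_no_jump hconst _ (Finset.mem_Icc.2 ⟨?_, ?_⟩)
    · have : (i : ℝ) - 1 < ⌈y * (n : ℝ) ^ 2⌉₊ := by
        have h4 := (div_lt_iff₀ (by positivity)).1 (hx.1.trans_le hy.1)
        exact h4.trans_le (Nat.le_ceil _)
      have h5 : (i : ℝ) < (⌈y * (n : ℝ) ^ 2⌉₊ + 1 : ℕ) := by push_cast; linarith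
      have h6 : i < ⌈y * (n : ℝ) ^ 2⌉₊ + 1 := by exact_mod_cast h5
      omega
    · refine Nat.ceil_le.2 ?_
      rw [← le_div_iff₀ (by positivity)]
      push_cast
      rw [add_div, ← h1n]
      linarith [hy.2, hx.2]
  rw [slidingMean, intervalIntegral.integral_congr h1, intervalIntegral.integral_const, smul_eq_mul]
  field_simp
  ring

theorem volume_slidingMean_le (hn : 1 ≤ n) (hv : v ∈ spinFunctions L n k) :
    volume {x | x ∈ Ioc 0 (shiftEnd L n) ∧ 0 < slidingMean n v x ∧ slidingMean n v x < 1} ≤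
      ENNReal.ofReal (1 / (n : ℝ) ^ 2 * (jumpWindows n (numSites L n) (site n v)).card) := by
  have hn' : (0 : ℝ) < n := by exact_mod_cast hn
  have hsub : {x | x ∈ Ioc 0 (shiftEnd L n) ∧ 0 < slidingMean n v x ∧ slidingMean n v x < 1} ⊆
      ⋃ i ∈ jumpWindows n (numSites L n) (site n v),
        Ioc (((i : ℝ) - 1) / (n : ℝ) ^ 2) ((i : ℝ) / (n : ℝ) ^ 2) := by
    rintro x ⟨hx, h0, h1⟩
    rw [shiftEnd, mul_one_div] at hx
    obtain ⟨h2, h3⟩ := mem_cell_ceil hn hx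
    simp only [mem_iUnion]
    refine ⟨_, ?_, h3⟩
    by_contra hj
    have h4 := slidingMean_of_notMem_jumpWindows hn hv
      (Finset.mem_Ico.2 (by have := Finset.mem_Icc.1 h2; omega)) hj h3
    rcases site_eq_zero_or_one hv ⌈x * (n : ℝ) ^ 2⌉₊ with h | h <;> rw [h] at h4 <;> linarith
  refine (measure_mono hsub).trans ((measure_biUnion_finset_le _ _).trans ?_)
  have h5 : ∀ i : ℕ, volume (Ioc (((i : ℝ) - 1) / (n : ℝ) ^ 2) ((i : ℝ) / (n : ℝ) ^ 2)) =
      ENNReal.ofReal (1 / (n : ℝ) ^ 2) := fun i => by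
    rw [Real.volume_Ioc]
    congr 1
    ring
  simp_rw [h5]
  rw [Finset.sum_const, nsmul_eq_mul, mul_comm (1 / (n : ℝ) ^ 2),
    ENNReal.ofReal_mul (by positivity), ENNReal.ofReal_natCast]

/-- Up to a remainder shorter than `1 / n`, the interval of length `h` is a union of windows of
length `1 / n`. The means of two such windows starting in it differ by at most the integral of the
difference quotient between their left ends. -/
theorem slidingMean_sub_mean_le (hn : 1 ≤ n) (hv : v ∈ spinFunctions L n k) {x h : ℝ}
    (hh : 0 < h) :
    |slidingMean n v x - 1 / h * ∫ y in x..(x + h), v y| ≤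
      n * (∫ y in x..(x + h), |v (y + 1 / n) - v y|) + 1 / (n * h) := by
  have hn' : (0 : ℝ) < n := by exact_mod_cast hn
  have hvi := integrable_spin hn hv
  have hi : ∀ a b : ℝ, IntervalIntegrable v volume a b := fun a b => hvi.intervalIntegrable
  have hvs : Integrable (fun y => v (y + 1 / n)) := hvi.comp_add_right _
  have hd : Integrable (fun y => |v (y + 1 / n) - v y|) := (hvs.sub hvi).abs
  set D := ∫ y in x..(x + h), |v (y + 1 / n) - v y| with hD
  have hD0 : 0 ≤ D := intervalIntegral.integral_nonneg (by linarith) fun _ _ => abs_nonneg _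
  -- comparison of the means of two windows
  have key : ∀ t, 0 ≤ t → t ≤ h → |slidingMean n v (x + t) - slidingMean n v x| ≤ n * D := by
    intro t ht0 hth
    -- The difference of the two window integrals equals the difference of the integrals over the
    -- right-hand and left-hand intervals of length `t`.
    have e1 : slidingMean n v (x + t) - slidingMean n v x =
        n * ∫ y in x..(x + t), (v (y + 1 / n) - v y) := by
      rw [intervalIntegral.integral_sub hvs.intervalIntegrable (hi _ _),
        intervalIntegral.integral_comp_add_right (fun y => v y), slidingMean, slidingMean, ← mul_sub]
      congr 1
      have a1 := intervalIntegral.integral_add_adjacent_intervals (hi x (x + t))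
        (hi (x + t) (x + t + 1 / n))
      have a2 := intervalIntegral.integral_add_adjacent_intervals (hi x (x + 1 / n))
        (hi (x + 1 / n) (x + t + 1 / n))
      linarith
    rw [e1, abs_mul, abs_of_pos hn']
    refine mul_le_mul_of_nonneg_left ?_ hn'.le
    refine (intervalIntegral.abs_integral_le_integral_abs (by linarith)).trans ?_
    have a3 := intervalIntegral.integral_add_adjacent_intervals
      (hd.intervalIntegrable (a := x) (b := x + t))
      (hd.intervalIntegrable (a := x + t) (b := x + h))
    have a4 : 0 ≤ ∫ y in (x + t)..(x + h), |v (y + 1 / n) - v y| :=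
      intervalIntegral.integral_nonneg (by linarith) fun _ _ => abs_nonneg _
    linarith
  set m := ⌊h * n⌋₊ with hm
  have hm1 : (m : ℝ) ≤ h * n := Nat.floor_le (by positivity)
  have hm2 : h * n < m + 1 := Nat.lt_floor_add_one _
  have hmh : (m : ℝ) * (1 / n) ≤ h := by rw [mul_one_div, div_le_iff₀ hn']; exact hm1
  have hmh' : h ≤ (m : ℝ) * (1 / n) + 1 / n := by
    rw [mul_one_div, ← add_div, le_div_iff₀ hn']; exact hm2.le
  have hsum : ∑ j ∈ Finset.range m, ∫ y in (x + j * (1 / n))..(x + (j + 1 : ℕ) * (1 / n)), v y =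
      ∫ y in (x + (0 : ℕ) * (1 / n))..(x + m * (1 / n)), v y :=
    intervalIntegral.sum_integral_adjacent_intervals (a := fun j : ℕ => x + j * (1 / (n : ℝ)))
      fun j _ => hi _ _
  have hterm : ∀ j : ℕ, ∫ y in (x + j * (1 / n))..(x + (j + 1 : ℕ) * (1 / n)), v y =
      1 / n * slidingMean n v (x + j * (1 / n)) := fun j => by
    rw [slidingMean, ← mul_assoc, one_div_mul_cancel hn'.ne', one_mul]
    congr 1
    push_cast
    ring
  simp_rw [hterm] at hsum
  rw [Nat.cast_zero, zero_mul, add_zero] at hsum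
  set R := ∫ y in (x + m * (1 / n))..(x + h), v y with hR
  have hsplit : ∫ y in x..(x + h), v y = (∫ y in x..(x + m * (1 / n)), v y) + R := by
    rw [hR, intervalIntegral.integral_add_adjacent_intervals (hi _ _) (hi _ _)]
  have hR0 : 0 ≤ R := intervalIntegral.integral_nonneg (by linarith) fun _ _ => spin_nonneg hv _
  have hw0 : ∀ z, 0 ≤ slidingMean n v z := fun z => mul_nonneg hn'.le
    (intervalIntegral.integral_nonneg (by linarith [one_div_pos.2 hn']) fun _ _ => spin_nonneg hv _)
  have hI : ∀ a b : ℝ, a ≤ b → ∫ y in a..b, v y ≤ b - a := fun a b hab => by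
    have := intervalIntegral.integral_mono_on hab (hi a b) (intervalIntegrable_const (c := (1 : ℝ)))
      fun y _ => spin_le_one hv y
    simpa using this
  have hw1 : ∀ z, slidingMean n v z ≤ 1 := fun z => by
    have := mul_le_mul_of_nonneg_left (hI z (z + 1 / n) (by linarith [one_div_pos.2 hn'])) hn'.le
    rw [add_sub_cancel_left, mul_one_div_cancel hn'.ne'] at this
    exact this
  have hR1 : R ≤ 1 / n := (hI _ _ (by linarith)).trans (by linarith)
  have hdiff : |∑ j ∈ Finset.range m, (1 / n * slidingMean n v (x + j * (1 / n)) -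
      1 / n * slidingMean n v x)| ≤ h * (n * D) := by
    refine (Finset.abs_sum_le_sum_abs _ _).trans ?_
    calc ∑ j ∈ Finset.range m, |1 / n * slidingMean n v (x + j * (1 / n)) -
          1 / n * slidingMean n v x| ≤ ∑ _j ∈ Finset.range m, 1 / n * (n * D) := by
          refine Finset.sum_le_sum fun j hj => ?_
          rw [← mul_sub, abs_mul, abs_of_pos (one_div_pos.2 hn')]
          refine mul_le_mul_of_nonneg_left (key _ (by positivity) ?_) (by positivity)
          refine le_trans ?_ hmh
          gcongr
          exact (Finset.mem_range.1 hj).le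
      _ = (m * (1 / n)) * (n * D) := by simp [mul_assoc]
      _ ≤ _ := by gcongr
  rw [Finset.sum_sub_distrib, hsum] at hdiff
  simp only [Finset.sum_const, Finset.card_range, nsmul_eq_mul] at hdiff
  set M := slidingMean n v x
  set A := ∫ y in x..(x + m * (1 / n)), v y
  -- `h M` is split into the part matching the `m` full windows and the part matching the remainder
  -- `R`.
  have e2 : M - 1 / h * (A + R) = 1 / h * (-(A - m * (1 / n * M)) + ((h - m * (1 / n)) * M - R)) := by
    field_simp
    ring
  have hq : |(h - m * (1 / n)) * M - R| ≤ 1 / n := by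
    have b1 : 0 ≤ (h - m * (1 / n)) * M := mul_nonneg (by linarith) (hw0 x)
    have b2 : (h - m * (1 / n)) * M ≤ 1 / n * 1 :=
      mul_le_mul (by linarith) (hw1 x) (hw0 x) (by positivity)
    rw [abs_le]
    constructor <;> linarith
  rw [hsplit, e2, abs_mul, abs_of_pos (one_div_pos.2 hh)]
  calc 1 / h * |-(A - m * (1 / n * M)) + ((h - m * (1 / n)) * M - R)|
      ≤ 1 / h * (h * (n * D) + 1 / n) := by
        refine mul_le_mul_of_nonneg_left ((abs_add_le _ _).trans ?_) (by positivity)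
        rw [abs_neg]
        exact add_le_add hdiff hq
    _ = _ := by field_simp

/-! ### The shift estimate -/

/-- The running integral is the convolution of `f` with the indicator of `[-h, 0)`, so Fubini is
contained in the integral of a convolution. -/
theorem integral_integral_shift {f : ℝ → ℝ} (hf : Integrable f) {h : ℝ} (hh : 0 ≤ h) :
    Integrable (fun x => ∫ y in x..(x + h), f y) ∧
      ∫ x, ∫ y in x..(x + h), f y = h * ∫ y, f y := by
  set g : ℝ → ℝ := (Ico (-h) 0).indicator 1 with hg
  have hgi : Integrable g := (integrable_indicator_iff measurableSet_Ico).2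
    (integrableOn_const (by simp) (by simp))
  have hgI : ∫ t, g t = h := by
    rw [hg, integral_indicator_one measurableSet_Ico, Measure.real, Real.volume_Ico]
    simp [hh]
  have hconv : (fun x => ∫ y in x..(x + h), f y) =
      convolution f g (ContinuousLinearMap.mul ℝ ℝ) volume := by
    ext x
    rw [convolution, intervalIntegral.integral_of_le (by linarith),
      ← integral_indicator measurableSet_Ioc]
    congr 1
    ext t
    simp only [ContinuousLinearMap.mul_apply', hg, indicator, mem_Ioc, mem_Ico, Pi.one_apply]
    have : (x < t ∧ t ≤ x + h) ↔ (-h ≤ x - t ∧ x - t < 0) := by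
      constructor <;> rintro ⟨h1, h2⟩ <;> constructor <;> linarith
    simp [this]
  rw [hconv]
  refine ⟨hf.integrable_convolution _ hgi, ?_⟩
  rw [integral_convolution _ hf hgi, hgI]
  simp [mul_comm]

variable {L : ℝ} {n k : ℕ} {v : ℝ → ℝ}

theorem integrable_shift_diff (hn : 1 ≤ n) (hv : v ∈ spinFunctions L n k) :
    Integrable (fun y => |v (y + 1 / n) - v y|) :=
  (((integrable_spin hn hv).comp_add_right _).sub (integrable_spin hn hv)).abs

/-- Markov's inequality for the running integral of the difference quotient, whose total integral is
`h` times the long energy. -/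
theorem volume_shift_diff_le (hn : 1 ≤ n) (hv : v ∈ spinFunctions L n k) {h δ : ℝ} (hh : 0 < h)
    (hδ : 0 < δ) :
    volume.real {x | x ∈ Ioo 0 (shiftEnd L n - h) ∧
        δ ≤ n * ∫ y in x..(x + h), |v (y + 1 / n) - v y|} ≤
      h / δ * longEnergy n (numSites L n) (site n v) := by
  have hn' : (0 : ℝ) < n := by exact_mod_cast hn
  -- The cut-off removes the differences created by extending `v` by zero at the two ends of the
  -- chain; they are not bonds.
  set d : ℝ → ℝ := fun y => n * (Ioc 0 (shiftEnd L n)).indicator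
    (fun y => |v (y + 1 / n) - v y|) y with hd
  have hdi : Integrable d :=
    ((integrable_shift_diff hn hv).indicator measurableSet_Ioc).const_mul _
  have hd0 : ∀ y, 0 ≤ d y := fun y =>
    mul_nonneg hn'.le (indicator_nonneg (fun _ _ => abs_nonneg _) _)
  have hdI : ∫ y, d y = longEnergy n (numSites L n) (site n v) := by
    rw [integral_const_mul, integral_indicator measurableSet_Ioc,
      ← intervalIntegral.integral_of_le (shiftEnd_nonneg L n), shiftEnd_integral hn hv]
  obtain ⟨h1, h2⟩ := integral_integral_shift hdi hh.le
  have h3 := mul_meas_ge_le_integral_of_nonneg (ae_of_all volume fun x =>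
    intervalIntegral.integral_nonneg (by linarith : x ≤ x + h) fun y _ => hd0 y) h1 δ
  rw [h2, hdI] at h3
  have hfin : volume {x | δ ≤ ∫ y in x..(x + h), d y} ≠ ∞ :=
    (h1.measure_ge_lt_top hδ).ne
  have hsub : {x | x ∈ Ioo 0 (shiftEnd L n - h) ∧
      δ ≤ n * ∫ y in x..(x + h), |v (y + 1 / n) - v y|} ⊆ {x | δ ≤ ∫ y in x..(x + h), d y} := by
    rintro x ⟨hx, hx'⟩
    refine hx'.trans_eq ?_
    rw [← intervalIntegral.integral_const_mul]
    refine intervalIntegral.integral_congr fun y hy => ?_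
    rw [uIcc_of_le (by linarith)] at hy
    simp only [hd]
    have hy' : y ∈ Ioc 0 (shiftEnd L n) := ⟨hx.1.trans_le hy.1, by linarith [hy.2, hx.2]⟩
    rw [indicator_of_mem hy']
  refine (measureReal_mono hsub hfin).trans ?_
  rw [div_mul_eq_mul_div, le_div_iff₀ hδ, mul_comm]
  exact h3

/-- Discrete integration by parts moves the difference quotient from `φ` to `v`. The support
condition on `φ` excludes contributions from the ends of the chain. -/
theorem integral_mul_diff_quotient_le (hn : 1 ≤ n) (hv : v ∈ spinFunctions L n k) {φ : ℝ → ℝ}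
    (hφ : Continuous φ) (hφ1 : ∀ x, |φ x| ≤ 1) (hsupp : ∀ x ∉ Ioc 0 (shiftEnd L n), φ x = 0) :
    ∫ y, v y * (n * (φ y - φ (y - 1 / n))) ≤ longEnergy n (numSites L n) (site n v) := by
  have hn' : (0 : ℝ) < n := by exact_mod_cast hn
  have hvi := integrable_spin hn hv
  have hvs : Integrable (fun y => v (y + 1 / n)) := hvi.comp_add_right _
  have hm : ∀ {f ψ : ℝ → ℝ}, Integrable f → Continuous ψ → (∀ x, |ψ x| ≤ 1) →
      Integrable (fun y => f y * ψ y) := fun hf hψ hψ1 =>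
    hf.mul_bdd (c := 1) hψ.aestronglyMeasurable (ae_of_all _ hψ1)
  have e1 : ∫ y, v y * φ (y - 1 / n) = ∫ y, v (y + 1 / n) * φ y := by
    rw [← integral_add_right_eq_self (fun y => v y * φ (y - 1 / n)) (1 / n)]
    simp
  have i1 := hm hvi hφ hφ1
  have i2 : Integrable fun y => v y * φ (y - 1 / n) := hm hvi (hφ.comp (continuous_sub_right (1 / (n : ℝ)))) fun x => hφ1 _
  have i3 := hm hvs hφ hφ1
  have e2 : ∫ y, v y * (n * (φ y - φ (y - 1 / n))) =
      ∫ y, n * ((v y - v (y + 1 / n)) * φ y) := by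
    calc ∫ y, v y * (n * (φ y - φ (y - 1 / n))) =
        ∫ y, n * (v y * φ y - v y * φ (y - 1 / n)) := by congr 1; ext y; ring
      _ = n * ((∫ y, v y * φ y) - ∫ y, v y * φ (y - 1 / n)) := by
        rw [integral_const_mul]
        congr 1
        exact integral_sub i1 i2
      _ = n * ∫ y, (v y * φ y - v (y + 1 / n) * φ y) := by rw [e1, integral_sub i1 i3]
      _ = _ := by
        rw [integral_const_mul]
        congr 2
        ext y
        ring
  have hdi := (integrable_shift_diff hn hv).indicator (measurableSet_Ioc (a := 0)
    (b := shiftEnd L n))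
  rw [e2, ← shiftEnd_integral hn hv, intervalIntegral.integral_of_le (shiftEnd_nonneg L n),
    ← integral_indicator measurableSet_Ioc, ← integral_const_mul]
  refine integral_mono ((hm (hvi.sub hvs) hφ hφ1).const_mul _) (hdi.const_mul _) fun y => ?_
  refine mul_le_mul_of_nonneg_left ?_ hn'.le
  by_cases hy : y ∈ Ioc 0 (shiftEnd L n)
  · rw [indicator_of_mem hy, abs_sub_comm]
    refine (le_abs_self _).trans ?_
    rw [abs_mul]
    exact mul_le_of_le_one_right (abs_nonneg _) (hφ1 y)
  · rw [indicator_of_notMem hy, hsupp y hy, mul_zero]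

/-! ### The liminf inequality -/

theorem shiftEnd_ge (L : ℝ) {n : ℕ} (hn : 1 ≤ n) : L - 2 / n ≤ shiftEnd L n := by
  have hn' : (1 : ℝ) ≤ n := by exact_mod_cast hn
  have h1 : (numSites L n : ℝ) - n ≤ ((numSites L n - n : ℕ) : ℝ) := by
    rw [sub_le_iff_le_add]
    have : numSites L n ≤ numSites L n - n + n := by omega
    exact_mod_cast this
  have h2 := lt_numSites_add_one L n
  rw [shiftEnd, mul_one_div, le_div_iff₀ (by positivity)]
  have h3 : (L - 2 / n) * (n : ℝ) ^ 2 = L * (n : ℝ) ^ 2 - 2 * n := by field_simp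
  rw [h3]
  linarith

theorem tendsto_shiftEnd_ge (L : ℝ) {ns : ℕ → ℕ} (hns : Tendsto ns atTop atTop) {b : ℝ}
    (hb : b < L) : ∀ᶠ j in atTop, b ≤ shiftEnd L (ns j) := by
  have h1 : Tendsto (fun j => 2 / (ns j : ℝ)) atTop (𝓝 0) :=
    (tendsto_const_div_atTop_nhds_zero_nat 2).comp hns
  filter_upwards [h1.eventually (gt_mem_nhds (sub_pos.2 hb)), hns.eventually_ge_atTop 1] with j h2 h3
  linarith [shiftEnd_ge L h3]

theorem ae_mu_le {L : ℝ} : ∀ᵐ x ∂(mu L), x ∈ Ioo 0 L := ae_restrict_mem measurableSet_Ioo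

section Liminf

variable {L c : ℝ} {ns ks : ℕ → ℕ} {v : ℕ → ℝ → ℝ} {u : ℝ → ℝ}

/-- The convergence of a sequence of functions tested against `L^1(0, L)`. -/
def TestTendsto (L : ℝ) (v : ℕ → ℝ → ℝ) (u : ℝ → ℝ) : Prop :=
  ∀ g : ℝ → ℝ, Integrable g (mu L) →
    Tendsto (fun j => ∫ x, v j x * g x ∂(mu L)) atTop (𝓝 (∫ x, u x * g x ∂(mu L)))

theorem integral_spin_mul_eq {n k : ℕ} {v : ℝ → ℝ} (hL : 0 < L) (hn : 1 ≤ n)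
    (hv : v ∈ spinFunctions L n k) (g : ℝ → ℝ) :
    ∫ x, v x * g x = ∫ x, v x * g x ∂(mu L) := by
  have h1 : ∫ x, v x * g x ∂(mu L) = ∫ x in Ioc 0 L, v x * g x :=
    integral_Ioc_eq_integral_Ioo.symm
  rw [h1]
  refine (setIntegral_eq_integral_of_forall_compl_eq_zero fun x hx => ?_).symm
  rw [hv.2.1 x, zero_mul]
  refine fun h => hx ⟨h.1, h.2.trans ?_⟩
  rw [div_le_iff₀ (by positivity)]
  exact numSites_le hL.le n

/-- The difference quotients of `φ` are bounded by its Lipschitz constant and converge pointwise,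
hence in `L¹(0, L)`. As `0 ≤ v j ≤ 1`, they may be replaced by `deriv φ`, which is an admissible
fixed test function. -/
theorem tendsto_integral_diff_quotient (hL : 0 < L) (hns : Tendsto ns atTop atTop)
    (hv : ∀ j, v j ∈ spinFunctions L (ns j) (ks j)) (hconv : TestTendsto L v u) {φ : ℝ → ℝ}
    (hφ : ContDiff ℝ 1 φ) (hφc : HasCompactSupport φ) :
    Tendsto (fun j => ∫ y, v j y * (ns j * (φ y - φ (y - 1 / ns j)))) atTop
      (𝓝 (∫ x, u x * deriv φ x ∂(mu L))) := by
  have hdc : Continuous (deriv φ) := hφ.continuous_deriv le_rfl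
  have hdi : Integrable (deriv φ) (mu L) :=
    (hdc.integrable_of_hasCompactSupport hφc.deriv).restrict
  obtain ⟨C, hC⟩ := hφ.lipschitzWith_of_hasCompactSupport hφc one_ne_zero
  have hdb : ∀ y, |deriv φ y| ≤ C := fun y => norm_deriv_le_of_lipschitz hC
  have hqm : ∀ j, AEStronglyMeasurable (fun y => (ns j : ℝ) * (φ y - φ (y - 1 / ns j)) - deriv φ y)
      (mu L) := fun j => by
    have := hφ.continuous
    exact Continuous.aestronglyMeasurable (by fun_prop)
  have hqb : ∀ j, 1 ≤ ns j → ∀ y, |(ns j : ℝ) * (φ y - φ (y - 1 / ns j)) - deriv φ y| ≤ 2 * C := by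
    intro j hj y
    have hn' : (0 : ℝ) < ns j := by exact_mod_cast hj
    have h1 := hC.dist_le_mul y (y - 1 / ns j)
    rw [Real.dist_eq, Real.dist_eq, sub_sub_cancel, abs_of_pos (one_div_pos.2 hn')] at h1
    refine (abs_sub _ _).trans ?_
    rw [abs_mul, abs_of_pos hn', two_mul]
    refine add_le_add ?_ (hdb y)
    calc (ns j : ℝ) * |φ y - φ (y - 1 / ns j)| ≤ ns j * (C * (1 / ns j)) := by gcongr
      _ = C := by field_simp
  have hev := hns.eventually_ge_atTop 1
  have hlim : Tendsto (fun j => ∫ y, |(ns j : ℝ) * (φ y - φ (y - 1 / ns j)) - deriv φ y| ∂(mu L))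
      atTop (𝓝 0) := by
    have := tendsto_integral_filter_of_dominated_convergence (μ := mu L) (l := atTop)
      (F := fun j y => |(ns j : ℝ) * (φ y - φ (y - 1 / ns j)) - deriv φ y|)
      (f := fun _ => (0 : ℝ)) (fun _ => 2 * (C : ℝ)) (Eventually.of_forall fun j => (hqm j).norm)
      (hev.mono fun j hj => ae_of_all _ fun y => by simpa using hqb j hj y)
      (integrable_const _) (ae_of_all _ fun y => ?_)
    · simpa using this
    · have h1 : HasDerivAt φ (deriv φ y) y :=
        (hφ.differentiable one_ne_zero y).hasDerivAt
      have h2 : Tendsto (fun j => y - 1 / (ns j : ℝ)) atTop (𝓝[≠] y) := by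
        refine tendsto_nhdsWithin_iff.2 ⟨?_, hev.mono fun j hj => ?_⟩
        · have h3 : Tendsto (fun j => 1 / (ns j : ℝ)) atTop (𝓝 0) :=
            (tendsto_const_div_atTop_nhds_zero_nat 1).comp hns
          simpa using tendsto_const_nhds.sub h3
        · have hn' : (0 : ℝ) < ns j := by exact_mod_cast hj
          have := one_div_pos.2 hn'
          exact (by linarith : y - 1 / (ns j : ℝ) < y).ne
      have h3 := (hasDerivAt_iff_tendsto_slope.1 h1).comp h2
      have h4 : Tendsto (fun j => (ns j : ℝ) * (φ y - φ (y - 1 / ns j))) atTop (𝓝 (deriv φ y)) := by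
        refine h3.congr' (hev.mono fun j hj => ?_)
        have hn' : (0 : ℝ) < ns j := by exact_mod_cast hj
        simp only [Function.comp, slope_def_field]
        field_simp
        ring
      simpa using (h4.sub_const (deriv φ y)).abs
  have hmain := hconv (deriv φ) hdi
  have hzero : Tendsto (fun j => ∫ y, v j y * (ns j * (φ y - φ (y - 1 / ns j))) ∂(mu L) -
      ∫ y, v j y * deriv φ y ∂(mu L)) atTop (𝓝 0) := by
    refine squeeze_zero_norm' (hev.mono fun j hj => ?_) hlim
    have hvb : ∀ᵐ y ∂(mu L), ‖v j y‖ ≤ 1 := ae_of_all _ fun y => by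
      rw [Real.norm_of_nonneg (spin_nonneg (hv j) y)]
      exact spin_le_one (hv j) y
    have hvm : AEStronglyMeasurable (v j) (mu L) :=
      (measurable_spin hj (hv j)).aestronglyMeasurable
    have i0 : Integrable (fun y => (ns j : ℝ) * (φ y - φ (y - 1 / ns j)) - deriv φ y) (mu L) :=
      Integrable.of_bound (hqm j) (2 * C) (ae_of_all _ (hqb j hj))
    have i1 : Integrable (fun y => v j y * (ns j * (φ y - φ (y - 1 / ns j)))) (mu L) := by
      refine Integrable.bdd_mul (c := 1) ?_ hvm hvb
      exact (i0.add hdi).congr (ae_of_all _ fun y => by simp)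
    have i2 : Integrable (fun y => v j y * deriv φ y) (mu L) := hdi.bdd_mul hvm hvb
    rw [← integral_sub i1 i2]
    refine (norm_integral_le_integral_norm _).trans (integral_mono (i1.sub i2).norm i0.norm ?_)
    intro y
    simp only [Real.norm_eq_abs]
    rw [← mul_sub, abs_mul, abs_of_nonneg (spin_nonneg (hv j) y)]
    exact mul_le_of_le_one_left (abs_nonneg _) (spin_le_one (hv j) y)
  have hsum := hzero.add hmain
  rw [zero_add] at hsum
  refine hsum.congr' (hev.mono fun j hj => ?_)
  rw [sub_add_cancel]
  exact (integral_spin_mul_eq hL hj (hv j) _).symm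

theorem tendsto_mean (hconv : TestTendsto L v u) {x h : ℝ} (hh : 0 < h) (hx : 0 ≤ x)
    (hxh : x + h < L) :
    Tendsto (fun j => 1 / h * ∫ y in x..(x + h), v j y) atTop
      (𝓝 (1 / h * ∫ y in x..(x + h), u y)) := by
  have key : ∀ f : ℝ → ℝ, ∫ y, f y * (Ioc x (x + h)).indicator (fun _ => 1 / h) y ∂(mu L) =
      1 / h * ∫ y in x..(x + h), f y := fun f => by
    have h1 : (fun y => f y * (Ioc x (x + h)).indicator (fun _ => 1 / h) y) =
        (Ioc x (x + h)).indicator (fun y => 1 / h * f y) := by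
      ext y
      by_cases hy : y ∈ Ioc x (x + h) <;> simp [hy, mul_comm]
    have hsub : Ioc x (x + h) ⊆ Ioo 0 L := fun y hy => ⟨hx.trans_lt hy.1, hy.2.trans_lt hxh⟩
    rw [h1, integral_indicator measurableSet_Ioc, Measure.restrict_restrict measurableSet_Ioc,
      inter_eq_left.2 hsub, integral_const_mul,
      intervalIntegral.integral_of_le (by linarith)]
  have := hconv _ ((integrable_const (1 / h)).indicator (measurableSet_Ioc (a := x) (b := x + h)))
  simpa only [key] using this

theorem continuous_mean {f : ℝ → ℝ} (hf : Integrable f) (h : ℝ) :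
    Continuous fun x => 1 / h * ∫ y in x..(x + h), f y := by
  have h1 : Continuous fun x => ∫ y in (0 : ℝ)..x, f y :=
    intervalIntegral.continuous_primitive (fun _ _ => hf.intervalIntegrable) 0
  have h2 : (fun x => 1 / h * ∫ y in x..(x + h), f y) =
      fun x => 1 / h * ((∫ y in (0 : ℝ)..(x + h), f y) - ∫ y in (0 : ℝ)..x, f y) := by
    ext x
    rw [intervalIntegral.integral_interval_sub_left hf.intervalIntegrable hf.intervalIntegrable]
  rw [h2]
  fun_prop

/-- Lebesgue differentiation gives convergence almost everywhere, hence in measure on a bounded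
interval. -/
theorem tendsto_volume_mean_sub {f : ℝ → ℝ} (hf : Integrable f) (b : ℝ) {δ : ℝ} (hδ : 0 < δ) :
    Tendsto (fun i : ℕ => (mu b).real {x | δ ≤ ‖1 / (1 / ((i : ℝ) + 1)) *
      (∫ y in x..(x + 1 / ((i : ℝ) + 1)), f y) - f x‖}) atTop (𝓝 0) := by
  refine tendstoInMeasure_iff_measureReal_norm.1 (tendstoInMeasure_of_tendsto_ae
    (fun i => (continuous_mean hf _).aestronglyMeasurable) (ae_restrict_of_ae ?_)) δ hδ
  filter_upwards [LocallyIntegrable.ae_hasDerivAt_integral hf.locallyIntegrable] with x hx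
  have h1 := hasDerivAt_iff_tendsto_slope.1 (hx x)
  have h2 : Tendsto (fun i : ℕ => x + 1 / ((i : ℝ) + 1)) atTop (𝓝[≠] x) := by
    refine tendsto_nhdsWithin_iff.2 ⟨?_, Eventually.of_forall fun i => ?_⟩
    · simpa using tendsto_const_nhds.add (tendsto_one_div_add_atTop_nhds_zero_nat (𝕜 := ℝ))
    · have : (0 : ℝ) < 1 / ((i : ℝ) + 1) := by positivity
      exact (by linarith : x < x + 1 / ((i : ℝ) + 1)).ne'
  refine (h1.comp h2).congr fun i => ?_
  simp only [Function.comp, slope_def_field]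
  rw [intervalIntegral.integral_same, sub_zero, add_sub_cancel_left]
  ring

/-- The main estimate: the measure of the region where `u` is bounded away from `0` and `1`
and the variation of `u` are controlled by a bound on the energies. -/
theorem two_mul_volume_add_integral_le (hL : 0 < L) (hns : Tendsto ns atTop atTop)
    (hv : ∀ j, v j ∈ spinFunctions L (ns j) (ks j)) (hE : ∀ j, energy L (ns j) (v j) ≤ c)
    (hui : Integrable u (mu L)) (hconv : TestTendsto L v u) {φ : ℝ → ℝ} (hφ : ContDiff ℝ 1 φ)
    (hφc : HasCompactSupport φ) (hφs : tsupport φ ⊆ Ioo 0 L) (hφ1 : ∀ x, |φ x| ≤ 1) {δ : ℝ}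
    (hδ : 0 < δ) :
    2 * volume.real {x | x ∈ Ioo 0 (L - δ) ∧ δ ≤ u x ∧ u x ≤ 1 - δ} +
      ∫ x, u x * deriv φ x ∂(mu L) ≤ c := by
  -- `u` carries information only on `(0, L)`. The extension by zero is integrable on the line, so
  -- its means are continuous and differentiation applies.
  set u0 : ℝ → ℝ := (Ioo 0 L).indicator u with hu0
  have hu0i : Integrable u0 := (integrable_indicator_iff measurableSet_Ioo).2 hui
  set S := {x | x ∈ Ioo 0 (L - δ) ∧ δ ≤ u x ∧ u x ≤ 1 - δ} with hS
  have hu0eq : ∀ x ∈ Ioo 0 (L - δ), u0 x = u x := fun x hx =>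
    indicator_of_mem (show x ∈ Ioo 0 L from ⟨hx.1, by linarith [hx.2]⟩) _
  have hconv0 : TestTendsto L v u0 := fun g hg => by
    have : ∫ x, u0 x * g x ∂(mu L) = ∫ x, u x * g x ∂(mu L) := by
      refine integral_congr_ae (ae_mu_le.mono fun x hx => ?_)
      simp only [hu0, indicator_of_mem hx]
    rw [this]
    exact hconv g hg
  have hI := tendsto_integral_diff_quotient hL hns hv hconv hφ hφc
  have hev := hns.eventually_ge_atTop 2
  have hinv : Tendsto (fun j => 1 / (ns j : ℝ)) atTop (𝓝 0) :=
    (tendsto_const_div_atTop_nhds_zero_nat 1).comp hns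
  -- The largest point of the compact support is below `L`, while `shiftEnd` is eventually above
  -- every number below `L`.
  have hsuppev : ∀ᶠ j in atTop, ∀ x ∉ Ioc 0 (shiftEnd L (ns j)), φ x = 0 := by
    rcases (tsupport φ).eq_empty_or_nonempty with he | hne
    · refine Eventually.of_forall fun j x _ => image_eq_zero_of_notMem_tsupport ?_
      simp [he]
    · obtain ⟨b, hb, hmax⟩ := IsCompact.exists_isMaxOn hφc hne continuousOn_id
      filter_upwards [tendsto_shiftEnd_ge L hns (hφs hb).2] with j hj x hx
      refine image_eq_zero_of_notMem_tsupport fun hx' => hx ⟨(hφs hx').1, ?_⟩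
      exact (show x ≤ b from hmax hx').trans hj
  -- the estimate at a fixed averaging length
  have hfix : ∀ h : ℝ, 0 < h → h < δ / 2 →
      2 * volume.real S + ∫ x, u x * deriv φ x ∂(mu L) ≤
        c + 2 * ((mu (L - δ)).real {x | δ / 3 ≤ ‖1 / h * (∫ y in x..(x + h), u0 y) - u0 x‖} +
          h / (δ / 6) * c) := by
    intro h hh hhδ
    set B1 := {x | δ / 3 ≤ ‖1 / h * (∫ y in x..(x + h), u0 y) - u0 x‖} with hB1
    set A : ℕ → ℝ → ℝ := fun j x => 1 / h * ∫ y in x..(x + h), v (j) y with hA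
    -- replace the finitely many `j` with `ns j = 0`
    obtain ⟨j0, hj0⟩ := eventually_atTop.1 hev
    have hmeas : TendstoInMeasure (mu (L - δ)) (fun j => A (j + j0)) atTop
        (fun x => 1 / h * ∫ y in x..(x + h), u0 y) := by
      refine tendstoInMeasure_of_tendsto_ae (fun j => (continuous_mean (integrable_spin
        (by linarith [hj0 (j + j0) (by omega)]) (hv _)) _).aestronglyMeasurable)
        (ae_mu_le.mono fun x hx => ?_)
      exact (tendsto_mean hconv0 hh hx.1.le (by linarith [hx.2])).comp (tendsto_add_atTop_nat j0)
    have hB2 := tendstoInMeasure_iff_measureReal_norm.1 hmeas (δ / 3) (by linarith)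
    rw [tendsto_add_atTop_iff_nat (f := fun j => (mu (L - δ)).real
      {x | δ / 3 ≤ ‖A j x - 1 / h * ∫ y in x..(x + h), u0 y‖}) j0] at hB2
    have hlim : Tendsto (fun j => c + 1 / (ns j : ℝ) * c + 2 * ((mu (L - δ)).real B1 +
        (mu (L - δ)).real {x | δ / 3 ≤ ‖A j x - 1 / h * ∫ y in x..(x + h), u0 y‖} +
        h / (δ / 6) * c)) atTop (𝓝 (c + 0 * c + 2 * ((mu (L - δ)).real B1 + 0 +
          h / (δ / 6) * c))) :=
      (tendsto_const_nhds.add (hinv.mul_const c)).add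
        (((tendsto_const_nhds.add hB2).add_const _).const_mul 2)
    rw [zero_mul, add_zero, add_zero] at hlim
    refine le_of_tendsto_of_tendsto (tendsto_const_nhds.add hI) hlim ?_
    have hsmall : ∀ᶠ j in atTop, 1 / ((ns j : ℝ) * h) < δ / 6 := by
      have h1 : Tendsto (fun j => 1 / (ns j : ℝ) * (1 / h)) atTop (𝓝 (0 * (1 / h))) :=
        hinv.mul_const _
      rw [zero_mul] at h1
      filter_upwards [h1.eventually (gt_mem_nhds (by linarith : (0 : ℝ) < δ / 6))] with j hj
      rwa [one_div_mul_one_div] at hj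
    filter_upwards [hev, hsuppev, hsmall, tendsto_shiftEnd_ge L hns
      (by linarith : L - δ / 2 < L)] with j hj hsj hsm hse
    have hj1 : 1 ≤ ns j := by omega
    have e1 := integral_mul_diff_quotient_le hj1 (hv j) hφ.continuous hφ1 hsj
    have e2 := energy_eq hj L (v j)
    have e3 := hE j
    have e4 := shortEnergy_nonneg (ns j) (numSites L (ns j)) (site (ns j) (v j))
    have e4' := longEnergy_nonneg (ns j) (numSites L (ns j)) (site (ns j) (v j))
    set Λ := longEnergy (ns j) (numSites L (ns j)) (site (ns j) (v j))
    have hΛ : Λ ≤ c := by linarith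
    have e5 := card_jumpWindows_le hj1 (a := site (ns j) (v j)) (N := numSites L (ns j))
      fun i _ => site_eq_zero_or_one (hv j) i
    have e6 := ENNReal.toReal_mono ENNReal.ofReal_ne_top (volume_slidingMean_le hj1 (hv j))
    rw [ENNReal.toReal_ofReal (by positivity)] at e6
    have e7 := volume_shift_diff_le hj1 (hv j) hh (by linarith : 0 < δ / 6)
    set M := {x | x ∈ Ioc 0 (shiftEnd L (ns j)) ∧ 0 < slidingMean (ns j) (v j) x ∧
      slidingMean (ns j) (v j) x < 1}
    set B2 := {x | δ / 3 ≤ ‖A j x - 1 / h * ∫ y in x..(x + h), u0 y‖}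
    set B3 := {x | x ∈ Ioo 0 (shiftEnd L (ns j) - h) ∧
        δ / 6 ≤ ns j * ∫ y in x..(x + h), |v j (y + 1 / ns j) - v j y|}
    -- Off the three exceptional sets each passage, from `u` to its mean over length `h`, to that of
    -- `v j`, to the sliding mean, costs less than `δ / 3`; the last third is `δ / 6` from `B3` plus
    -- `δ / 6` from `1 / (n h)`. Since `δ ≤ u ≤ 1 - δ`, the sliding mean is strictly between 0 and
    -- 1.
    have hsub : S ⊆ M ∪ (Ioo 0 (L - δ) ∩ B1 ∪ Ioo 0 (L - δ) ∩ B2 ∪ B3) := by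
      rintro x ⟨hx, hx1, hx2⟩
      by_contra hcon
      simp only [mem_union, mem_inter_iff, not_or, not_and] at hcon
      obtain ⟨c1, ⟨c2, c3⟩, c4⟩ := hcon
      have d1 : |1 / h * (∫ y in x..(x + h), u0 y) - u x| < δ / 3 := by
        rw [← hu0eq x hx]
        exact not_le.1 (c2 hx)
      have d2 : |A j x - 1 / h * ∫ y in x..(x + h), u0 y| < δ / 3 := not_le.1 (c3 hx)
      have d3 : ns j * ∫ y in x..(x + h), |v j (y + 1 / ns j) - v j y| < δ / 6 :=
        not_le.1 fun hc => c4 ⟨⟨hx.1, by linarith [hx.2]⟩, hc⟩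
      have d4 := slidingMean_sub_mean_le hj1 (hv j) (x := x) hh
      have d5 : |slidingMean (ns j) (v j) x - A j x| < δ / 3 := by
        refine lt_of_le_of_lt d4 ?_
        linarith
      rw [abs_lt] at d1 d2 d5
      exact c1 ⟨⟨hx.1, by linarith [hx.2]⟩, by linarith [d1.1, d2.1, d5.1], by linarith [d1.2, d2.2, d5.2]⟩
    have hfinM : volume M ≠ ∞ :=
      ne_top_of_le_ne_top (by simp) (measure_mono (t := Ioc 0 (shiftEnd L (ns j))) fun x hx => hx.1)
    have hfin3 : volume B3 ≠ ∞ := ne_top_of_le_ne_top (by simp)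
      (measure_mono (t := Ioo 0 (shiftEnd L (ns j) - h)) fun x hx => hx.1)
    have hfin : ∀ B : Set ℝ, volume (Ioo 0 (L - δ) ∩ B) ≠ ∞ := fun B =>
      ne_top_of_le_ne_top (by simp) (measure_mono inter_subset_left)
    have hmr : ∀ B : Set ℝ, (mu (L - δ)).real B = volume.real (Ioo 0 (L - δ) ∩ B) := fun B => by
      rw [Measure.real, Measure.restrict_apply' measurableSet_Ioo, inter_comm, Measure.real]
    have e8 : volume.real S ≤ volume.real M + ((mu (L - δ)).real B1 + (mu (L - δ)).real B2 +
        volume.real B3) := by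
      rw [hmr, hmr]
      refine (measureReal_mono hsub ?_).trans ((measureReal_union_le _ _).trans
        (add_le_add_right ((measureReal_union_le _ _).trans
          (add_le_add_left (measureReal_union_le _ _) _)) _))
      simp only [ne_eq, measure_union_eq_top_iff, not_or]
      exact ⟨hfinM, ⟨hfin _, hfin _⟩, hfin3⟩
    have e9 : h / (δ / 6) * Λ ≤ h / (δ / 6) * c := by gcongr
    have e10 : 1 / (ns j : ℝ) * Λ ≤ 1 / (ns j : ℝ) * c := by gcongr
    have e11 : volume.real M ≤ _ := e6
    linarith
  have hlim2 := (((tendsto_volume_mean_sub hu0i (L - δ) (by linarith : 0 < δ / 3)).add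
    (((tendsto_one_div_add_atTop_nhds_zero_nat (𝕜 := ℝ)).div_const (δ / 6)).mul_const c)).const_mul
      2).const_add c
  simp only [zero_div, zero_mul, add_zero, mul_zero] at hlim2
  refine ge_of_tendsto hlim2 ?_
  filter_upwards [(tendsto_one_div_add_atTop_nhds_zero_nat (𝕜 := ℝ)).eventually
    (gt_mem_nhds (by linarith : 0 < δ / 2))] with i hi
  exact hfix _ (by positivity) hi

end Liminf

/-! ### Admissibility of the limit and the supremum over test functions -/

section LiminfConclusion

variable {L c : ℝ} {ns ks : ℕ → ℕ} {v : ℕ → ℝ → ℝ} {u : ℝ → ℝ}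

theorem tendsto_setIntegral (hconv : TestTendsto L v u) {s : Set ℝ} (hs : MeasurableSet s) :
    Tendsto (fun j => ∫ x in s, v j x ∂(mu L)) atTop (𝓝 (∫ x in s, u x ∂(mu L))) := by
  have key : ∀ f : ℝ → ℝ, ∫ y, f y * s.indicator (fun _ => 1) y ∂(mu L) =
      ∫ y in s, f y ∂(mu L) := fun f => by
    rw [← integral_indicator hs]
    congr 1
    ext y
    by_cases hy : y ∈ s <;> simp [hy]
  have := hconv _ ((integrable_const (1 : ℝ)).indicator hs)
  simpa only [key] using this

theorem ae_mem_unit_interval (hns : Tendsto ns atTop atTop)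
    (hv : ∀ j, v j ∈ spinFunctions L (ns j) (ks j)) (hui : Integrable u (mu L))
    (hconv : TestTendsto L v u) : ∀ᵐ x ∂(mu L), 0 ≤ u x ∧ u x ≤ 1 := by
  have h0 : 0 ≤ᵐ[mu L] u := ae_nonneg_of_forall_setIntegral_nonneg hui fun s hs _ =>
    ge_of_tendsto' (tendsto_setIntegral hconv hs) fun j =>
      integral_nonneg fun x => spin_nonneg (hv j) x
  have h1 : u ≤ᵐ[mu L] fun _ => 1 := ae_le_of_forall_setIntegral_le hui (integrable_const 1)
    fun s hs _ => le_of_tendsto (tendsto_setIntegral hconv hs) <| by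
      filter_upwards [hns.eventually_ge_atTop 1] with j hj
      exact integral_mono (integrable_spin hj (hv j)).restrict.restrict (integrable_const 1)
        fun x => spin_le_one (hv j) x
  filter_upwards [h0, h1] with x hx0 hx1 using ⟨hx0, hx1⟩

theorem integral_eq_of_tendsto {σ : ℝ} (hL : 0 < L) (hns : Tendsto ns atTop atTop)
    (hv : ∀ j, v j ∈ spinFunctions L (ns j) (ks j)) (hconv : TestTendsto L v u)
    (hkσ : Tendsto (fun j => (ks j : ℝ) / (L * (ns j : ℝ) ^ 2)) atTop (𝓝 σ)) :
    ∫ x, u x ∂(mu L) = L * σ := by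
  have h1 := tendsto_setIntegral hconv MeasurableSet.univ
  simp only [setIntegral_univ] at h1
  refine tendsto_nhds_unique h1 ((hkσ.const_mul L).congr' ?_)
  filter_upwards [hns.eventually_ge_atTop 1] with j hj
  rw [integral_spin hL hj (hv j)]
  have : (0 : ℝ) < ns j := by exact_mod_cast hj
  field_simp

theorem two_mul_volume_add_totalVar_le (hL : 0 < L) (hns : Tendsto ns atTop atTop)
    (hv : ∀ j, v j ∈ spinFunctions L (ns j) (ks j)) (hE : ∀ j, energy L (ns j) (v j) ≤ c)
    (hui : Integrable u (mu L)) (hconv : TestTendsto L v u) :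
    2 * volume {x : ℝ | x ∈ Ioo 0 L ∧ 0 < u x ∧ u x < 1} + totalVar L u ≤ ENNReal.ofReal c := by
  set S : ℕ → Set ℝ := fun i => {x | x ∈ Ioo 0 (L - 1 / ((i : ℝ) + 1)) ∧ 1 / ((i : ℝ) + 1) ≤ u x ∧
    u x ≤ 1 - 1 / ((i : ℝ) + 1)} with hS
  have hmain : ∀ (i : ℕ) (φ : ℝ → ℝ), ContDiff ℝ 1 φ → HasCompactSupport φ →
      tsupport φ ⊆ Ioo 0 L → (∀ x, |φ x| ≤ 1) →
      2 * volume (S i) + ENNReal.ofReal (∫ x, u x * deriv φ x ∂(mu L)) ≤ ENNReal.ofReal c := by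
    intro i φ h1 h2 h3 h4
    have hpos : (0 : ℝ) < 1 / ((i : ℝ) + 1) := by positivity
    have e1 := two_mul_volume_add_integral_le hL hns hv hE hui hconv h1 h2 h3 h4 hpos
    -- The zero test function serves when the integral is negative, where `ENNReal.ofReal` returns
    -- 0.
    have e0 := two_mul_volume_add_integral_le hL hns hv hE hui hconv (φ := fun _ => 0)
      contDiff_const (HasCompactSupport.zero (α := ℝ) (β := ℝ)) (by simp [tsupport]) (by simp) hpos
    simp only [deriv_const, mul_zero, integral_zero, add_zero] at e0
    have hfin : volume (S i) ≠ ∞ := ne_top_of_le_ne_top (by simp)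
      (measure_mono (t := Ioo 0 (L - 1 / ((i : ℝ) + 1))) fun x hx => hx.1)
    have e2 : 2 * volume (S i) = ENNReal.ofReal (2 * volume.real (S i)) := by
      rw [ENNReal.ofReal_mul (by norm_num), Measure.real, ENNReal.ofReal_toReal hfin]
      simp
    rw [e2]
    rcases le_total 0 (∫ x, u x * deriv φ x ∂(mu L)) with h | h
    · rw [← ENNReal.ofReal_add (by positivity) h]
      exact ENNReal.ofReal_le_ofReal e1
    · rw [ENNReal.ofReal_of_nonpos h, add_zero]
      exact ENNReal.ofReal_le_ofReal e0
  have hmono : Monotone S := by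
    rintro i j hij x ⟨hx, hx1, hx2⟩
    have : 1 / ((j : ℝ) + 1) ≤ 1 / ((i : ℝ) + 1) := Nat.one_div_le_one_div hij
    exact ⟨⟨hx.1, by linarith [hx.2]⟩, by linarith, by linarith⟩
  have hunion : {x : ℝ | x ∈ Ioo 0 L ∧ 0 < u x ∧ u x < 1} ⊆ ⋃ i, S i := by
    rintro x ⟨hx, hx0, hx1⟩
    obtain ⟨i, hi⟩ := exists_nat_one_div_lt
      (lt_min (sub_pos.2 hx.2) (lt_min hx0 (sub_pos.2 hx1)))
    rw [lt_min_iff, lt_min_iff] at hi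
    exact mem_iUnion.2 ⟨i, ⟨hx.1, by linarith [hi.1]⟩, hi.2.1.le, by linarith [hi.2.2]⟩
  have hlim := ENNReal.Tendsto.const_mul (a := 2) (tendsto_measure_iUnion_atTop (μ := volume) hmono)
    (Or.inr ENNReal.ofNat_ne_top)
  have hφ : ∀ φ : ℝ → ℝ, ContDiff ℝ 1 φ → HasCompactSupport φ →
      tsupport φ ⊆ Ioo 0 L → (∀ x, |φ x| ≤ 1) →
      2 * volume {x : ℝ | x ∈ Ioo 0 L ∧ 0 < u x ∧ u x < 1} +
        ENNReal.ofReal (∫ x, u x * deriv φ x ∂(mu L)) ≤ ENNReal.ofReal c := by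
    intro φ h1 h2 h3 h4
    refine (add_le_add_left (mul_le_mul_right (measure_mono hunion) 2) _).trans ?_
    exact le_of_tendsto' (hlim.add_const _) fun i => hmain i φ h1 h2 h3 h4
  have h0 := hφ (fun _ => 0) contDiff_const (HasCompactSupport.zero (α := ℝ) (β := ℝ))
    (by simp [tsupport]) (by simp)
  simp only [deriv_const, mul_zero, integral_zero, ENNReal.ofReal_zero, add_zero] at h0
  -- Finiteness of the volume term allows it to be subtracted before taking the supremum over `φ`.
  have hA : 2 * volume {x : ℝ | x ∈ Ioo 0 L ∧ 0 < u x ∧ u x < 1} ≠ ∞ :=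
    ne_top_of_le_ne_top ENNReal.ofReal_ne_top h0
  have htv : totalVar L u ≤ ENNReal.ofReal c -
      2 * volume {x : ℝ | x ∈ Ioo 0 L ∧ 0 < u x ∧ u x < 1} :=
    iSup₂_le fun φ hφ' => ENNReal.le_sub_of_add_le_left hA
      (hφ φ hφ'.1 hφ'.2.1 hφ'.2.2.1 hφ'.2.2.2)
  calc _ ≤ 2 * volume {x : ℝ | x ∈ Ioo 0 L ∧ 0 < u x ∧ u x < 1} + (ENNReal.ofReal c -
        2 * volume {x : ℝ | x ∈ Ioo 0 L ∧ 0 < u x ∧ u x < 1}) := add_le_add_right htv _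
    _ = _ := add_tsub_cancel_of_le h0

end LiminfConclusion

theorem limitFunctional_le_liminf {L σ : ℝ} (hL : 0 < L) {k : ℕ → ℕ}
    (hkσ : Tendsto (fun n : ℕ => (k n : ℝ) / (L * (n : ℝ) ^ 2)) atTop (𝓝 σ))
    {u : ℕ → LInfty L} {u₀ : LInfty L} (hconv : WeakStarTendsto L u u₀) :
    limitFunctional L σ u₀ ≤ liminf (fun n => discreteFunctional L n (k n) (u n)) atTop := by
  refine le_of_forall_gt fun C hC => ?_
  obtain ⟨C', hC1, hC2⟩ := exists_between hC
  have hfreq : ∃ᶠ n in atTop, discreteFunctional L n (k n) (u n) < C' :=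
    frequently_lt_of_liminf_lt (by isBoundedDefault) hC1
  -- Along this subsequence the functionals are below a finite `C'`, so every term has a spin
  -- representative of bounded energy.
  obtain ⟨ns, hns, hlt⟩ := extraction_of_frequently_atTop hfreq
  have hns' : Tendsto ns atTop atTop := hns.tendsto_atTop
  have hC'top : C' ≠ ∞ := hC2.ne_top
  have hex : ∀ j, ∃ v, v ∈ spinFunctions L (ns j) (k (ns j)) ∧
      ((u (ns j) : LInfty L) : ℝ → ℝ) =ᵐ[mu L] v ∧ energy L (ns j) v ≤ C'.toReal := by
    intro j
    have h1 := hlt j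
    simp only [discreteFunctional, iInf_lt_iff, mem_ofPred_eq, exists_prop] at h1
    obtain ⟨v, ⟨hv1, hv2⟩, hv3⟩ := h1
    refine ⟨v, hv1, hv2, ?_⟩
    exact (ENNReal.ofReal_le_iff_le_toReal hC'top).1 hv3.le
  choose v hv hvae hvE using hex
  have htest : TestTendsto L v (u₀ : ℝ → ℝ) := fun g hg => by
    refine ((hconv g hg).comp hns').congr fun j => ?_
    refine integral_congr_ae ((hvae j).mono fun x hx => ?_)
    simp only [hx]
  have hui : Integrable (u₀ : ℝ → ℝ) (mu L) :=
    (Lp.memLp u₀).integrable le_top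
  have hmain := two_mul_volume_add_totalVar_le hL hns' hv hvE hui htest
  rw [ENNReal.ofReal_toReal hC'top] at hmain
  have hcond : IsBV L (u₀ : ℝ → ℝ) ∧ (∀ᵐ x ∂(mu L), 0 ≤ (u₀ : ℝ → ℝ) x ∧ (u₀ : ℝ → ℝ) x ≤ 1) ∧
      ∫ x, (u₀ : ℝ → ℝ) x ∂(mu L) = L * σ :=
    ⟨⟨hui, lt_of_le_of_lt (le_add_self.trans hmain) hC'top.lt_top⟩,
      ae_mem_unit_interval hns' hv hui htest,
      integral_eq_of_tendsto hL hns' hv htest (hkσ.comp hns')⟩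
  rw [limitFunctional, if_pos hcond]
  exact hmain.trans_lt hC2

/-! ### Pointwise variation on a set of full measure -/

/-- The primitive of a bump function centred at the origin. -/
def bumpStep (η : ContDiffBump (0 : ℝ)) (t : ℝ) : ℝ := ∫ s in (-η.rOut)..t, η.normed volume s

/-! ### Smoothed step functions as test functions -/

section BumpStep

variable (η : ContDiffBump (0 : ℝ))

theorem hasDerivAt_bumpStep (t : ℝ) : HasDerivAt (bumpStep η) (η.normed volume t) t :=
  η.continuous_normed.integral_hasStrictDerivAt _ _ |>.hasDerivAt

theorem monotone_bumpStep : Monotone (bumpStep η) :=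
  monotone_of_hasDerivAt_nonneg (hasDerivAt_bumpStep η) fun t => η.nonneg_normed t

theorem normed_eq_zero_of_notMem {t : ℝ} (ht : t ∉ Ioo (-η.rOut) η.rOut) :
    η.normed volume t = 0 := by
  rw [← Function.notMem_support, η.support_normed_eq, Real.ball_eq_Ioo]
  simpa using ht

theorem bumpStep_of_le {t : ℝ} (ht : t ≤ -η.rOut) : bumpStep η t = 0 := by
  rw [bumpStep, intervalIntegral.integral_congr (g := fun _ => 0), intervalIntegral.integral_zero]
  intro s hs
  rw [uIcc_of_ge ht] at hs
  exact normed_eq_zero_of_notMem η fun h => absurd h.1 (not_lt.2 hs.2)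

theorem bumpStep_of_ge {t : ℝ} (ht : η.rOut ≤ t) : bumpStep η t = 1 := by
  have h0 := η.rOut_pos
  rw [bumpStep, intervalIntegral.integral_of_le (by linarith), ← η.integral_normed (μ := volume)]
  refine setIntegral_eq_integral_of_forall_compl_eq_zero fun s hs => ?_
  exact normed_eq_zero_of_notMem η fun h => hs ⟨h.1, h.2.le.trans ht⟩

theorem bumpStep_mem_Icc (t : ℝ) : bumpStep η t ∈ Icc (0 : ℝ) 1 := by
  constructor
  · rcases le_total t (-η.rOut) with h | h
    · exact (bumpStep_of_le η h).ge
    · exact (bumpStep_of_le η le_rfl).ge.trans (monotone_bumpStep η h)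
  · rcases le_total η.rOut t with h | h
    · exact (bumpStep_of_ge η h).le
    · exact (monotone_bumpStep η h).trans (bumpStep_of_ge η le_rfl).le

/-- A smoothed step function with values `s i` on `(X i, X (i + 1))`. -/
def bumpSteps (N : ℕ) (X s : ℕ → ℝ) (x : ℝ) : ℝ :=
  ∑ i ∈ Finset.range N, s i * (bumpStep η (x - X i) - bumpStep η (x - X (i + 1)))

variable {N : ℕ} {X s : ℕ → ℝ}

theorem hasDerivAt_bumpSteps (x : ℝ) :
    HasDerivAt (bumpSteps η N X s) (∑ i ∈ Finset.range N,
      s i * (η.normed volume (x - X i) - η.normed volume (x - X (i + 1)))) x := by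
  have h : ∀ a, HasDerivAt (fun x => bumpStep η (x - a)) (η.normed volume (x - a)) x := fun a =>
    (hasDerivAt_bumpStep η (x - a)).comp_sub_const x a
  exact HasDerivAt.fun_sum fun i _ => ((h _).sub (h _)).const_mul _

theorem contDiff_bumpSteps : ContDiff ℝ 1 (bumpSteps η N X s) := by
  refine contDiff_one_iff_deriv.2
    ⟨fun x => (hasDerivAt_bumpSteps η x).differentiableAt, ?_⟩
  rw [show deriv (bumpSteps η N X s) = _ from funext fun x => (hasDerivAt_bumpSteps η x).deriv]
  have := η.continuous_normed (μ := volume)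
  fun_prop

/-- The differences of consecutive steps are nonnegative and telescope to a difference of two
numbers in `[0, 1]`. -/
theorem abs_bumpSteps_le (hX : Monotone X) (hs : ∀ i, |s i| ≤ 1) (x : ℝ) :
    |bumpSteps η N X s x| ≤ 1 := by
  calc |bumpSteps η N X s x| ≤ ∑ i ∈ Finset.range N,
        |s i * (bumpStep η (x - X i) - bumpStep η (x - X (i + 1)))| :=
        Finset.abs_sum_le_sum_abs _ _
    _ ≤ ∑ i ∈ Finset.range N, (bumpStep η (x - X i) - bumpStep η (x - X (i + 1))) := by
        refine Finset.sum_le_sum fun i _ => ?_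
        have h := monotone_bumpStep η (by linarith [hX i.le_succ] : x - X (i + 1) ≤ x - X i)
        rw [abs_mul, abs_of_nonneg (sub_nonneg.2 h)]
        exact mul_le_of_le_one_left (sub_nonneg.2 h) (hs i)
    _ = bumpStep η (x - X 0) - bumpStep η (x - X N) :=
        Finset.sum_range_sub' (fun i => bumpStep η (x - X i)) N
    _ ≤ 1 := by linarith [(bumpStep_mem_Icc η (x - X 0)).2, (bumpStep_mem_Icc η (x - X N)).1]

theorem tsupport_bumpSteps_subset (hX : Monotone X) :
    tsupport (bumpSteps η N X s) ⊆ Icc (X 0 - η.rOut) (X N + η.rOut) := by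
  refine closure_minimal (fun x hx => ?_) isClosed_Icc
  by_contra hcon
  refine hx (Finset.sum_eq_zero fun i hi => ?_)
  have h0 := hX (Nat.zero_le i)
  have h1 := hX i.le_succ
  have h2 := hX (Finset.mem_range.1 hi)
  simp only [Nat.succ_eq_add_one] at h1 h2
  rw [mem_Icc, not_and_or, not_le, not_le] at hcon
  rcases hcon with h | h
  · rw [bumpStep_of_le η (by linarith), bumpStep_of_le η (by linarith), sub_zero, mul_zero]
  · rw [bumpStep_of_ge η (by linarith), bumpStep_of_ge η (by linarith), sub_self, mul_zero]

/-- The derivative of a smoothed step is a bump centred at its jump. Testing `f` against it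
evaluates the mollification of `f` there. -/
theorem integral_mul_deriv_bumpSteps {f : ℝ → ℝ} (hf : Integrable f) :
    ∫ x, f x * deriv (bumpSteps η N X s) x = ∑ i ∈ Finset.range N,
      s i * (convolution (η.normed volume) f (ContinuousLinearMap.lsmul ℝ ℝ) volume (X i) -
        convolution (η.normed volume) f (ContinuousLinearMap.lsmul ℝ ℝ) volume (X (i + 1))) := by
  have hconv : ∀ a, convolution (η.normed volume) f (ContinuousLinearMap.lsmul ℝ ℝ) volume a =
      ∫ x, f x * η.normed volume (x - a) := fun a => by
    rw [convolution_eq_swap]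
    congr 1
    ext x
    rw [ContinuousLinearMap.lsmul_apply, smul_eq_mul, mul_comm, ← η.normed_neg (x - a), neg_sub]
  obtain ⟨C, hC⟩ := η.hasCompactSupport_normed (μ := volume) |>.exists_bound_of_continuous
    (η.continuous_normed (μ := volume))
  have hi : ∀ a, Integrable fun x => f x * η.normed volume (x - a) := fun a =>
    hf.mul_bdd (c := C)
      ((η.continuous_normed.comp (continuous_sub_right a)).aestronglyMeasurable)
      (ae_of_all _ fun x => hC _)
  simp_rw [hconv]
  simp_rw [fun x => (hasDerivAt_bumpSteps η (N := N) (X := X) (s := s) x).deriv, Finset.mul_sum]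
  rw [integral_finsetSum]
  · refine Finset.sum_congr rfl fun i _ => ?_
    rw [← integral_sub (hi _) (hi _), ← integral_const_mul]
    congr 1
    ext x
    ring
  · intro i _
    refine (((hi (X i)).sub (hi (X (i + 1)))).const_mul (s i)).congr (ae_of_all _ fun x => ?_)
    simp only [Pi.sub_apply]
    ring

end BumpStep

/-- A function of bounded variation has, on a set of full measure, pointwise variation at most its
total variation. -/
theorem exists_good_set {L : ℝ} {u : ℝ → ℝ} (hu : IsBV L u) :
    ∃ G ⊆ Ioo 0 L, (∀ᵐ x ∂(mu L), x ∈ G) ∧ eVariationOn u G ≤ totalVar L u := by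
  set f : ℝ → ℝ := (Ioo 0 L).indicator u with hf
  have hfi : Integrable f := (integrable_indicator_iff measurableSet_Ioo).2 hu.1
  -- Keeping the ratio of the radii equal to 2 is what the almost everywhere convergence of the
  -- mollifications requires.
  let η : ℕ → ContDiffBump (0 : ℝ) := fun i =>
    { rIn := 1 / ((i : ℝ) + 1), rOut := 2 * (1 / ((i : ℝ) + 1)),
      rIn_pos := by positivity
      rIn_lt_rOut := by
        have : (0 : ℝ) < 1 / ((i : ℝ) + 1) := by positivity
        linarith }
  have hη : Tendsto (fun i => (η i).rOut) atTop (𝓝 0) := by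
    have h := (tendsto_one_div_add_atTop_nhds_zero_nat (𝕜 := ℝ)).const_mul 2
    rwa [mul_zero] at h
  have hae := ContDiffBump.ae_convolution_tendsto_right_of_locallyIntegrable (μ := volume)
    (φ := η) (K := 2) hη (Eventually.of_forall fun i => le_rfl) hfi.locallyIntegrable
  refine ⟨Ioo 0 L ∩ {x | Tendsto (fun i => convolution ((η i).normed volume) f
    (ContinuousLinearMap.lsmul ℝ ℝ) volume x) atTop (𝓝 (f x))}, inter_subset_left, ?_, ?_⟩
  · filter_upwards [ae_mu_le, ae_restrict_of_ae hae] with x h1 h2 using ⟨h1, h2⟩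
  refine iSup_le ?_
  rintro ⟨N, X, hX, hXG⟩
  simp only
  have htop := hu.2.ne
  -- With these signs as the values of the test function, the limit of the tested integrals is the
  -- variation of `u` along `X`.
  set s : ℕ → ℝ := fun i => SignType.sign (u (X i) - u (X (i + 1))) with hs
  have hs1 : ∀ i, |s i| ≤ 1 := fun i => by
    simp only [hs]
    rcases SignType.trichotomy (SignType.sign (u (X i) - u (X (i + 1)))) with h | h | h <;> simp [h]
  have hfu : ∀ i, f (X i) = u (X i) := fun i => indicator_of_mem (hXG i).1 _
  have hsum : ∑ i ∈ Finset.range N, edist (u (X (i + 1))) (u (X i)) =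
      ENNReal.ofReal (∑ i ∈ Finset.range N, s i * (f (X i) - f (X (i + 1)))) := by
    rw [ENNReal.ofReal_sum_of_nonneg]
    · refine Finset.sum_congr rfl fun i _ => ?_
      rw [hfu, hfu, edist_comm, edist_dist, Real.dist_eq, sign_mul_self]
    · intro i _
      rw [hfu, hfu, sign_mul_self]
      exact abs_nonneg _
  rw [hsum, ENNReal.ofReal_le_iff_le_toReal htop]
  have hlim : Tendsto (fun i => ∫ x, f x * deriv (bumpSteps (η i) N X s) x) atTop
      (𝓝 (∑ i ∈ Finset.range N, s i * (f (X i) - f (X (i + 1))))) := by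
    simp_rw [fun i => integral_mul_deriv_bumpSteps (η i) (N := N) (X := X) (s := s) hfi]
    exact tendsto_finsetSum _ fun i _ => ((hXG i).2.sub (hXG (i + 1)).2).const_mul _
  refine le_of_tendsto hlim ?_
  filter_upwards [hη.eventually (gt_mem_nhds (hXG 0).1.1),
    hη.eventually (gt_mem_nhds (sub_pos.2 (hXG N).1.2))] with i h1 h2
  have hsupp := tsupport_bumpSteps_subset (η i) (N := N) (s := s) hX
  have hint : ∫ x, f x * deriv (bumpSteps (η i) N X s) x =
      ∫ x, u x * deriv (bumpSteps (η i) N X s) x ∂(mu L) := by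
    rw [← integral_indicator measurableSet_Ioo]
    congr 1
    ext x
    by_cases hx : x ∈ Ioo 0 L <;> simp [hf, hx]
  rw [hint, ← ENNReal.ofReal_le_iff_le_toReal htop]
  refine le_iSup₂_of_le (bumpSteps (η i) N X s) ⟨contDiff_bumpSteps _, ?_, ?_,
    abs_bumpSteps_le _ hX hs1⟩ le_rfl
  · exact HasCompactSupport.of_support_subset_isCompact isCompact_Icc
      ((subset_tsupport _).trans hsupp)
  · exact hsupp.trans fun x hx => ⟨by linarith [hx.1], by linarith [hx.2]⟩

/-! ### Configurations given by heights -/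

theorem sum_range_mul_eq (f : ℕ → ℝ) (Q n : ℕ) :
    ∑ j ∈ Finset.range (Q * n), f j =
      ∑ q ∈ Finset.range Q, ∑ r ∈ Finset.range n, f (q * n + r) := by
  induction Q with
  | zero => simp
  | succ Q ih => rw [Nat.succ_mul, Finset.sum_range_add, ih, Finset.sum_range_succ]

/-- The spin at the site `i` if the `q`-th column, made of the sites `q n + 1, …, q n + n`, is
filled up to the height `h q`. -/
def heightSites (n : ℕ) (h : ℕ → ℕ) (i : ℕ) : ℝ := if (i - 1) % n < h ((i - 1) / n) then 1 else 0

/-- The indicator of the columns that are neither empty nor full. -/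
def partialColumn (n : ℕ) (h : ℕ → ℕ) (q : ℕ) : ℝ := if 0 < h q ∧ h q < n then 1 else 0

theorem heightSites_eq {n : ℕ} (h : ℕ → ℕ) (q : ℕ) {r : ℕ} (hr : r < n) :
    heightSites n h (q * n + r + 1) = if r < h q then 1 else 0 := by
  rw [heightSites, Nat.add_sub_cancel, Nat.add_comm (q * n) r, Nat.add_mul_mod_self_right,
    Nat.mod_eq_of_lt hr, Nat.add_mul_div_right _ _ (by omega), Nat.div_eq_of_lt hr, zero_add]

theorem heightSites_eq_zero_or_one (n : ℕ) (h : ℕ → ℕ) (i : ℕ) :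
    heightSites n h i = 0 ∨ heightSites n h i = 1 := by
  unfold heightSites
  split_ifs <;> simp

/-- Both columns are filled from the bottom, so they differ exactly in the rows between the two
heights. -/
theorem sum_step_sub_sq {n x y : ℕ} (hx : x ≤ n) (hy : y ≤ n) :
    ∑ r ∈ Finset.range n, ((if r < x then (1 : ℝ) else 0) - if r < y then 1 else 0) ^ 2 =
      |(x : ℝ) - y| := by
  wlog hxy : x ≤ y generalizing x y
  · rw [abs_sub_comm, ← this hy hx (by omega)]
    exact Finset.sum_congr rfl fun r _ => by ring
  have h : ∀ r, ((if r < x then (1 : ℝ) else 0) - if r < y then 1 else 0) ^ 2 =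
      if r ∈ Finset.Ico x y then 1 else 0 := fun r => by
    simp only [Finset.mem_Ico]
    split_ifs <;> first | omega | norm_num
  simp_rw [h]
  rw [Finset.sum_ite_mem, Finset.sum_const, nsmul_eq_mul, mul_one, abs_sub_comm,
    abs_of_nonneg (by simpa using hxy), Finset.inter_eq_right.2, Nat.card_Ico, Nat.cast_sub hxy]
  intro r hr
  simp only [Finset.mem_Ico, Finset.mem_range] at hr ⊢
  omega

variable {n : ℕ} {h : ℕ → ℕ}

theorem longEnergy_heightSites_le (hn : 1 ≤ n) (hh : ∀ q, h q ≤ n) {N Q : ℕ} (hN : N ≤ Q * n + n) :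
    longEnergy n N (heightSites n h) ≤
      1 / (n : ℝ) * ∑ q ∈ Finset.range Q, |(h q : ℝ) - h (q + 1)| := by
  refine mul_le_mul_of_nonneg_left ?_ (by positivity)
  calc ∑ i ∈ Finset.Ico 1 (N + 1 - n), (heightSites n h i - heightSites n h (i + n)) ^ 2
      ≤ ∑ i ∈ Finset.Ico (0 + 1) (Q * n + 1),
          (heightSites n h i - heightSites n h (i + n)) ^ 2 := by
        refine Finset.sum_le_sum_of_subset_of_nonneg ?_ fun _ _ _ => sq_nonneg _
        exact Finset.Ico_subset_Ico_right (by omega)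
    _ = ∑ q ∈ Finset.range Q, ∑ r ∈ Finset.range n,
          (heightSites n h (q * n + r + 1) - heightSites n h (q * n + r + 1 + n)) ^ 2 := by
        rw [← Finset.sum_Ico_add' (fun i => (heightSites n h i - heightSites n h (i + n)) ^ 2),
          ← Finset.range_eq_Ico, sum_range_mul_eq]
    _ = _ := by
        refine Finset.sum_congr rfl fun q _ => ?_
        rw [← sum_step_sub_sq (hh q) (hh (q + 1))]
        refine Finset.sum_congr rfl fun r hr => ?_
        have hr' := Finset.mem_range.1 hr
        rw [heightSites_eq h q hr', show q * n + r + 1 + n = (q + 1) * n + r + 1 by ring,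
          heightSites_eq h (q + 1) hr']

/-- A partial column has one inner jump, and a second one on its top bond when the next column is
nonempty. The difference of indicators telescopes over the columns: it pays for an empty column
followed by a nonempty one. A full column followed by an empty one is paid by the last term, since
then the heights differ by `n`. -/
theorem column_jumps_le (hn : 1 ≤ n) (hh : ∀ q, h q ≤ n) (q : ℕ) :
    ∑ r ∈ Finset.range n,
        (heightSites n h (q * n + r + 1) - heightSites n h (q * n + r + 1 + 1)) ^ 2 ≤
      2 * partialColumn n h q + ((if 0 < h (q + 1) then 1 else 0) - if 0 < h q then 1 else 0) +
        2 / (n : ℝ) * |(h q : ℝ) - h (q + 1)| := by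
  obtain ⟨m, rfl⟩ : ∃ m, n = m + 1 := ⟨n - 1, by omega⟩
  rw [Finset.sum_range_succ]
  have h1 : ∀ r ∈ Finset.range m, (heightSites (m + 1) h (q * (m + 1) + r + 1) -
      heightSites (m + 1) h (q * (m + 1) + r + 1 + 1)) ^ 2 = if r + 1 = h q then 1 else 0 := by
    intro r hr
    have hr' := Finset.mem_range.1 hr
    rw [heightSites_eq h q (by omega), add_assoc (q * (m + 1)) r 1, heightSites_eq h q (by omega)]
    split_ifs <;> first | omega | norm_num
  have h2 : ∑ r ∈ Finset.range m, (if r + 1 = h q then (1 : ℝ) else 0) ≤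
      partialColumn (m + 1) h q := by
    unfold partialColumn
    split_ifs with hc
    · rw [Finset.sum_eq_single (h q - 1)]
      · split_ifs <;> norm_num
      · intro r _ hr
        rw [if_neg (by omega)]
      · intro hr
        rw [if_neg (fun _ => hr (Finset.mem_range.2 (by omega)))]
    · refine (Finset.sum_eq_zero fun r hr => ?_).le
      have hr' := Finset.mem_range.1 hr
      rw [if_neg (by omega)]
  rw [Finset.sum_congr rfl h1, heightSites_eq h q (by omega),
    show q * (m + 1) + m + 1 + 1 = (q + 1) * (m + 1) + 0 + 1 by ring,
    heightSites_eq (n := m + 1) h (q + 1) (r := 0) (by omega)]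
  have hq := hh q
  have hq1 := hh (q + 1)
  have habs : 0 ≤ 2 / ((m + 1 : ℕ) : ℝ) * |(h q : ℝ) - h (q + 1)| := by positivity
  have hfull : h q = m + 1 → h (q + 1) = 0 →
      2 / ((m + 1 : ℕ) : ℝ) * |(h q : ℝ) - h (q + 1)| = 2 := by
    intro e1 e2
    rw [e1, e2, Nat.cast_zero, sub_zero, abs_of_nonneg (by positivity)]
    field_simp
  refine (add_le_add_left h2 _).trans ?_
  unfold partialColumn
  by_cases c1 : m < h q <;> by_cases c2 : 0 < h (q + 1)
  · rw [if_pos c1, if_pos c2, if_neg (by omega), if_pos (by omega)]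
    linarith
  · rw [if_pos c1, if_neg c2, if_neg (by omega), if_pos (by omega),
      hfull (by omega) (by omega)]
    norm_num
  · rw [if_neg c1, if_pos c2]
    by_cases c3 : 0 < h q
    · rw [if_pos c3, if_pos (by omega)]
      linarith
    · rw [if_neg c3, if_neg (by omega)]
      linarith
  · rw [if_neg c1, if_neg c2]
    by_cases c3 : 0 < h q
    · rw [if_pos c3, if_pos (by omega)]
      linarith
    · rw [if_neg c3, if_neg (by omega)]
      linarith

theorem shortEnergy_heightSites_le (hn : 1 ≤ n) (hh : ∀ q, h q ≤ n) {N Q : ℕ} (hN : N ≤ Q * n) :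
    shortEnergy n N (heightSites n h) ≤ 2 * (1 / (n : ℝ) * ∑ q ∈ Finset.range Q, partialColumn n h q) +
      1 / n + 2 / n * (1 / (n : ℝ) * ∑ q ∈ Finset.range Q, |(h q : ℝ) - h (q + 1)|) := by
  have h1 : ∑ i ∈ Finset.Ico 1 N, (heightSites n h i - heightSites n h (i + 1)) ^ 2 ≤
      2 * ∑ q ∈ Finset.range Q, partialColumn n h q + 1 +
        2 / n * ∑ q ∈ Finset.range Q, |(h q : ℝ) - h (q + 1)| := by
    calc ∑ i ∈ Finset.Ico 1 N, (heightSites n h i - heightSites n h (i + 1)) ^ 2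
        ≤ ∑ i ∈ Finset.Ico (0 + 1) (Q * n + 1),
            (heightSites n h i - heightSites n h (i + 1)) ^ 2 := by
          refine Finset.sum_le_sum_of_subset_of_nonneg ?_ fun _ _ _ => sq_nonneg _
          exact Finset.Ico_subset_Ico_right (by omega)
      _ = ∑ q ∈ Finset.range Q, ∑ r ∈ Finset.range n,
            (heightSites n h (q * n + r + 1) - heightSites n h (q * n + r + 1 + 1)) ^ 2 := by
          rw [← Finset.sum_Ico_add' (fun i => (heightSites n h i - heightSites n h (i + 1)) ^ 2),
            ← Finset.range_eq_Ico, sum_range_mul_eq]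
      _ ≤ ∑ q ∈ Finset.range Q, (2 * partialColumn n h q +
            ((if 0 < h (q + 1) then 1 else 0) - if 0 < h q then 1 else 0) +
            2 / (n : ℝ) * |(h q : ℝ) - h (q + 1)|) :=
          Finset.sum_le_sum fun q _ => column_jumps_le hn hh q
      _ = 2 * ∑ q ∈ Finset.range Q, partialColumn n h q +
            ((if 0 < h Q then 1 else 0) - if 0 < h 0 then 1 else 0) +
            2 / (n : ℝ) * ∑ q ∈ Finset.range Q, |(h q : ℝ) - h (q + 1)| := by
          rw [Finset.sum_add_distrib, Finset.sum_add_distrib, ← Finset.mul_sum, ← Finset.mul_sum,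
            Finset.sum_range_sub (fun q => if 0 < h q then (1 : ℝ) else 0)]
      _ ≤ _ := by
          gcongr
          split_ifs <;> norm_num
  calc shortEnergy n N (heightSites n h) ≤ 1 / (n : ℝ) *
        (2 * ∑ q ∈ Finset.range Q, partialColumn n h q + 1 +
        2 / n * ∑ q ∈ Finset.range Q, |(h q : ℝ) - h (q + 1)|) :=
        mul_le_mul_of_nonneg_left h1 (by positivity)
    _ = _ := by ring

/-! ### Spin functions with prescribed sites -/

/-- The function that takes the value `a i` on the `i`-th cell of the chain. -/
def spinOfSites (L : ℝ) (n : ℕ) (a : ℕ → ℝ) : ℝ → ℝ :=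
  (Ioc (0 : ℝ) ((numSites L n : ℝ) / (n : ℝ) ^ 2)).indicator fun x => a ⌈x * (n : ℝ) ^ 2⌉₊

theorem spinOfSites_cell {L : ℝ} (hn : 1 ≤ n) (a : ℕ → ℝ) {i : ℕ}
    (hi : i ∈ Finset.Icc 1 (numSites L n)) {x : ℝ}
    (hx : x ∈ Ioc (((i : ℝ) - 1) / (n : ℝ) ^ 2) ((i : ℝ) / (n : ℝ) ^ 2)) :
    spinOfSites L n a x = a i := by
  have hn' : (0 : ℝ) < (n : ℝ) ^ 2 := by positivity
  obtain ⟨h1, h2⟩ := Finset.mem_Icc.1 hi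
  have h1' : (1 : ℝ) ≤ i := by exact_mod_cast h1
  have hx' : x ∈ Ioc (0 : ℝ) ((numSites L n : ℝ) / (n : ℝ) ^ 2) :=
    ⟨lt_of_le_of_lt (div_nonneg (by linarith) hn'.le) hx.1, hx.2.trans (by gcongr)⟩
  rw [spinOfSites, indicator_of_mem hx']
  congr 1
  refine (Nat.ceil_eq_iff (by omega)).2 ⟨?_, ?_⟩
  · rw [Nat.cast_sub h1, Nat.cast_one]
    exact (div_lt_iff₀ hn').1 hx.1
  · exact (le_div_iff₀ hn').1 hx.2

theorem site_spinOfSites {L : ℝ} (hn : 1 ≤ n) (a : ℕ → ℝ) {i : ℕ}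
    (hi : i ∈ Finset.Icc 1 (numSites L n)) : site n (spinOfSites L n a) i = a i :=
  spinOfSites_cell hn a hi ⟨by gcongr; linarith, le_rfl⟩

theorem spinOfSites_mem {L : ℝ} (hn : 1 ≤ n) {a : ℕ → ℝ} (ha : ∀ i, a i = 0 ∨ a i = 1) {k : ℕ}
    (hk : ∑ i ∈ Finset.range (numSites L n), a (i + 1) = k) :
    spinOfSites L n a ∈ spinFunctions L n k := by
  refine ⟨fun x hx => ?_, fun x hx => indicator_of_notMem hx _, fun i hi x hx => ?_, ?_⟩
  · rw [spinOfSites, indicator_of_mem hx]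
    exact ha _
  · rw [spinOfSites_cell hn a hi hx, site_spinOfSites hn a hi]
  · have h1 : {i : ℕ | i ∈ Finset.Icc 1 (numSites L n) ∧ site n (spinOfSites L n a) i = 1} =
        ((Finset.Icc 1 (numSites L n)).filter fun i => a i = 1 : Finset ℕ) := by
      ext i
      simp only [mem_ofPred_eq, Finset.coe_filter]
      refine and_congr_right fun hi => ?_
      rw [site_spinOfSites hn a hi]
    rw [h1, Set.ncard_coe_finset]
    have h2 : (((Finset.Icc 1 (numSites L n)).filter fun i => a i = 1).card : ℝ) = k := by
      rw [← hk, Finset.card_filter, Finset.range_eq_Ico, Finset.sum_Ico_add' a]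
      push_cast
      refine Finset.sum_congr (by ext i; simp only [Finset.mem_Icc, Finset.mem_Ico]; omega)
        fun i _ => ?_
      rcases ha i with h | h <;> simp [h]
    exact_mod_cast h2

theorem energy_spinOfSites {L : ℝ} (hn : 2 ≤ n) (a : ℕ → ℝ) :
    energy L n (spinOfSites L n a) =
      shortEnergy n (numSites L n) a + longEnergy n (numSites L n) a := by
  have hn1 : 1 ≤ n := by omega
  rw [energy_eq hn]
  congr 1
  · rw [shortEnergy, shortEnergy]
    congr 1
    refine Finset.sum_congr rfl fun i hi => ?_
    have := Finset.mem_Ico.1 hi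
    rw [site_spinOfSites hn1 a (Finset.mem_Icc.2 (by omega)),
      site_spinOfSites hn1 a (Finset.mem_Icc.2 (by omega))]
  · rw [longEnergy, longEnergy]
    congr 1
    refine Finset.sum_congr rfl fun i hi => ?_
    have := Finset.mem_Ico.1 hi
    rw [site_spinOfSites hn1 a (Finset.mem_Icc.2 (by omega)),
      site_spinOfSites hn1 a (Finset.mem_Icc.2 (by omega))]

/-! ### Sampling a function of bounded variation -/

/-- A function with values in `[0, 1]` and pointwise variation at most `V` on a subset `G` of full
measure of `(0, L)`. -/
structure IsRegular (L V : ℝ) (f : ℝ → ℝ) (G : Set ℝ) : Prop where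
  integrable : Integrable f
  subset : G ⊆ Ioo 0 L
  ae_mem : ∀ᵐ x ∂(mu L), x ∈ G
  mem_Icc : ∀ x ∈ G, 0 ≤ f x ∧ f x ≤ 1
  variation_le : eVariationOn f G ≤ ENNReal.ofReal V
  nonneg : 0 ≤ V

/-! ### Windows, means and samples of a regular function -/

section Regular

variable {L V : ℝ} {f : ℝ → ℝ} {G : Set ℝ}

theorem IsRegular.ae_of_subset (hf : IsRegular L V f G) {a b : ℝ} (ha : 0 ≤ a) (hb : b ≤ L) :
    ∀ᵐ x, x ∈ Ioo a b → x ∈ G := by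
  filter_upwards [(ae_restrict_iff' measurableSet_Ioo).1 hf.ae_mem] with x hx hx'
  exact hx ⟨ha.trans_lt hx'.1, hx'.2.trans_le hb⟩

theorem ae_Ioc_of_Ioo {a b : ℝ} {p : ℝ → Prop} (h : ∀ᵐ x, x ∈ Ioo a b → p x) :
    ∀ᵐ x, x ∈ Ioc a b → p x := by
  have h1 : ∀ᵐ x : ℝ, x ≠ b := by simp [ae_iff]
  filter_upwards [h, h1] with x hx hxb hx'
  exact hx ⟨hx'.1, lt_of_le_of_ne hx'.2 hxb⟩

theorem IsRegular.exists_mem_Ioo (hf : IsRegular L V f G) {a b : ℝ} (ha : 0 ≤ a) (hab : a < b)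
    (hb : b ≤ L) : ∃ x ∈ G, x ∈ Ioo a b := by
  by_contra! hcon
  have h1 : ∀ᵐ x, x ∉ Ioo a b :=
    (hf.ae_of_subset ha hb).mono fun x hx hx' => hcon x (hx hx') hx'
  have h2 : volume (Ioo a b) = 0 := measure_eq_zero_iff_ae_notMem.2 h1
  rw [Real.volume_Ioo] at h2
  simp only [ENNReal.ofReal_eq_zero] at h2
  linarith

theorem IsRegular.integral_mem (hf : IsRegular L V f G) {a b : ℝ} (ha : 0 ≤ a) (hab : a ≤ b)
    (hb : b ≤ L) : 0 ≤ ∫ x in a..b, f x ∧ ∫ x in a..b, f x ≤ b - a := by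
  have hae := ae_Ioc_of_Ioo (hf.ae_of_subset ha hb)
  have hae' := (ae_restrict_iff' measurableSet_Ioc).2 hae
  rw [intervalIntegral.integral_of_le hab]
  refine ⟨integral_nonneg_of_ae (hae'.mono fun x hx => (hf.mem_Icc x hx).1), ?_⟩
  have h := integral_mono_ae hf.integrable.restrict (integrable_const (1 : ℝ))
    (hae'.mono fun x hx => (hf.mem_Icc x hx).2)
  simpa [hab] using h

/-- There are arbitrarily short windows on which the mean is neither `0` nor `1`. -/
theorem IsRegular.exists_window (hf : IsRegular L V f G) (hL : 0 < L)
    (h0 : 0 < ∫ x in 0..L, f x) (h1 : ∫ x in 0..L, f x < L) {ε : ℝ} (hε : 0 < ε) :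
    ∃ a b, 0 < a ∧ a < b ∧ b < L ∧ b - a ≤ ε ∧ 0 < ∫ x in a..b, f x ∧
      ∫ x in a..b, f x < b - a := by
  -- `(0, L)` is divided into `M + 2` windows; having at least two makes their length `e` smaller
  -- than `L`.
  obtain ⟨M, hM⟩ := exists_nat_gt (L / ε)
  have hM0 : 0 < M + 2 := by omega
  set e := L / ((M + 2 : ℕ) : ℝ) with he
  have hMr : (0 : ℝ) < ((M + 2 : ℕ) : ℝ) := by positivity
  have he0 : 0 < e := by positivity
  have heε : e ≤ ε := by
    rw [he, div_le_iff₀ hMr]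
    rw [div_lt_iff₀ hε] at hM
    push_cast
    nlinarith
  have heL : e < L := by
    rw [he, div_lt_iff₀ hMr]
    push_cast
    nlinarith [(Nat.cast_nonneg M : (0 : ℝ) ≤ M)]
  have hMe : ((M + 2 : ℕ) : ℝ) * e = L := by rw [he]; field_simp
  set F : ℝ → ℝ := fun t => ∫ x in t..(t + e), f x with hF
  have hFc : Continuous F := by
    have := continuous_mean hf.integrable e
    have h2 : F = fun t => e * (1 / e * ∫ x in t..(t + e), f x) := by
      ext t
      rw [← mul_assoc, mul_one_div_cancel he0.ne', one_mul]
    rw [h2]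
    fun_prop
  have hsum : ∑ i ∈ Finset.range (M + 2), F (i * e) = ∫ x in 0..L, f x := by
    have := intervalIntegral.sum_integral_adjacent_intervals (μ := volume) (f := f)
      (a := fun i : ℕ => (i : ℝ) * e) (n := M + 2) fun i _ => hf.integrable.intervalIntegrable
    rw [Nat.cast_zero, zero_mul, hMe] at this
    rw [← this]
    refine Finset.sum_congr rfl fun i _ => ?_
    simp only [hF]
    congr 1
    push_cast
    ring
  have hmem : ∀ i ∈ Finset.range (M + 2), (i : ℝ) * e ∈ Icc 0 (L - e) := fun i hi => by
    refine ⟨by positivity, ?_⟩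
    have : ((i + 1 : ℕ) : ℝ) ≤ ((M + 2 : ℕ) : ℝ) := by
      exact_mod_cast Finset.mem_range.1 hi
    push_cast at this hMe
    nlinarith
  -- The total integral is neither 0 nor `L`, so some window has positive integral and some window
  -- is not full. If every `F t` were nonpositive or at least `e`, the intermediate value `e / 2`
  -- would give a contradiction.
  have hexist : ∃ t ∈ Icc 0 (L - e), 0 < F t ∧ F t < e := by
    by_contra! hcon
    obtain ⟨i, hi, hi'⟩ : ∃ i ∈ Finset.range (M + 2), 0 < F (i * e) := by
      by_contra! hc
      linarith [Finset.sum_nonpos hc]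
    obtain ⟨j, hj, hj'⟩ : ∃ j ∈ Finset.range (M + 2), F (j * e) < e := by
      by_contra! hc
      have := Finset.card_nsmul_le_sum _ _ _ hc
      rw [Finset.card_range, nsmul_eq_mul, hMe, hsum] at this
      linarith
    have hi2 := hcon _ (hmem i hi) hi'
    have hj2 : F (j * e) ≤ 0 := by
      by_contra! hc
      linarith [hcon _ (hmem j hj) hc]
    obtain ⟨t, ht, ht'⟩ := isPreconnected_Icc.intermediate_value (hmem j hj) (hmem i hi)
      hFc.continuousOn (⟨by linarith, by linarith⟩ : e / 2 ∈ Icc (F (j * e)) (F (i * e)))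
    linarith [hcon t ht (by linarith)]
  obtain ⟨t, ht, ht0, ht1⟩ := hexist
  -- `t` may be an end point; the strict inequalities persist at nearby interior points.
  have hclos : t ∈ closure (Ioo 0 (L - e)) := by rwa [closure_Ioo (by linarith)]
  obtain ⟨s, ⟨hs0, hs1⟩, hs⟩ := mem_closure_iff.1 hclos (F ⁻¹' Ioo 0 e) (isOpen_Ioo.preimage hFc)
    ⟨ht0, ht1⟩
  exact ⟨s, s + e, hs.1, by linarith, by linarith [hs.2], by linarith, hs0, by simpa using hs1⟩

/-- Replacing a value by the mean does not increase the variation, for a suitable value. -/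
theorem IsRegular.exists_abs_mean_le (hf : IsRegular L V f G) {a b : ℝ} (ha : 0 < a) (hab : a < b)
    (hb : b < L) (l r : ℝ) : ∃ y ∈ G, y ∈ Ioo a b ∧
      |l - (∫ x in a..b, f x) / (b - a)| + |(∫ x in a..b, f x) / (b - a) - r| ≤
        |l - f y| + |f y - r| := by
  set z := (∫ x in a..b, f x) / (b - a) with hz
  have hint : IntegrableOn f (Ioo a b) := hf.integrable.integrableOn
  have hpos : volume (Ioo a b) ≠ 0 := by simp [hab]
  have hnull : (volume.restrict (Ioo a b)) {x | ¬(x ∈ G ∧ x ∈ Ioo a b)} = 0 := by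
    rw [← ae_iff, ae_restrict_iff' measurableSet_Ioo]
    filter_upwards [hf.ae_of_subset ha.le hb.le] with x hx hx' using ⟨hx hx', hx'⟩
  have hav : ⨍ x in Ioo a b, f x = z := by
    rw [setAverage_eq, ← integral_Ioc_eq_integral_Ioo, ← intervalIntegral.integral_of_le hab.le,
      Measure.real, Real.volume_Ioo, ENNReal.toReal_ofReal (by linarith), hz, smul_eq_mul,
      div_eq_inv_mul]
  have : NeZero (volume.restrict (Ioo a b)) := ⟨by simpa using hab⟩
  obtain ⟨y1, hy1, hy1'⟩ := exists_notMem_null_le_average (NeZero.ne _) hint hnull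
  obtain ⟨y2, hy2, hy2'⟩ := exists_notMem_null_average_le (NeZero.ne _) hint hnull
  rw [hav] at hy1' hy2'
  simp only [mem_ofPred_eq, not_not] at hy1 hy2
  -- The mean `z` lies between `f y1` and `f y2`, and `t ↦ |l - t| + |t - r|` is convex, so its
  -- value at `z` is at most one of the values at these two points.
  by_contra! hcon
  have c1 := hcon y1 hy1.1 hy1.2
  have c2 := hcon y2 hy2.1 hy2.2
  rcases abs_cases (l - z) with ⟨h1, _⟩ | ⟨h1, _⟩ <;> rcases abs_cases (z - r) with ⟨h2, _⟩ | ⟨h2, _⟩ <;>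
    rw [h1, h2] at c1 c2 <;>
    linarith [le_abs_self (l - f y1), neg_abs_le (l - f y1), le_abs_self (f y1 - r),
      neg_abs_le (f y1 - r), le_abs_self (l - f y2), neg_abs_le (l - f y2),
      le_abs_self (f y2 - r), neg_abs_le (f y2 - r)]

/-- The part of `G` in the `p`-th interval of length `w`. -/
def group (G : Set ℝ) (w : ℝ) (p : ℕ) : Set ℝ := G ∩ Ico ((p : ℝ) * w) (((p : ℝ) + 1) * w)

/-- The variation in the `p`-th interval of length `w`. -/
def groupVar (f : ℝ → ℝ) (G : Set ℝ) (w : ℝ) (p : ℕ) : ℝ := (eVariationOn f (group G w p)).toReal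

theorem groupVar_nonneg (f : ℝ → ℝ) (G : Set ℝ) (w : ℝ) (p : ℕ) : 0 ≤ groupVar f G w p :=
  ENNReal.toReal_nonneg

theorem group_subset (G : Set ℝ) (w : ℝ) (p : ℕ) : group G w p ⊆ G := inter_subset_left

theorem IsRegular.ne_top (hf : IsRegular L V f G) {s : Set ℝ} (hs : s ⊆ G) :
    eVariationOn f s ≠ ∞ :=
  ne_top_of_le_ne_top ENNReal.ofReal_ne_top ((eVariationOn.mono f hs).trans hf.variation_le)

/-- Variation is superadditive over sets lying one to the left of the other. -/
theorem IsRegular.sum_groupVar_le (hf : IsRegular L V f G) {w : ℝ} (hw : 0 ≤ w) (P : ℕ) :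
    ∑ p ∈ Finset.range P, groupVar f G w p ≤ V := by
  have key : ∀ P : ℕ, ∑ p ∈ Finset.range P, eVariationOn f (group G w p) ≤
      eVariationOn f (G ∩ Iio (P * w)) := by
    intro P
    induction P with
    | zero => simp
    | succ P ih =>
      rw [Finset.sum_range_succ]
      refine (add_le_add_left ih _).trans ((eVariationOn.add_le_union f ?_).trans
        (eVariationOn.mono f ?_))
      · exact fun x hx y hy => hx.2.le.trans hy.2.1
      · push_cast
        rintro x (hx | hx)
        · exact ⟨hx.1, (mem_Iio.1 hx.2).trans_le (by nlinarith)⟩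
        · exact ⟨hx.1, hx.2.2⟩
  have h1 : ∑ p ∈ Finset.range P, eVariationOn f (group G w p) ≤ ENNReal.ofReal V :=
    (key P).trans ((eVariationOn.mono f inter_subset_left).trans hf.variation_le)
  have h2 := ENNReal.toReal_mono ENNReal.ofReal_ne_top h1
  rw [ENNReal.toReal_sum fun p _ => hf.ne_top (group_subset _ _ _),
    ENNReal.toReal_ofReal hf.nonneg] at h2
  exact h2

theorem IsRegular.abs_sub_le_groupVar (hf : IsRegular L V f G) {w : ℝ} {p : ℕ} {x y : ℝ}
    (hx : x ∈ group G w p) (hy : y ∈ group G w p) : |f x - f y| ≤ groupVar f G w p := by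
  have h := eVariationOn.edist_le f hx hy
  rw [edist_dist, ENNReal.ofReal_le_iff_le_toReal (hf.ne_top (group_subset _ _ _))] at h
  exact h

/-- Sample points, chosen where `f` is `0` or `1` whenever this is possible. -/
theorem IsRegular.exists_samples (hf : IsRegular L V f G) {w : ℝ} (hw : 0 < w) :
    ∃ x : ℕ → ℝ, ∀ p : ℕ, (p : ℝ) * w < L → x p ∈ group G w p ∧
      (0 < f (x p) ∧ f (x p) < 1 → ∀ y ∈ group G w p, 0 < f y ∧ f y < 1) := by
  have : ∀ p : ℕ, ∃ x : ℝ, (p : ℝ) * w < L → x ∈ group G w p ∧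
      (0 < f x ∧ f x < 1 → ∀ y ∈ group G w p, 0 < f y ∧ f y < 1) := by
    intro p
    by_cases hp : (p : ℝ) * w < L
    · by_cases hall : ∀ y ∈ group G w p, 0 < f y ∧ f y < 1
      · obtain ⟨x, hx, hx'⟩ := hf.exists_mem_Ioo (a := p * w) (b := min ((p + 1) * w) L)
          (by positivity) (lt_min (by nlinarith) hp) (min_le_right _ _)
        exact ⟨x, fun _ => ⟨⟨hx, hx'.1.le, hx'.2.trans_le (min_le_left _ _)⟩, fun _ => hall⟩⟩
      · push Not at hall
        obtain ⟨x, hx, hx'⟩ := hall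
        exact ⟨x, fun _ => ⟨hx, fun h => absurd h.2 (not_lt.2 (hx' h.1))⟩⟩
    · exact ⟨0, fun h => absurd h hp⟩
  choose x hx using this
  exact ⟨x, hx⟩

/-- On a cell `(s, t)` of a group, the rescaled sample is close to the integral. -/
theorem IsRegular.abs_integral_sub_le (hf : IsRegular L V f G) {w : ℝ} {p : ℕ} {x s t : ℝ}
    (hx : x ∈ group G w p) (hs : 0 ≤ s) (hst : s ≤ t) (ht : t ≤ L) (hps : (p : ℝ) * w ≤ s)
    (htp : t ≤ ((p : ℝ) + 1) * w) :
    |(∫ y in s..t, f y) - (t - s) * f x| ≤ groupVar f G w p * (t - s) := by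
  have h1 : (∫ y in s..t, f y) - (t - s) * f x = ∫ y in s..t, (f y - f x) := by
    rw [intervalIntegral.integral_sub hf.integrable.intervalIntegrable intervalIntegrable_const,
      intervalIntegral.integral_const, smul_eq_mul]
  rw [h1]
  have h2 := intervalIntegral.norm_integral_le_of_norm_le_const_ae (a := s) (b := t)
    (f := fun y => f y - f x) (C := groupVar f G w p) ?_
  · rwa [Real.norm_eq_abs, abs_of_nonneg (sub_nonneg.2 hst)] at h2
  · rw [uIoc_of_le hst]
    have h3 : ∀ᵐ y, y ∈ Ioo s t → ‖f y - f x‖ ≤ groupVar f G w p := by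
      filter_upwards [hf.ae_of_subset hs ht] with y hy hy'
      exact hf.abs_sub_le_groupVar ⟨hy hy', hps.trans hy'.1.le, hy'.2.trans_le htp⟩ hx
    exact ae_Ioc_of_Ioo h3

end Regular

/-! ### Columns with a corrected mass -/

/-- Both sequences are constant on the window and agree outside it, so the sums differ only in the
two terms that cross its ends. -/
theorem sum_abs_replace_le {Y Z : ℕ → ℝ} {y z : ℝ} {qa qb Q : ℕ} (ha : 1 ≤ qa) (hab : qa < qb)
    (hQ : qb ≤ Q) (hY : ∀ q, qa ≤ q → q < qb → Y q = y) (hZ : ∀ q, qa ≤ q → q < qb → Z q = z)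
    (hout : ∀ q, ¬(qa ≤ q ∧ q < qb) → Y q = Z q)
    (hyz : |Z (qa - 1) - z| + |z - Z qb| ≤ |Z (qa - 1) - y| + |y - Z qb|) :
    ∑ q ∈ Finset.range Q, |Z q - Z (q + 1)| ≤ ∑ q ∈ Finset.range Q, |Y q - Y (q + 1)| := by
  rw [← sub_nonneg, ← Finset.sum_sub_distrib, Finset.sum_eq_add (qa - 1) (qb - 1) (by omega)]
  · rw [show qa - 1 + 1 = qa by omega, show qb - 1 + 1 = qb by omega,
      hout (qa - 1) (by omega), hY qa (by omega) (by omega), hZ qa (by omega) (by omega),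
      hY (qb - 1) (by omega) (by omega), hZ (qb - 1) (by omega) (by omega), hout qb (by omega)]
    linarith
  · intro q _ hq
    by_cases h1 : qa ≤ q ∧ q < qb
    · rw [hY q h1.1 h1.2, hZ q h1.1 h1.2, hY (q + 1) (by omega) (by omega),
        hZ (q + 1) (by omega) (by omega)]
      simp
    · rw [hout q h1, hout (q + 1) (by omega), sub_self]
  · exact fun h => absurd (Finset.mem_range.2 (by omega)) h
  · exact fun h => absurd (Finset.mem_range.2 (by omega)) h

/-- Heights that are equal to `c` or `c + 1` on `[qa, qb)`, and to `β` elsewhere. -/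
def correctedHeight (β : ℕ → ℕ) (qa qb c r q : ℕ) : ℕ :=
  if qa ≤ q ∧ q < qb then c + (if q < qa + r then 1 else 0) else β q

theorem abs_floor_sub_floor_le {s t : ℝ} (hs : 0 ≤ s) (ht : 0 ≤ t) :
    |(⌊s⌋₊ : ℝ) - ⌊t⌋₊| ≤ |s - t| + 1 := by
  have h1 := Nat.floor_le hs
  have h2 := Nat.floor_le ht
  have h3 := Nat.lt_floor_add_one s
  have h4 := Nat.lt_floor_add_one t
  rw [abs_le]
  constructor <;> linarith [le_abs_self (s - t), neg_abs_le (s - t)]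

theorem abs_floor_sub_le {s t : ℝ} (hs : 0 ≤ s) : |(⌊s⌋₊ : ℝ) - t| ≤ |s - t| + 1 := by
  have h1 := Nat.floor_le hs
  have h3 := Nat.lt_floor_add_one s
  rw [abs_le]
  constructor <;> linarith [le_abs_self (s - t), neg_abs_le (s - t)]

/-- Since `Y` is constant on groups of `m` columns, rounding costs 1 only at a change of group, at
most `Q / m` times. Each end of the window costs `1 + E`, and the step from `c + 1` to `c` inside it
costs 1; together these give `2 E + 3`. -/
theorem sum_abs_correctedHeight_le {n m Q qa qb c r : ℕ} {Y : ℕ → ℝ} {z E : ℝ}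
    (hY : ∀ q, 0 ≤ Y q) (hYc : ∀ q, q / m = (q + 1) / m → Y q = Y (q + 1))
    (hc : |(c : ℝ) - n * z| ≤ E) (hc1 : |(c : ℝ) + 1 - n * z| ≤ E) (hab : qa < qb) :
    ∑ q ∈ Finset.range Q, |(correctedHeight (fun q => ⌊n * Y q⌋₊) qa qb c r q : ℝ) -
        correctedHeight (fun q => ⌊n * Y q⌋₊) qa qb c r (q + 1)| ≤
      n * ∑ q ∈ Finset.range Q, |(if qa ≤ q ∧ q < qb then z else Y q) -
        (if qa ≤ q + 1 ∧ q + 1 < qb then z else Y (q + 1))| + (Q / m : ℕ) + (2 * E + 3) := by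
  set H : ℕ → ℝ := fun q => correctedHeight (fun q => ⌊n * Y q⌋₊) qa qb c r q with hH
  set Z : ℕ → ℝ := fun q => if qa ≤ q ∧ q < qb then z else Y q with hZ
  have hE : 0 ≤ E := (abs_nonneg _).trans hc
  have hn : (0 : ℝ) ≤ n := Nat.cast_nonneg n
  have hin : ∀ q, qa ≤ q → q < qb → |H q - n * z| ≤ E := by
    intro q h1 h2
    simp only [hH, correctedHeight, if_pos (And.intro h1 h2)]
    split_ifs
    · simpa using hc1
    · simpa using hc
  have hZin : ∀ q, qa ≤ q → q < qb → Z q = z := fun q h1 h2 => if_pos ⟨h1, h2⟩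
  have hZout : ∀ q, ¬(qa ≤ q ∧ q < qb) → Z q = Y q := fun q h => if_neg h
  have hHout : ∀ q, ¬(qa ≤ q ∧ q < qb) → H q = ⌊n * Y q⌋₊ := fun q h => by
    simp only [hH, correctedHeight, if_neg h]
  have hmono : ∀ q, q / m ≤ (q + 1) / m := fun q => Nat.div_le_div_right (by omega)
  have hterm : ∀ q ∈ Finset.range Q, |H q - H (q + 1)| ≤ n * |Z q - Z (q + 1)| +
      ((((q + 1) / m : ℕ) : ℝ) - ((q / m : ℕ) : ℝ)) + ((if q + 1 = qa then 1 + E else 0) +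
      (if q + 1 = qb then 1 + E else 0) + if q + 1 = qa + r then 1 else 0) := by
    intro q _
    have hm0 : (0 : ℝ) ≤ (((q + 1) / m : ℕ) : ℝ) - ((q / m : ℕ) : ℝ) := by
      rw [sub_nonneg]
      exact_mod_cast hmono q
    have hr0 : (0 : ℝ) ≤ if q + 1 = qa + r then 1 else 0 := by split_ifs <;> norm_num
    have hmul : n * |Z q - Z (q + 1)| = |n * Z q - n * Z (q + 1)| := by
      rw [← mul_sub, abs_mul, abs_of_nonneg hn]
    by_cases h1 : qa ≤ q ∧ q < qb
    · by_cases h2 : q + 1 < qb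
      · rw [hZin q h1.1 h1.2, hZin (q + 1) (by omega) h2, if_neg (by omega : ¬ q + 1 = qa),
          if_neg (by omega : ¬ q + 1 = qb), sub_self, abs_zero, mul_zero]
        have h3 : |H q - H (q + 1)| ≤ if q + 1 = qa + r then 1 else 0 := by
          simp only [hH, correctedHeight, if_pos h1,
            if_pos (And.intro (by omega : qa ≤ q + 1) h2)]
          split_ifs <;> (first | omega | simp)
        linarith
      · rw [if_neg (by omega : ¬ q + 1 = qa), if_pos (by omega : q + 1 = qb), hmul,
          hZin q h1.1 h1.2, hZout (q + 1) (by omega), hHout (q + 1) (by omega)]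
        have h3 := hin q h1.1 h1.2
        have h4 := abs_floor_sub_le (s := n * Y (q + 1)) (t := n * z) (mul_nonneg hn (hY _))
        have h5 := abs_sub_le (H q) (n * z) ⌊n * Y (q + 1)⌋₊
        rw [abs_sub_comm (n * z) (⌊n * Y (q + 1)⌋₊ : ℝ)] at h5
        rw [abs_sub_comm (n * z) (n * Y (q + 1))]
        linarith
    · by_cases h2 : q + 1 = qa
      · rw [if_pos h2, if_neg (by omega : ¬ q + 1 = qb), hmul, hZout q h1,
          hZin (q + 1) (by omega) (by omega), hHout q h1]
        have h3 := hin (q + 1) (by omega) (by omega)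
        have h4 := abs_floor_sub_le (s := n * Y q) (t := n * z) (mul_nonneg hn (hY _))
        have h5 := abs_sub_le (⌊n * Y q⌋₊ : ℝ) (n * z) (H (q + 1))
        rw [abs_sub_comm (n * z) (H (q + 1))] at h5
        linarith
      · have h3 : ¬(qa ≤ q + 1 ∧ q + 1 < qb) := by omega
        have h0a : (0 : ℝ) ≤ if q + 1 = qa then 1 + E else 0 := by split_ifs <;> linarith
        have h0b : (0 : ℝ) ≤ if q + 1 = qb then 1 + E else 0 := by split_ifs <;> linarith
        rw [hHout q h1, hHout _ h3]
        by_cases h4 : q / m = (q + 1) / m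
        · rw [hYc q h4, sub_self, abs_zero]
          positivity
        · have h5 : (1 : ℝ) ≤ (((q + 1) / m : ℕ) : ℝ) - ((q / m : ℕ) : ℝ) := by
            have : q / m + 1 ≤ (q + 1) / m := by have := hmono q; omega
            have : ((q / m : ℕ) : ℝ) + 1 ≤ (((q + 1) / m : ℕ) : ℝ) := by exact_mod_cast this
            linarith
          rw [hmul, hZout q h1, hZout _ h3]
          have h6 := abs_floor_sub_floor_le (mul_nonneg hn (hY q)) (mul_nonneg hn (hY (q + 1)))
          linarith
  refine (Finset.sum_le_sum hterm).trans ?_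
  rw [Finset.sum_add_distrib, Finset.sum_add_distrib, ← Finset.mul_sum,
    Finset.sum_range_sub (fun q => ((q / m : ℕ) : ℝ)), Finset.sum_add_distrib,
    Finset.sum_add_distrib]
  have hone : ∀ (s : ℕ) (C : ℝ), 0 ≤ C →
      ∑ q ∈ Finset.range Q, (if q + 1 = s then C else 0) ≤ C := by
    intro s C hC
    have h1 : ∀ q, (if q + 1 = s then C else 0) = if s = q + 1 then C else 0 := fun q => by
      simp only [eq_comm]
    rcases Nat.eq_zero_or_pos s with h0 | h0
    · subst h0
      simpa using hC
    · have h2 : ∀ q, (if q + 1 = s then C else 0) = if q = s - 1 then C else 0 := fun q => by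
        congr 1
        simp only [eq_iff_iff]
        omega
      simp_rw [h2, Finset.sum_ite_eq']
      split_ifs
      · exact le_rfl
      · exact hC
  have e1 := hone qa (1 + E) (by linarith)
  have e2 := hone qb (1 + E) (by linarith)
  have e3 := hone (qa + r) 1 zero_le_one
  have e4 : (0 : ℝ) ≤ ((0 / m : ℕ) : ℝ) := Nat.cast_nonneg _
  linarith

/-- The column `Q` may be incomplete: only its first `N - Q n` rows belong to the chain. -/
theorem sum_heightSites {n N Q : ℕ} (h : ℕ → ℕ) (h1 : Q * n ≤ N) (h2 : N ≤ Q * n + n)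
    (hh : ∀ q, h q ≤ n) :
    ∑ i ∈ Finset.range N, heightSites n h (i + 1) =
      ∑ q ∈ Finset.range Q, (h q : ℝ) + (min (h Q) (N - Q * n) : ℕ) := by
  obtain ⟨s, rfl⟩ : ∃ s, N = Q * n + s := ⟨N - Q * n, by omega⟩
  have hrow : ∀ q s, s ≤ n → ∑ r ∈ Finset.range s, heightSites n h (q * n + r + 1) =
      (min (h q) s : ℕ) := by
    intro q s hs
    have h3 : ∀ r ∈ Finset.range s, heightSites n h (q * n + r + 1) =
        if r ∈ Finset.range (h q) then 1 else 0 := fun r hr => by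
      rw [heightSites_eq h q (by have := Finset.mem_range.1 hr; omega)]
      simp
    rw [Finset.sum_congr rfl h3, Finset.sum_ite_mem, Finset.sum_const, nsmul_eq_mul, mul_one,
      Finset.range_inter_range, Finset.card_range, min_comm]
  rw [Finset.sum_range_add, sum_range_mul_eq (fun j => heightSites n h (j + 1))]
  congr 1
  · refine Finset.sum_congr rfl fun q _ => ?_
    rw [hrow q n le_rfl, min_eq_left (hh q)]
  · rw [hrow Q s (by omega), Nat.add_sub_cancel_left]

theorem sum_correctedHeight {β : ℕ → ℕ} {qa qb c r Q : ℕ} (hab : qa ≤ qb) (hQ : qb ≤ Q)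
    (hr : r ≤ qb - qa) :
    ∑ q ∈ Finset.range Q, correctedHeight β qa qb c r q =
      ∑ q ∈ Finset.range Q \ Finset.Ico qa qb, β q + ((qb - qa) * c + r) := by
  have hsub : Finset.Ico qa qb ⊆ Finset.range Q := fun q hq => by
    simp only [Finset.mem_Ico, Finset.mem_range] at hq ⊢
    omega
  rw [← Finset.sum_sdiff hsub]
  congr 1
  · refine Finset.sum_congr rfl fun q hq => ?_
    simp only [Finset.mem_sdiff, Finset.mem_Ico] at hq
    rw [correctedHeight, if_neg hq.2]
  · have h1 : ∀ q ∈ Finset.Ico qa qb, correctedHeight β qa qb c r q =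
        c + if q < qa + r then 1 else 0 := fun q hq => by
      rw [correctedHeight, if_pos (Finset.mem_Ico.1 hq)]
    rw [Finset.sum_congr rfl h1, Finset.sum_add_distrib, Finset.sum_const, Nat.card_Ico,
      smul_eq_mul, ← Finset.card_filter]
    congr 1
    have h2 : (Finset.Ico qa qb).filter (fun q => q < qa + r) = Finset.Ico qa (qa + r) := by
      ext q
      simp only [Finset.mem_filter, Finset.mem_Ico]
      omega
    rw [h2, Nat.card_Ico, Nat.add_sub_cancel_left]

/-! ### Sampled heights against column integrals -/

section Columns

variable {L V : ℝ} {f : ℝ → ℝ} {G : Set ℝ} {n m : ℕ} {x : ℕ → ℝ}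

/-- `x` samples `f` on the groups of `m` consecutive columns. -/
def IsSampling (L : ℝ) (f : ℝ → ℝ) (G : Set ℝ) (n m : ℕ) (x : ℕ → ℝ) : Prop :=
  ∀ p : ℕ, (p : ℝ) * ((m : ℝ) / n) < L → x p ∈ group G ((m : ℝ) / n) p ∧
    (0 < f (x p) ∧ f (x p) < 1 → ∀ y ∈ group G ((m : ℝ) / n) p, 0 < f y ∧ f y < 1)

theorem group_start_le (hn : 1 ≤ n) (q : ℕ) : ((q / m : ℕ) : ℝ) * ((m : ℝ) / n) ≤ (q : ℝ) / n := by
  have hn' : (0 : ℝ) < n := by exact_mod_cast hn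
  rw [← mul_div_assoc]
  gcongr
  exact_mod_cast Nat.div_mul_le_self q m

theorem le_group_end (hn : 1 ≤ n) (hm : 1 ≤ m) (q : ℕ) :
    ((q : ℝ) + 1) / n ≤ (((q / m : ℕ) : ℝ) + 1) * ((m : ℝ) / n) := by
  have hn' : (0 : ℝ) < n := by exact_mod_cast hn
  rw [← mul_div_assoc]
  gcongr
  have h : q + 1 ≤ (q / m + 1) * m := by
    have := Nat.lt_div_mul_add (a := q) (b := m) (by omega)
    rw [add_mul, one_mul]
    omega
  exact_mod_cast h

/-- The 1 is the rounding error; the other term is the oscillation of `f` on the group, over a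
column of `n` sites. -/
theorem abs_column_sub_le (hf : IsRegular L V f G) (hn : 1 ≤ n) (hm : 1 ≤ m)
    (hx : IsSampling L f G n m x) {q : ℕ} (hq : ((q : ℝ) + 1) / n ≤ L) :
    |(⌊n * f (x (q / m))⌋₊ : ℝ) - (n : ℝ) ^ 2 * ∫ y in (q / n : ℝ)..((q + 1) / n), f y| ≤
      1 + n * groupVar f G ((m : ℝ) / n) (q / m) := by
  have hn' : (0 : ℝ) < n := by exact_mod_cast hn
  have hqlt : (q : ℝ) / n < ((q : ℝ) + 1) / n := by gcongr; linarith
  have hxp := (hx (q / m) (((group_start_le hn q).trans_lt hqlt).trans_le hq)).1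
  have h1 := hf.abs_integral_sub_le hxp (s := q / n) (by positivity) hqlt.le hq
    (group_start_le hn q) (le_group_end hn hm q)
  have h2 : ((q : ℝ) + 1) / n - q / n = 1 / n := by ring
  rw [h2] at h1
  have h3 := abs_floor_sub_le (s := n * f (x (q / m)))
    (t := (n : ℝ) ^ 2 * ∫ y in (q / n : ℝ)..((q + 1) / n), f y)
    (mul_nonneg hn'.le (hf.mem_Icc _ hxp.1).1)
  have h4 : n * f (x (q / m)) - (n : ℝ) ^ 2 * ∫ y in (q / n : ℝ)..((q + 1) / n), f y =
      -((n : ℝ) ^ 2 * ((∫ y in (q / n : ℝ)..((q + 1) / n), f y) - 1 / n * f (x (q / m)))) := by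
    field_simp
    ring
  have h5 : (n : ℝ) ^ 2 * |(∫ y in (q / n : ℝ)..((q + 1) / n), f y) - 1 / n * f (x (q / m))| ≤
      (n : ℝ) ^ 2 * (groupVar f G ((m : ℝ) / n) (q / m) * (1 / n)) :=
    mul_le_mul_of_nonneg_left h1 (by positivity)
  rw [h4, abs_neg, abs_mul, abs_of_pos (by positivity : (0 : ℝ) < (n : ℝ) ^ 2)] at h3
  have h6 : (n : ℝ) ^ 2 * (groupVar f G ((m : ℝ) / n) (q / m) * (1 / n)) =
      n * groupVar f G ((m : ℝ) / n) (q / m) := by field_simp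
  linarith

/-- Each group variation is counted at most `m` times, once per column of the group. -/
theorem sum_groupVar_div_le (hf : IsRegular L V f G) (hm : 1 ≤ m) (Q : ℕ) :
    ∑ q ∈ Finset.range Q, groupVar f G ((m : ℝ) / n) (q / m) ≤ m * V := by
  have h1 : Q ≤ (Q / m + 1) * m := by
    have := Nat.lt_div_mul_add (a := Q) (b := m) (by omega)
    rw [add_mul, one_mul]
    omega
  calc ∑ q ∈ Finset.range Q, groupVar f G ((m : ℝ) / n) (q / m)
      ≤ ∑ q ∈ Finset.range ((Q / m + 1) * m), groupVar f G ((m : ℝ) / n) (q / m) :=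
        Finset.sum_le_sum_of_subset_of_nonneg (Finset.range_subset_range.2 h1)
          fun _ _ _ => groupVar_nonneg _ _ _ _
    _ = ∑ p ∈ Finset.range (Q / m + 1), ∑ _r ∈ Finset.range m, groupVar f G ((m : ℝ) / n) p := by
        rw [sum_range_mul_eq (fun q => groupVar f G ((m : ℝ) / n) (q / m))]
        refine Finset.sum_congr rfl fun p _ => Finset.sum_congr rfl fun r hr => ?_
        rw [Nat.add_comm, Nat.add_mul_div_right _ _ (by omega),
          Nat.div_eq_of_lt (Finset.mem_range.1 hr), zero_add]
    _ = m * ∑ p ∈ Finset.range (Q / m + 1), groupVar f G ((m : ℝ) / n) p := by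
        simp [Finset.mul_sum]
    _ ≤ m * V := by
        gcongr
        exact hf.sum_groupVar_le (by positivity) _

/-- By the choice of samples, a sample strictly between 0 and 1 means that the same holds at all
points of `G` in the group. The columns counted are therefore disjoint intervals of length `1 / n`
almost contained in `{0 < f < 1}`. -/
theorem card_partial_columns_le (hf : IsRegular L V f G) (hn : 1 ≤ n) (hm : 1 ≤ m)
    (hx : IsSampling L f G n m x) (T : Finset ℕ)
    (hT : ∀ q ∈ T, ((q : ℝ) + 1) / n ≤ L ∧ 0 < f (x (q / m)) ∧ f (x (q / m)) < 1) :
    1 / (n : ℝ) * T.card ≤ volume.real {y | y ∈ Ioo 0 L ∧ 0 < f y ∧ f y < 1} := by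
  have hn' : (0 : ℝ) < n := by exact_mod_cast hn
  set I : ℕ → Set ℝ := fun q => Ioo ((q : ℝ) / n) (((q : ℝ) + 1) / n) with hI
  have hdisj : Pairwise (Function.onFun Disjoint I) := by
    intro p q hpq
    wlog hlt : p < q generalizing p q
    · exact (this hpq.symm (by omega)).symm
    rw [Function.onFun, Set.disjoint_left]
    intro y hy1 hy2
    have h1 : ((p : ℝ) + 1) / n ≤ q / n := by
      gcongr
      exact_mod_cast hlt
    linarith [hy1.2, hy2.1]
  have hvol : volume.real (⋃ q ∈ T, I q) = 1 / (n : ℝ) * T.card := by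
    rw [measureReal_biUnion_finset (fun p _ q _ hpq => hdisj hpq) (fun _ _ => measurableSet_Ioo)
      (by simp [hI])]
    have h1 : ∀ q : ℕ, volume.real (I q) = 1 / n := fun q => by
      rw [Measure.real, Real.volume_Ioo, ENNReal.toReal_ofReal]
      · ring
      · rw [sub_nonneg]; gcongr; linarith
    simp_rw [h1]
    simp [mul_comm]
  rw [← hvol, Measure.real, Measure.real]
  refine ENNReal.toReal_mono (ne_top_of_le_ne_top (by simp)
    (measure_mono (t := Ioo 0 L) fun y hy => hy.1)) (measure_mono_ae ?_)
  filter_upwards [hf.ae_of_subset le_rfl le_rfl] with y hy hyT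
  obtain ⟨q, hqT, hyq⟩ := mem_iUnion₂.1 hyT
  obtain ⟨h1, h2⟩ := hT q hqT
  have hyL : y ∈ Ioo 0 L := ⟨lt_of_le_of_lt (by positivity) hyq.1, hyq.2.trans_le h1⟩
  refine ⟨hyL, (hx (q / m) ?_).2 h2 y ⟨hy hyL, (group_start_le hn q).trans hyq.1.le,
    hyq.2.trans_le (le_group_end hn hm q)⟩⟩
  exact (group_start_le hn q).trans_lt (hyq.1.trans hyL.2)

end Columns

/-! ### Mass balance and variation of the corrected samples -/

section Recovery

variable {L V : ℝ} {f : ℝ → ℝ} {G : Set ℝ} {n m N Q : ℕ} {x : ℕ → ℝ}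

theorem sum_column_integrals (hf : Integrable f) {p q : ℕ} (hpq : p ≤ q) :
    ∑ i ∈ Finset.Ico p q, ∫ y in (i / n : ℝ)..((i + 1) / n), f y = ∫ y in (p / n : ℝ)..(q / n), f y := by
  have := intervalIntegral.sum_integral_adjacent_intervals_Ico (μ := volume) (f := f)
    (a := fun i : ℕ => (i : ℝ) / n) hpq fun i _ => hf.intervalIntegrable
  rw [← this]
  push_cast
  rfl

/-- The mass outside the window `[qa, qb)` is close to the mass that leaves the mean of `f` on
`(a, b)` for the columns of the window. -/
theorem abs_mass_sub_le (hf : IsRegular L V f G) (hn : 1 ≤ n) (hm : 1 ≤ m)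
    (hx : IsSampling L f G n m x) (hNL : (N : ℝ) ≤ L * (n : ℝ) ^ 2)
    (hNL' : L * (n : ℝ) ^ 2 < N + 1) (hQ1 : Q * n ≤ N) (hQ2 : N ≤ Q * n + n) {β : ℕ → ℕ}
    (hβ : ∀ q < Q, β q = ⌊n * f (x (q / m))⌋₊) {P : ℕ} (hP : P ≤ n) {a b : ℝ} (hab : a < b)
    {qa qb : ℕ} (hqab : qa ≤ qb) (hqbQ : qb ≤ Q) (hqa : (qa : ℝ) / n ≤ a) (hqb : b ≤ (qb : ℝ) / n)
    (hW : (qb : ℝ) / n - qa / n ≤ b - a + 2 * m / n) (k : ℕ) :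
    |(k : ℝ) - (∑ q ∈ Finset.range Q \ Finset.Ico qa qb, β q : ℕ) - P -
        ((qb : ℝ) - qa) * (n * ((∫ y in a..b, f y) / (b - a)))| ≤
      |(k : ℝ) - (n : ℝ) ^ 2 * ∫ y in 0..L, f y| + (L + m * V + 2 + 2 * m) * n := by
  have hn' : (1 : ℝ) ≤ n := by exact_mod_cast hn
  have hn0 : (0 : ℝ) < n := by linarith
  have hi : ∀ s t : ℝ, IntervalIntegrable f volume s t := fun s t => hf.integrable.intervalIntegrable
  set J : ℕ → ℝ := fun q => ∫ y in (q / n : ℝ)..((q + 1) / n), f y with hJ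
  have hQn : (Q : ℝ) * n ≤ N := by exact_mod_cast hQ1
  have hQL : (Q : ℝ) / n ≤ L := by
    rw [div_le_iff₀ hn0]
    have h1 : (Q : ℝ) * n ≤ L * n * n := by nlinarith
    exact le_of_mul_le_mul_right h1 hn0
  have hqbL : (qb : ℝ) / n ≤ L := le_trans (by gcongr) hQL
  have hsub : Finset.Ico qa qb ⊆ Finset.range Q := fun q hq => by
    simp only [Finset.mem_Ico, Finset.mem_range] at hq ⊢
    omega
  have hqaN : (0 : ℝ) ≤ (qa : ℝ) / n := by positivity
  -- splitting of the mass
  have e1 : ∑ q ∈ Finset.range Q \ Finset.Ico qa qb, J q + ∑ q ∈ Finset.Ico qa qb, J q =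
      ∫ y in (0 : ℝ)..(Q / n), f y := by
    rw [Finset.sum_sdiff hsub, Finset.range_eq_Ico, hJ, sum_column_integrals hf.integrable
      (Nat.zero_le _), Nat.cast_zero, zero_div]
  have e2 : ∑ q ∈ Finset.Ico qa qb, J q = ∫ y in (qa / n : ℝ)..(qb / n), f y :=
    sum_column_integrals hf.integrable hqab
  have e3 := intervalIntegral.integral_add_adjacent_intervals (hi 0 (Q / n)) (hi (Q / n) L)
  have e4 := intervalIntegral.integral_add_adjacent_intervals (hi (qa / n) a) (hi a b)
  have e5 := intervalIntegral.integral_add_adjacent_intervals (hi (qa / n) b) (hi b (qb / n))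
  have b1 := hf.integral_mem hqaN hqa (by linarith)
  have b2 := hf.integral_mem (by linarith : (0 : ℝ) ≤ b) hqb hqbL
  have b3 := hf.integral_mem (by positivity : (0 : ℝ) ≤ Q / n) hQL le_rfl
  have b4 := hf.integral_mem (by linarith : (0 : ℝ) ≤ a) hab.le (by linarith)
  set tail := ∫ y in (Q / n : ℝ)..L, f y
  set I0 := ∫ y in a..b, f y
  set z := I0 / (b - a) with hz
  have hz0 : 0 ≤ z := div_nonneg b4.1 (by linarith)
  have hz1 : z ≤ 1 := div_le_one_of_le₀ b4.2 (by linarith)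
  have hI0 : I0 = (b - a) * z := by rw [hz, mul_div_cancel₀ _ (by linarith)]
  -- the columns outside the window
  have c1 : |((∑ q ∈ Finset.range Q \ Finset.Ico qa qb, β q : ℕ) : ℝ) -
      (n : ℝ) ^ 2 * ∑ q ∈ Finset.range Q \ Finset.Ico qa qb, J q| ≤ Q + n * (m * V) := by
    push_cast
    rw [Finset.mul_sum, ← Finset.sum_sub_distrib]
    refine (Finset.abs_sum_le_sum_abs _ _).trans ?_
    calc ∑ q ∈ Finset.range Q \ Finset.Ico qa qb, |(β q : ℝ) - (n : ℝ) ^ 2 * J q|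
        ≤ ∑ q ∈ Finset.range Q \ Finset.Ico qa qb,
            (1 + n * groupVar f G ((m : ℝ) / n) (q / m)) := by
          refine Finset.sum_le_sum fun q hq => ?_
          have hq' : q < Q := Finset.mem_range.1 (Finset.mem_sdiff.1 hq).1
          rw [hβ q hq']
          refine abs_column_sub_le hf hn hm hx (le_trans ?_ hQL)
          gcongr
          exact_mod_cast hq'
      _ ≤ ∑ q ∈ Finset.range Q, (1 + n * groupVar f G ((m : ℝ) / n) (q / m)) :=
          Finset.sum_le_sum_of_subset_of_nonneg Finset.sdiff_subset fun q _ _ => by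
            have := groupVar_nonneg f G ((m : ℝ) / n) (q / m)
            positivity
      _ = Q + n * ∑ q ∈ Finset.range Q, groupVar f G ((m : ℝ) / n) (q / m) := by
          rw [Finset.sum_add_distrib, ← Finset.mul_sum]
          simp
      _ ≤ _ := by
          gcongr
          exact sum_groupVar_div_le hf hm Q
  -- the last, incomplete column
  have c2 : |(n : ℝ) ^ 2 * tail - P| ≤ n + 1 := by
    have hP' : (P : ℝ) ≤ n := by exact_mod_cast hP
    have h1 : (n : ℝ) ^ 2 * tail ≤ (n : ℝ) ^ 2 * (L - Q / n) :=
      mul_le_mul_of_nonneg_left b3.2 (by positivity)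
    have h2 : (n : ℝ) ^ 2 * (L - Q / n) = L * (n : ℝ) ^ 2 - Q * n := by field_simp
    have h3 : (N : ℝ) ≤ Q * n + n := by exact_mod_cast hQ2
    have h4 : 0 ≤ (n : ℝ) ^ 2 * tail := mul_nonneg (by positivity) b3.1
    have h5 : (0 : ℝ) ≤ P := Nat.cast_nonneg P
    rw [abs_le]
    constructor <;> linarith
  -- the window
  have c3 : |(n : ℝ) ^ 2 * ∑ q ∈ Finset.Ico qa qb, J q - ((qb : ℝ) - qa) * (n * z)| ≤
      2 * m * n := by
    have h1 : ((qb : ℝ) - qa) * (n * z) = (n : ℝ) ^ 2 * (((qb : ℝ) / n - qa / n) * z) := by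
      field_simp
    have h2 : |∑ q ∈ Finset.Ico qa qb, J q - ((qb : ℝ) / n - qa / n) * z| ≤ 2 * m / n := by
      have h3 : 0 ≤ ((qb : ℝ) / n - qa / n - (b - a)) * z := mul_nonneg (by linarith) hz0
      have h4 : ((qb : ℝ) / n - qa / n - (b - a)) * z ≤ (qb : ℝ) / n - qa / n - (b - a) :=
        mul_le_of_le_one_right (by linarith) hz1
      rw [e2, ← e5, ← e4, hI0, abs_le]
      constructor <;> nlinarith
    rw [h1, ← mul_sub, abs_mul, abs_of_pos (by positivity : (0 : ℝ) < (n : ℝ) ^ 2)]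
    calc _ ≤ (n : ℝ) ^ 2 * (2 * m / n) := by gcongr
      _ = _ := by field_simp
  have hQn' : (Q : ℝ) ≤ L * n := by rwa [div_le_iff₀ hn0] at hQL
  have e6 : (n : ℝ) ^ 2 * ∫ y in 0..L, f y = (n : ℝ) ^ 2 *
      ∑ q ∈ Finset.range Q \ Finset.Ico qa qb, J q + (n : ℝ) ^ 2 * ∑ q ∈ Finset.Ico qa qb, J q +
      (n : ℝ) ^ 2 * tail := by
    rw [← e3, ← e1]
    ring
  have hk := le_abs_self ((k : ℝ) - (n : ℝ) ^ 2 * ∫ y in 0..L, f y)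
  have hk' := neg_abs_le ((k : ℝ) - (n : ℝ) ^ 2 * ∫ y in 0..L, f y)
  -- The errors add up to the stated multiple of `n`: `Q ≤ L n` from rounding, `m V n` from
  -- sampling, `n + 1 ≤ 2 n` from the last column, and `2 m n` from aligning the window.
  rw [abs_le] at c1 c2 c3 ⊢
  constructor <;> linarith [c1.1, c1.2, c2.1, c2.2, c3.1, c3.2]

theorem sample_variation_le (hf : IsRegular L V f G) {X : ℕ → ℝ} (hX : Monotone X)
    (hXG : ∀ q, X q ∈ G) (Q : ℕ) : ∑ q ∈ Finset.range Q, |f (X q) - f (X (q + 1))| ≤ V := by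
  have h1 := (eVariationOn.sum_le (f := f) (n := Q) hX hXG).trans hf.variation_le
  have h2 : ∑ i ∈ Finset.range Q, edist (f (X (i + 1))) (f (X i)) =
      ENNReal.ofReal (∑ q ∈ Finset.range Q, |f (X q) - f (X (q + 1))|) := by
    rw [ENNReal.ofReal_sum_of_nonneg fun _ _ => abs_nonneg _]
    refine Finset.sum_congr rfl fun i _ => ?_
    rw [edist_comm, edist_dist, Real.dist_eq]
  rw [h2] at h1
  exact (ENNReal.ofReal_le_ofReal_iff hf.nonneg).1 h1

/-- The samples of `f` on the columns `q ≤ Q`, with those of the window `[m pa, m pb)` replaced by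
the mean on `(a, b)`, have variation at most `V`. -/
theorem window_variation_le (hf : IsRegular L V f G) (hn : 1 ≤ n) (hm : 1 ≤ m)
    (hx : IsSampling L f G n m x) (hQ : (Q : ℝ) / n < L) {a b : ℝ} (ha : 0 < a) (hab : a < b)
    (hb : b < L) {pa pb : ℕ} (hpa : 1 ≤ m * pa) (hpab : m * pa < m * pb) (hpb : m * pb ≤ Q)
    (hqa : ((m * pa : ℕ) : ℝ) / n ≤ a) (hqb : b ≤ ((m * pb : ℕ) : ℝ) / n) :
    ∑ q ∈ Finset.range (Q + 1), |(if m * pa ≤ q ∧ q < m * pb then (∫ y in a..b, f y) / (b - a)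
        else f (x (min q Q / m))) - (if m * pa ≤ q + 1 ∧ q + 1 < m * pb then
        (∫ y in a..b, f y) / (b - a) else f (x (min (q + 1) Q / m)))| ≤ V := by
  have hn0 : (0 : ℝ) < n := by exact_mod_cast hn
  have hw : (0 : ℝ) < (m : ℝ) / n := by
    have : (0 : ℝ) < m := by exact_mod_cast hm
    positivity
  have hvalid : ∀ p ≤ Q / m, (p : ℝ) * ((m : ℝ) / n) < L := fun p hp => by
    refine lt_of_le_of_lt ?_ hQ
    rw [← mul_div_assoc]
    gcongr
    have : p * m ≤ Q := (Nat.mul_le_mul_right m hp).trans (Nat.div_mul_le_self Q m)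
    exact_mod_cast this
  have hidx : ∀ q, min q Q / m ≤ Q / m := fun q => Nat.div_le_div_right (min_le_right _ _)
  have hgr : ∀ q, x (min q Q / m) ∈ group G ((m : ℝ) / n) (min q Q / m) := fun q =>
    (hx _ (hvalid _ (hidx q))).1
  have hxmono : ∀ p p', p < p' → p' ≤ Q / m → x p ≤ x p' := fun p p' hpp hp' => by
    have h1 := (hx p (hvalid p (hpp.le.trans hp'))).1.2.2
    have h2 := (hx p' (hvalid p' hp')).1.2.1
    refine h1.le.trans (le_trans ?_ h2)
    gcongr
    exact_mod_cast hpp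
  obtain ⟨y, hyG, hy, hyz⟩ := hf.exists_abs_mean_le ha hab hb (f (x (min (m * pa - 1) Q / m)))
    (f (x (min (m * pb) Q / m)))
  -- One point `y` of `(a, b)` stands for the whole window. The window consists of entire groups and
  -- covers `(a, b)`, so the earlier samples lie to the left of `y` and the later ones to its right.
  -- The minimum with `Q` freezes the samples after the last column.
  set X : ℕ → ℝ := fun q => if m * pa ≤ q ∧ q < m * pb then y else x (min q Q / m) with hX
  have hXin : ∀ q, m * pa ≤ q → q < m * pb → X q = y := fun q h1 h2 => if_pos ⟨h1, h2⟩
  have hXout : ∀ q, ¬(m * pa ≤ q ∧ q < m * pb) → X q = x (min q Q / m) := fun q h => if_neg h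
  have hXG : ∀ q, X q ∈ G := fun q => by
    simp only [hX]
    split_ifs
    · exact hyG
    · exact (hgr q).1
  have hcast : ∀ p : ℕ, (p : ℝ) * ((m : ℝ) / n) = ((m * p : ℕ) : ℝ) / n := fun p => by
    push_cast
    ring
  have hXmono : Monotone X := by
    refine monotone_nat_of_le_succ fun q => ?_
    by_cases h1 : m * pa ≤ q ∧ q < m * pb
    · by_cases h2 : q + 1 < m * pb
      · rw [hXin q h1.1 h1.2, hXin (q + 1) (by omega) h2]
      · have h3 : q + 1 = m * pb := by omega
        rw [hXin q h1.1 h1.2, hXout (q + 1) (by omega), h3]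
        have h4 := (hgr (m * pb)).2.1
        rw [min_eq_left hpb, Nat.mul_div_cancel_left _ (by omega)] at h4 ⊢
        rw [hcast] at h4
        linarith [hy.2]
    · by_cases h2 : q + 1 = m * pa
      · rw [hXout q h1, hXin (q + 1) (by omega) (by omega)]
        have h4 := (hgr q).2.2
        have h5 : min q Q / m + 1 ≤ pa := by
          rw [min_eq_left (by omega)]
          exact Nat.div_lt_of_lt_mul (by omega)
        have h6 : (((min q Q / m : ℕ) : ℝ) + 1) * ((m : ℝ) / n) ≤ (pa : ℝ) * ((m : ℝ) / n) := by
          gcongr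
          exact_mod_cast h5
        rw [hcast] at h6
        linarith [hy.1]
      · rw [hXout q h1, hXout (q + 1) (by omega)]
        have h3 : min q Q / m ≤ min (q + 1) Q / m := Nat.div_le_div_right (by omega)
        rcases h3.eq_or_lt with h4 | h4
        · rw [h4]
        · exact hxmono _ _ h4 (hidx _)
  refine le_trans ?_ (sample_variation_le hf hXmono hXG (Q + 1))
  refine sum_abs_replace_le (Y := fun q => f (X q)) (Z := fun q =>
    if m * pa ≤ q ∧ q < m * pb then (∫ y in a..b, f y) / (b - a) else f (x (min q Q / m)))
    hpa hpab (by omega) (fun q h1 h2 => ?_) (fun q h1 h2 => if_pos ⟨h1, h2⟩) (fun q h => ?_) ?_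
    (y := f y)
  · rw [hXin q h1 h2]
  · simp only [hXout q h, if_neg h]
  · simp only [if_neg (by omega : ¬(m * pa ≤ m * pa - 1 ∧ m * pa - 1 < m * pb)),
      if_neg (by omega : ¬(m * pa ≤ m * pb ∧ m * pb < m * pb))]
    exact hyz

end Recovery

/-! ### Column heights with exact mass -/

section Heights

variable {L V : ℝ} {f : ℝ → ℝ} {G : Set ℝ} {n m : ℕ} {x : ℕ → ℝ}

/-- The bound for the energy and the distance of a configuration of column heights. -/
structure HeightBounds (L V : ℝ) (f : ℝ → ℝ) (n k Q : ℕ) (h : ℕ → ℕ) (B₁ B₂ B₃ : ℝ) : Prop where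
  le : ∀ q, h q ≤ n
  mass : ∑ i ∈ Finset.range (numSites L n), heightSites n h (i + 1) = k
  variation : ∑ q ∈ Finset.range (Q + 1), |(h q : ℝ) - h (q + 1)| ≤ n * V + B₁
  partial_le : ∑ q ∈ Finset.range (Q + 1), partialColumn n h q ≤
    n * volume.real {y | y ∈ Ioo 0 L ∧ 0 < f y ∧ f y < 1} + B₂
  dist_le : ∑ q ∈ Finset.range Q,
    |(h q : ℝ) / (n : ℝ) ^ 2 - ∫ y in (q / n : ℝ)..((q + 1) / n), f y| ≤ B₃

/-- Outside the window the sampling error applies. Inside it both masses lie in `[0, 1 / n]`, which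
costs at most `1 / n` per column. -/
theorem sum_dist_le (hf : IsRegular L V f G) (hn : 1 ≤ n) (hm : 1 ≤ m)
    (hx : IsSampling L f G n m x) {Q qa qb : ℕ} (hQL : (Q : ℝ) / n ≤ L)
    (hqb : qb ≤ Q) {h : ℕ → ℕ} (hhn : ∀ q, h q ≤ n)
    (hh : ∀ q < Q, ¬(qa ≤ q ∧ q < qb) → h q = ⌊n * f (x (q / m))⌋₊) :
    ∑ q ∈ Finset.range Q, |(h q : ℝ) / (n : ℝ) ^ 2 - ∫ y in (q / n : ℝ)..((q + 1) / n), f y| ≤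
      (Q + n * (m * V)) / (n : ℝ) ^ 2 + ((qb - qa : ℕ) : ℝ) / n := by
  have hn0 : (0 : ℝ) < n := by exact_mod_cast hn
  have hsub : Finset.Ico qa qb ⊆ Finset.range Q := fun q hq => by
    simp only [Finset.mem_Ico, Finset.mem_range] at hq ⊢
    omega
  have hqL : ∀ q < Q, ((q : ℝ) + 1) / n ≤ L := fun q hq => by
    refine le_trans ?_ hQL
    gcongr
    exact_mod_cast hq
  rw [← Finset.sum_sdiff hsub]
  refine add_le_add ?_ ?_
  · calc ∑ q ∈ Finset.range Q \ Finset.Ico qa qb,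
          |(h q : ℝ) / (n : ℝ) ^ 2 - ∫ y in (q / n : ℝ)..((q + 1) / n), f y|
        ≤ ∑ q ∈ Finset.range Q \ Finset.Ico qa qb,
          (1 + n * groupVar f G ((m : ℝ) / n) (q / m)) / (n : ℝ) ^ 2 := by
          refine Finset.sum_le_sum fun q hq => ?_
          obtain ⟨h1, h2⟩ := Finset.mem_sdiff.1 hq
          rw [Finset.mem_range] at h1
          rw [hh q h1 (by simpa using h2), le_div_iff₀ (by positivity)]
          have h3 := abs_column_sub_le hf hn hm hx (hqL q h1)
          have h4 : ((⌊n * f (x (q / m))⌋₊ : ℝ) / (n : ℝ) ^ 2 -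
              ∫ y in (q / n : ℝ)..((q + 1) / n), f y) * (n : ℝ) ^ 2 =
              ⌊n * f (x (q / m))⌋₊ - (n : ℝ) ^ 2 * ∫ y in (q / n : ℝ)..((q + 1) / n), f y := by
            field_simp
          rwa [← h4, abs_mul, abs_of_pos (by positivity : (0 : ℝ) < (n : ℝ) ^ 2)] at h3
      _ ≤ ∑ q ∈ Finset.range Q, (1 + n * groupVar f G ((m : ℝ) / n) (q / m)) / (n : ℝ) ^ 2 :=
          Finset.sum_le_sum_of_subset_of_nonneg Finset.sdiff_subset fun q _ _ => by
            have := groupVar_nonneg f G ((m : ℝ) / n) (q / m)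
            positivity
      _ = (Q + n * ∑ q ∈ Finset.range Q, groupVar f G ((m : ℝ) / n) (q / m)) / (n : ℝ) ^ 2 := by
          rw [← Finset.sum_div, Finset.sum_add_distrib, ← Finset.mul_sum]
          simp
      _ ≤ _ := by
          gcongr
          exact sum_groupVar_div_le hf hm Q
  · calc ∑ q ∈ Finset.Ico qa qb,
          |(h q : ℝ) / (n : ℝ) ^ 2 - ∫ y in (q / n : ℝ)..((q + 1) / n), f y|
        ≤ ∑ _q ∈ Finset.Ico qa qb, 1 / (n : ℝ) := by
          refine Finset.sum_le_sum fun q hq => ?_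
          have hqQ := Finset.mem_range.1 (hsub hq)
          have h1 := hf.integral_mem (a := q / n) (b := (q + 1) / n) (by positivity)
            (by gcongr; linarith) (hqL q hqQ)
          have h2 : ((q : ℝ) + 1) / n - q / n = 1 / n := by ring
          have h3 : (h q : ℝ) / (n : ℝ) ^ 2 ≤ 1 / n := by
            rw [div_le_div_iff₀ (by positivity) hn0]
            have : (h q : ℝ) ≤ n := by exact_mod_cast hhn q
            nlinarith
          have h4 : 0 ≤ (h q : ℝ) / (n : ℝ) ^ 2 := by positivity
          rw [abs_le]
          constructor <;> linarith [h1.1, h1.2]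
      _ = ((qb - qa : ℕ) : ℝ) / n := by
          rw [Finset.sum_const, Nat.card_Ico, nsmul_eq_mul, mul_one_div]

/-- The columns of the window and the last column are counted without further knowledge. Elsewhere
samples 0 and 1 give heights 0 and `n`, so a partial column has its sample strictly between 0 and 1.
-/
theorem sum_partialColumn_le (hf : IsRegular L V f G) (hn : 1 ≤ n) (hm : 1 ≤ m)
    (hx : IsSampling L f G n m x) {Q qa qb : ℕ} (hQL : (Q : ℝ) / n < L)
    {h : ℕ → ℕ} (hh : ∀ q < Q, ¬(qa ≤ q ∧ q < qb) → h q = ⌊n * f (x (q / m))⌋₊) :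
    ∑ q ∈ Finset.range (Q + 1), partialColumn n h q ≤
      ((qb - qa : ℕ) : ℝ) + 1 + n * volume.real {y | y ∈ Ioo 0 L ∧ 0 < f y ∧ f y < 1} := by
  have hn0 : (0 : ℝ) < n := by exact_mod_cast hn
  set T := (Finset.range Q).filter fun q => ¬(qa ≤ q ∧ q < qb) ∧ 0 < h q ∧ h q < n with hT
  have h1 : ∑ q ∈ Finset.range (Q + 1), partialColumn n h q ≤ ((qb - qa : ℕ) : ℝ) + 1 + T.card := by
    have h2 : ∑ q ∈ Finset.range (Q + 1), partialColumn n h q =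
        ((Finset.range (Q + 1)).filter fun q => 0 < h q ∧ h q < n).card := by
      rw [Finset.card_filter]
      push_cast
      rfl
    have h3 : ((Finset.range (Q + 1)).filter fun q => 0 < h q ∧ h q < n) ⊆
        (Finset.Ico qa qb ∪ {Q}) ∪ T := fun q hq => by
      simp only [hT, Finset.mem_filter, Finset.mem_range, Finset.mem_union, Finset.mem_Ico,
        Finset.mem_singleton] at hq ⊢
      by_cases h4 : qa ≤ q ∧ q < qb
      · exact Or.inl (Or.inl h4)
      · by_cases h5 : q = Q
        · exact Or.inl (Or.inr h5)
        · exact Or.inr ⟨by omega, h4, hq.2⟩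
    have h4 : ((Finset.range (Q + 1)).filter fun q => 0 < h q ∧ h q < n).card ≤
        qb - qa + 1 + T.card := by
      refine (Finset.card_le_card h3).trans ((Finset.card_union_le _ _).trans ?_)
      gcongr
      refine (Finset.card_union_le _ _).trans ?_
      rw [Nat.card_Ico, Finset.card_singleton]
    rw [h2]
    exact_mod_cast h4
  have h5 := card_partial_columns_le hf hn hm hx T fun q hq => by
    obtain ⟨h6, h7, h8⟩ := Finset.mem_filter.1 hq
    have hqQ := Finset.mem_range.1 h6
    rw [hh q hqQ h7] at h8
    have hYq := hf.mem_Icc _ (hx (q / m) ((group_start_le hn q).trans_lt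
      (lt_of_le_of_lt (by gcongr) hQL))).1.1
    refine ⟨le_trans ?_ hQL.le, ?_, ?_⟩
    · gcongr
      exact_mod_cast hqQ
    · by_contra h9
      have h10 : f (x (q / m)) = 0 := le_antisymm (not_lt.1 h9) hYq.1
      rw [h10] at h8
      simp at h8
    · by_contra h9
      have h10 : f (x (q / m)) = 1 := le_antisymm hYq.2 (not_lt.1 h9)
      rw [h10] at h8
      simp at h8
  rw [one_div, inv_mul_le_iff₀ hn0] at h5
  linarith

theorem exists_heights (hf : IsRegular L V f G) (hL : 0 < L) (hn : 1 ≤ n) (hm : 1 ≤ m)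
    (hx : IsSampling L f G n m x) (hN : 1 ≤ numSites L n) {Q : ℕ} (hQ : Q = (numSites L n - 1) / n)
    {a b : ℝ} (ha : 0 < a) (hab : a < b) (hb : b < L) {z : ℝ}
    (hz : z = (∫ y in a..b, f y) / (b - a)) {pa pb : ℕ} (hpa : 1 ≤ m * pa)
    (hpb : m * pb ≤ Q) (hqa : ((m * pa : ℕ) : ℝ) / n ≤ a) (hqb : b ≤ ((m * pb : ℕ) : ℝ) / n)
    (hW : ((m * pb : ℕ) : ℝ) / n - ((m * pa : ℕ) : ℝ) / n ≤ b - a + 2 * m / n) {k : ℕ} {ρ : ℝ}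
    (hk : |(k : ℝ) - (n : ℝ) ^ 2 * ∫ y in 0..L, f y| + (L + m * V + 2 + 2 * m) * n ≤
      ρ * (b - a) * (n : ℝ) ^ 2) (hρ : 0 ≤ ρ) (hρz : ρ ≤ z) (hρ1 : ρ * n + 1 ≤ n * (1 - z)) :
    ∃ h : ℕ → ℕ, HeightBounds L V f n k Q h ((L * n + 1) / m + (2 * (ρ * n + 1) + 3))
      (n * (b - a) + 2 * m + 1) ((L * n + n * (m * V)) / (n : ℝ) ^ 2 + (b - a + 2 * m / n)) := by
  have hn0 : (0 : ℝ) < n := by exact_mod_cast hn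
  have hm0 : (0 : ℝ) < m := by exact_mod_cast hm
  set N := numSites L n with hNdef
  have hQ1 : Q * n ≤ N - 1 := hQ ▸ Nat.div_mul_le_self _ _
  have hQ2 : N ≤ Q * n + n := by
    have := Nat.lt_div_mul_add (a := N - 1) (b := n) (by omega)
    rw [← hQ] at this
    omega
  have hNL := numSites_le hL.le n
  have hNL' := lt_numSites_add_one L n
  rw [← hNdef] at hNL hNL'
  -- Dividing `N - 1` instead of `N` leaves at least one site in the column `Q`. Its left end is
  -- thus strictly below `L`, and a sample exists for it.
  have hQL : (Q : ℝ) / n < L := by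
    have h1 : ((Q * n + 1 : ℕ) : ℝ) ≤ N := by exact_mod_cast (by omega : Q * n + 1 ≤ N)
    push_cast at h1
    rw [div_lt_iff₀ hn0]
    have h2 : (Q : ℝ) * n < L * n * n := by nlinarith
    exact lt_of_mul_lt_mul_right h2 hn0.le
  have hQLn : (Q : ℝ) ≤ L * n := ((div_lt_iff₀ hn0).1 hQL).le
  set qa := m * pa with hqadef
  set qb := m * pb with hqbdef
  have hqab : qa < qb := by
    have h1 : (qa : ℝ) / n < (qb : ℝ) / n := lt_of_le_of_lt hqa (lt_of_lt_of_le hab hqb)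
    have h2 := (div_lt_div_iff_of_pos_right hn0).1 h1
    exact_mod_cast h2
  set W := qb - qa with hWdef
  have hWr : (W : ℝ) = (qb : ℝ) - qa := by rw [hWdef, Nat.cast_sub hqab.le]
  have hW0 : (0 : ℝ) < W := by exact_mod_cast (by omega : 0 < W)
  have hWn : (W : ℝ) / n ≤ b - a + 2 * m / n := by rw [hWr, sub_div]; exact hW
  have hWge : n * (b - a) ≤ W := by
    have : b - a ≤ (W : ℝ) / n := by rw [hWr, sub_div]; linarith
    rw [le_div_iff₀ hn0] at this
    linarith
  have hidx : ∀ q, ((min q Q / m : ℕ) : ℝ) * ((m : ℝ) / n) < L := fun q => by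
    refine lt_of_le_of_lt ((group_start_le hn _).trans ?_) hQL
    gcongr
    exact min_le_right _ _
  set Y : ℕ → ℝ := fun q => f (x (min q Q / m)) with hY
  have hY01 : ∀ q, 0 ≤ Y q ∧ Y q ≤ 1 := fun q => hf.mem_Icc _ (hx _ (hidx q)).1.1
  set β : ℕ → ℕ := fun q => ⌊n * Y q⌋₊ with hβ
  have hβn : ∀ q, β q ≤ n := fun q => by
    refine Nat.floor_le_of_le ?_
    nlinarith [hY01 q]
  have hβeq : ∀ q < Q, β q = ⌊n * f (x (q / m))⌋₊ := fun q hq => by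
    simp only [hβ, hY, min_eq_left hq.le]
  set P := min (β Q) (N - Q * n) with hP
  have hPn : P ≤ n := (min_le_left _ _).trans (hβn Q)
  set B := ∑ q ∈ Finset.range Q \ Finset.Ico qa qb, β q with hB
  have hz0 : 0 ≤ z := hρ.trans hρz
  have hmass := (abs_mass_sub_le hf hn hm hx hNL hNL' (by omega) hQ2 hβeq hPn hab hqab.le hpb hqa
    hqb hW k).trans hk
  rw [← hz, ← hWr, ← hB] at hmass
  have hmass' : |(k : ℝ) - B - P - W * (n * z)| ≤ W * (ρ * n) := by
    refine hmass.trans ?_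
    calc ρ * (b - a) * (n : ℝ) ^ 2 = (n * (b - a)) * (ρ * n) := by ring
      _ ≤ W * (ρ * n) := by gcongr
  -- The condition `ρ ≤ z` keeps the mass still to be placed in the window nonnegative.
  have hBk : B + P ≤ k := by
    have h1 : W * (ρ * n) ≤ W * (n * z) := by
      rw [mul_comm (n : ℝ) z]
      gcongr
    have h2 : ((B + P : ℕ) : ℝ) ≤ k := by
      push_cast
      linarith [(abs_le.1 hmass').1]
    exact_mod_cast h2
  set R := k - (B + P) with hR
  have hRr : (R : ℝ) = (k : ℝ) - B - P := by
    rw [hR, Nat.cast_sub hBk]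
    push_cast
    ring
  rw [← hRr] at hmass'
  -- The remaining mass `R` is spread over the `W` columns of the window by division with remainder:
  -- `r` columns receive `c + 1`, the others `c`.
  set c := R / W with hc
  set r := R % W with hr
  have hdiv : W * c + r = R := Nat.div_add_mod R W
  have hrW : r < W := Nat.mod_lt _ (by omega)
  have hdivr : (W : ℝ) * c + r = R := by exact_mod_cast hdiv
  have hrWr : (r : ℝ) < W := by exact_mod_cast hrW
  have hr0 : (0 : ℝ) ≤ r := Nat.cast_nonneg r
  obtain ⟨hm1, hm2⟩ := abs_le.1 hmass'
  have hcu : (c : ℝ) ≤ n * z + ρ * n := by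
    refine le_of_mul_le_mul_left ?_ hW0
    rw [mul_add]
    linarith
  have hcl : n * z - ρ * n ≤ (c : ℝ) + 1 := by
    refine le_of_mul_le_mul_left ?_ hW0
    rw [mul_sub, mul_add]
    linarith
  have hρn : 0 ≤ ρ * n := by positivity
  set h := correctedHeight β qa qb c r with hh
  -- `c` exceeds `n z` by at most `ρ n`, and the condition on `1 - z` leaves room for one more site.
  have hcn : c + 1 ≤ n := by
    have : ((c + 1 : ℕ) : ℝ) ≤ n := by
      push_cast
      linarith
    exact_mod_cast this
  have hhn : ∀ q, h q ≤ n := fun q => by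
    simp only [hh, correctedHeight]
    split_ifs
    · exact hcn
    · omega
    · exact hβn q
  have hhout : ∀ q, ¬(qa ≤ q ∧ q < qb) → h q = β q := fun q hq => by
    simp only [hh, correctedHeight, if_neg hq]
  have hQadd : (((Q + 1) / m : ℕ) : ℝ) ≤ (L * n + 1) / m := by
    refine Nat.cast_div_le.trans ?_
    push_cast
    gcongr
  refine ⟨h, hhn, ?_, ?_, ?_, ?_⟩
  · rw [sum_heightSites h (by omega) hQ2 hhn, hhout Q (by omega), ← hP]
    have h1 := sum_correctedHeight (β := β) (c := c) hqab.le hpb hrW.le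
    rw [← hWdef, hdiv, ← hB, ← hh] at h1
    have h2 : ∑ q ∈ Finset.range Q, h q + P = k := by
      rw [h1]
      omega
    exact_mod_cast h2
  · have h1 := sum_abs_correctedHeight_le (n := n) (m := m) (Q := Q + 1) (c := c) (r := r) (z := z)
      (E := ρ * n + 1) (fun q => (hY01 q).1) (fun q hq => ?_)
      (abs_le.2 ⟨by linarith, by linarith⟩) (abs_le.2 ⟨by linarith, by linarith⟩) hqab
    · refine h1.trans ?_
      have h2 := window_variation_le hf hn hm hx hQL ha hab hb hpa hqab hpb hqa hqb
      rw [← hz] at h2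
      have h3 := mul_le_mul_of_nonneg_left h2 hn0.le
      linarith
    · have h2 : min q Q / m = min (q + 1) Q / m := by
        rcases lt_or_ge q Q with h3 | h3
        · rw [min_eq_left h3.le, min_eq_left h3, hq]
        · rw [min_eq_right h3, min_eq_right (by omega)]
      simp only [hY, h2]
  · have h1 := sum_partialColumn_le hf hn hm hx hQL (h := h) fun q hq hq' => by
      rw [hhout q hq', hβeq q hq]
    rw [← hWdef] at h1
    have h6 : (W : ℝ) ≤ n * (b - a) + 2 * m := by
      rw [div_le_iff₀ hn0] at hWn
      have : (b - a + 2 * m / n) * n = n * (b - a) + 2 * m := by field_simp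
      linarith
    linarith
  · have h1 := sum_dist_le hf hn hm hx hQL.le hpb hhn fun q hq hq' => by
      rw [hhout q hq', hβeq q hq]
    refine h1.trans ?_
    rw [← hWdef]
    gcongr

end Heights

/-! ### Recovery configurations -/

theorem integral_column_spinOfSites {L : ℝ} {n k Q : ℕ} {h : ℕ → ℕ} (hn : 1 ≤ n)
    (hQ : Q * n ≤ numSites L n) (hh : ∀ q, h q ≤ n)
    (hv : spinOfSites L n (heightSites n h) ∈ spinFunctions L n k) {q : ℕ} (hq : q < Q) :
    ∫ y in (q / n : ℝ)..((q + 1) / n), spinOfSites L n (heightSites n h) y =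
      (h q : ℝ) / (n : ℝ) ^ 2 := by
  have hn0 : (0 : ℝ) < n := by exact_mod_cast hn
  have hle : (q + 1) * n ≤ numSites L n := (Nat.mul_le_mul_right n hq).trans hQ
  have h1 := integral_spin_cells hv (p := q * n) (q := (q + 1) * n)
    (Nat.mul_le_mul_right n (by omega)) hle
  have h2 : ((q * n : ℕ) : ℝ) * (1 / (n : ℝ) ^ 2) = q / n := by push_cast; field_simp
  have h3 : (((q + 1) * n : ℕ) : ℝ) * (1 / (n : ℝ) ^ 2) = (q + 1) / n := by push_cast; field_simp
  rw [h2, h3] at h1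
  rw [h1, Finset.sum_Ico_eq_sum_range, show (q + 1) * n - q * n = n by
    rw [add_mul, one_mul, Nat.add_sub_cancel_left]]
  have h4 : ∀ r ∈ Finset.range n, site n (spinOfSites L n (heightSites n h)) (q * n + r + 1) =
      if r ∈ Finset.range (h q) then 1 else 0 := fun r hr => by
    have hr' := Finset.mem_range.1 hr
    rw [site_spinOfSites hn _ (Finset.mem_Icc.2 ⟨by omega, by
      rw [add_mul, one_mul] at hle; omega⟩), heightSites_eq h q hr']
    simp
  rw [Finset.sum_congr rfl h4, Finset.sum_ite_mem, Finset.sum_const, nsmul_eq_mul, mul_one,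
    Finset.range_inter_range, Finset.card_range, min_eq_right (hh q)]
  ring

theorem eventually_lt_of_continuous {g : ℝ → ℝ} (hg : Continuous g) {ε : ℝ} (h : g 0 < ε) :
    ∀ᶠ n : ℕ in atTop, g (1 / (n : ℝ)) < ε :=
  ((hg.tendsto 0).comp (tendsto_const_div_atTop_nhds_zero_nat 1)).eventually (gt_mem_nhds h)

/-- `(a, b)` is enlarged to whole groups, by at most `m` columns on either side. The bound `m / a`
leaves a full group on the left; `(m + 3) / (L - b)` gives `m pb ≤ b n + m ≤ L n - 3 ≤ Q`. -/
theorem exists_window_indices {L a b : ℝ} {n m : ℕ} (hn1 : 1 ≤ n) (hm1 : 1 ≤ m) (ha : 0 < a)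
    (hab : a < b) (hb : b < L) (h1 : m / a ≤ (n : ℝ)) (h2 : (m + 3) / (L - b) ≤ (n : ℝ)) :
    ∃ pa pb : ℕ, 1 ≤ m * pa ∧ m * pb ≤ (numSites L n - 1) / n ∧ 1 ≤ (numSites L n - 1) / n ∧
      ((m * pa : ℕ) : ℝ) / n ≤ a ∧ b ≤ ((m * pb : ℕ) : ℝ) / n ∧
      ((m * pb : ℕ) : ℝ) / n - ((m * pa : ℕ) : ℝ) / n ≤ b - a + 2 * m / n := by
  have hn0 : (0 : ℝ) < n := by exact_mod_cast hn1
  have hn1' : (1 : ℝ) ≤ n := by exact_mod_cast hn1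
  have hm0 : (0 : ℝ) < m := by exact_mod_cast hm1
  set Q := (numSites L n - 1) / n with hQ
  set pa := ⌊a * n / m⌋₊ with hpa
  set pb := ⌈b * n / m⌉₊ with hpb
  have hpa1 : 1 ≤ pa := by
    refine Nat.le_floor ?_
    rw [Nat.cast_one, le_div_iff₀ hm0, one_mul]
    rw [div_le_iff₀ ha] at h1
    linarith
  have hpau : (m : ℝ) * pa ≤ a * n := by
    have := Nat.floor_le (show 0 ≤ a * n / m by positivity)
    rw [le_div_iff₀ hm0] at this
    linarith
  have hpal : a * n - m ≤ (m : ℝ) * pa := by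
    have := Nat.lt_floor_add_one (a * n / m)
    rw [div_lt_iff₀ hm0] at this
    linarith
  have hb0 : 0 < b := by linarith
  have hpbl : b * n ≤ (m : ℝ) * pb := by
    have := Nat.le_ceil (b * n / m)
    rw [div_le_iff₀ hm0] at this
    linarith
  have hpbu : (m : ℝ) * pb ≤ b * n + m := by
    have := (Nat.ceil_lt_add_one (show 0 ≤ b * n / m by positivity)).le
    rw [← hpb] at this
    calc (m : ℝ) * pb ≤ m * (b * n / m + 1) := by gcongr
      _ = _ := by field_simp
  have hQl : L * n - 3 ≤ (Q : ℝ) := by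
    have e1 : numSites L n ≤ Q * n + n := by
      have := Nat.lt_div_mul_add (a := numSites L n - 1) (b := n) (by omega)
      rw [← hQ] at this
      omega
    have e2 : (numSites L n : ℝ) ≤ Q * n + n := by exact_mod_cast e1
    have e3 := lt_numSites_add_one L n
    have e4 : (L * n - 3) * n ≤ Q * n := by nlinarith
    exact le_of_mul_le_mul_right e4 hn0
  have hpbQ : m * pb ≤ Q := by
    have e1 : ((m * pb : ℕ) : ℝ) ≤ Q := by
      push_cast
      rw [div_le_iff₀ (by linarith)] at h2
      nlinarith
    exact_mod_cast e1
  have hpb1 : 1 ≤ pb := Nat.one_le_ceil_iff.2 (by positivity)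
  have hQ1 : 1 ≤ Q := (Nat.mul_le_mul hm1 hpb1).trans hpbQ
  refine ⟨pa, pb, Nat.mul_le_mul hm1 hpa1, hpbQ, hQ1, ?_, ?_, ?_⟩
  · rw [div_le_iff₀ hn0]
    push_cast
    exact hpau
  · rw [le_div_iff₀ hn0]
    push_cast
    exact hpbl
  · rw [← sub_div, div_le_iff₀ hn0]
    push_cast
    have : (b - a + 2 * m / n) * n = b * n - a * n + 2 * m := by field_simp
    rw [this]
    linarith

theorem HeightBounds.energy_le {L V B₁ B₂ B₃ : ℝ} {f : ℝ → ℝ} {n k Q : ℕ} {h : ℕ → ℕ}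
    (hh : HeightBounds L V f n k Q h B₁ B₂ B₃) (hn : 2 ≤ n) (hQ : numSites L n ≤ (Q + 1) * n) :
    energy L n (spinOfSites L n (heightSites n h)) ≤
      2 * volume.real {y | y ∈ Ioo 0 L ∧ 0 < f y ∧ f y < 1} + V +
        (B₁ / n + 2 * (B₂ / n) + 1 / n + 2 * (1 / n) * (V + B₁ / n)) := by
  have hn1 : 1 ≤ n := by omega
  have hn0 : (0 : ℝ) < n := by exact_mod_cast hn1
  rw [energy_spinOfSites hn]
  have e1 := shortEnergy_heightSites_le hn1 hh.le hQ
  have e2 := longEnergy_heightSites_le hn1 hh.le (hQ.trans (Nat.le_add_right _ n))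
  set D := ∑ q ∈ Finset.range (Q + 1), |(h q : ℝ) - h (q + 1)|
  set S := volume.real {y | y ∈ Ioo 0 L ∧ 0 < f y ∧ f y < 1}
  have e3 : 1 / (n : ℝ) * D ≤ V + B₁ / n := by
    calc 1 / (n : ℝ) * D ≤ 1 / (n : ℝ) * (n * V + B₁) := by
          gcongr
          exact hh.variation
      _ = _ := by field_simp
  have e4 : 1 / (n : ℝ) * ∑ q ∈ Finset.range (Q + 1), partialColumn n h q ≤ S + B₂ / n := by
    calc _ ≤ 1 / (n : ℝ) * (n * S + B₂) := by
          gcongr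
          exact hh.partial_le
      _ = _ := by field_simp
  have e5 : 2 / (n : ℝ) * (1 / (n : ℝ) * D) ≤ 2 * (1 / n) * (V + B₁ / n) := by
    calc 2 / (n : ℝ) * (1 / (n : ℝ) * D) ≤ 2 / (n : ℝ) * (V + B₁ / n) := by gcongr
      _ = _ := by ring
  linarith

theorem eventually_exists_spin {L V σ : ℝ} {f : ℝ → ℝ} {G : Set ℝ} {k : ℕ → ℕ}
    (hf : IsRegular L V f G) (hL : 0 < L) (hσ0 : 0 < σ) (hσ1 : σ < 1)
    (hint : ∫ y in 0..L, f y = L * σ)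
    (hkσ : Tendsto (fun n : ℕ => (k n : ℝ) / (L * (n : ℝ) ^ 2)) atTop (𝓝 σ)) {ε : ℝ}
    (hε : 0 < ε) :
    ∀ᶠ n in atTop, ∃ v ∈ spinFunctions L n (k n),
      energy L n v ≤ 2 * volume.real {y | y ∈ Ioo 0 L ∧ 0 < f y ∧ f y < 1} + V + ε ∧
      ∑ q ∈ Finset.range ((numSites L n - 1) / n), |(∫ y in (q / n : ℝ)..((q + 1) / n), v y) -
        ∫ y in (q / n : ℝ)..((q + 1) / n), f y| ≤ ε := by
  obtain ⟨a, b, ha, hab, hb, hbε, hI0, hI1⟩ := hf.exists_window hL (by rw [hint]; positivity)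
    (by rw [hint]; nlinarith) (by linarith : 0 < ε / 8)
  set z := (∫ y in a..b, f y) / (b - a) with hz
  have hba : 0 < b - a := by linarith
  have hz0 : 0 < z := div_pos hI0 hba
  have hz1 : z < 1 := (div_lt_one hba).2 hI1
  obtain ⟨M, hM⟩ := exists_nat_gt (8 * L / ε)
  set m := M + 1 with hm
  have hm1 : 1 ≤ m := by omega
  have hm0 : (0 : ℝ) < m := by exact_mod_cast hm1
  have hLm : L / m ≤ ε / 8 := by
    rw [div_lt_iff₀ hε] at hM
    rw [div_le_iff₀ hm0, hm]
    push_cast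
    linarith
  -- `ρ` is the admissible correction of a height relative to `n`: small for the energy, and such
  -- that the corrected heights stay between 0 and `n`.
  set ρ := min (ε / 16) (min z ((1 - z) / 2)) with hρ
  have hρ0 : 0 < ρ := lt_min (by linarith) (lt_min hz0 (by linarith))
  have hρε : ρ ≤ ε / 16 := min_le_left _ _
  have hρz : ρ ≤ z := (min_le_right _ _).trans (min_le_left _ _)
  have hρ1 : ρ ≤ (1 - z) / 2 := (min_le_right _ _).trans (min_le_right _ _)
  have ev1 : ∀ᶠ n : ℕ in atTop, m / a ≤ (n : ℝ) :=
    tendsto_natCast_atTop_atTop.eventually_ge_atTop _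
  have ev2 : ∀ᶠ n : ℕ in atTop, (m + 3) / (L - b) ≤ (n : ℝ) :=
    tendsto_natCast_atTop_atTop.eventually_ge_atTop _
  have ev3 : ∀ᶠ n : ℕ in atTop, 2 / (1 - z) ≤ (n : ℝ) :=
    tendsto_natCast_atTop_atTop.eventually_ge_atTop _
  have ev4 : ∀ᶠ n : ℕ in atTop, L * |(k n : ℝ) / (L * (n : ℝ) ^ 2) - σ| +
      (L + m * V + 2 + 2 * m) * (1 / (n : ℝ)) < ρ * (b - a) := by
    have h1 : Tendsto (fun n : ℕ => L * |(k n : ℝ) / (L * (n : ℝ) ^ 2) - σ| +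
        (L + m * V + 2 + 2 * m) * (1 / (n : ℝ))) atTop
        (𝓝 (L * |σ - σ| + (L + m * V + 2 + 2 * m) * 0)) :=
      (((hkσ.sub_const σ).abs).const_mul L).add
        ((tendsto_const_div_atTop_nhds_zero_nat 1).const_mul _)
    refine h1.eventually (gt_mem_nhds ?_)
    simp only [sub_self, abs_zero, mul_zero, add_zero]
    positivity
  -- This is the excess energy as a function of `t = 1 / n`. At `t = 0` it equals `L / m + 2 ρ + 2
  -- (b - a)`, at most `ε / 2` by the choice of `m`, `ρ` and the window.
  have ev5 := eventually_lt_of_continuous (ε := ε) (g := fun t => (L / m + t / m + 2 * ρ + 5 * t) +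
    2 * ((b - a) + (2 * m + 1) * t) + t + 2 * t * (V + (L / m + t / m + 2 * ρ + 5 * t)))
    (by fun_prop) (by simp only [zero_div, mul_zero, zero_mul, add_zero]; linarith)
  have ev6 := eventually_lt_of_continuous (ε := ε) (g := fun t => (L + m * V) * t +
    (b - a + 2 * m * t)) (by fun_prop) (by simp only [mul_zero, add_zero, zero_add]; linarith)
  filter_upwards [ev1, ev2, ev3, ev4, ev5, ev6, eventually_ge_atTop 2] with n h1 h2 h3 h4 h5 h6 h7
  have hn1 : 1 ≤ n := by omega
  have hn0 : (0 : ℝ) < n := by exact_mod_cast hn1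
  have hn2 : (2 : ℝ) ≤ n := by exact_mod_cast h7
  obtain ⟨x, hx⟩ := hf.exists_samples (div_pos hm0 hn0)
  set Q := (numSites L n - 1) / n with hQ
  obtain ⟨pa, pb, hpa1, hpbQ, hQ1, hpau, hpbl, hW⟩ := exists_window_indices hn1 hm1 ha hab h1
    (hb := hb) h2
  rw [← hQ] at hpbQ hQ1
  have hN : 1 ≤ numSites L n := by
    by_contra hc
    rw [hQ, show numSites L n - 1 = 0 by omega, Nat.zero_div] at hQ1
    omega
  have hk : |(k n : ℝ) - (n : ℝ) ^ 2 * ∫ y in 0..L, f y| + (L + m * V + 2 + 2 * m) * n ≤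
      ρ * (b - a) * (n : ℝ) ^ 2 := by
    have e1 : (k n : ℝ) - (n : ℝ) ^ 2 * ∫ y in 0..L, f y =
        (L * (n : ℝ) ^ 2) * ((k n : ℝ) / (L * (n : ℝ) ^ 2) - σ) := by
      rw [hint]
      field_simp
    rw [e1, abs_mul, abs_of_pos (by positivity : 0 < L * (n : ℝ) ^ 2)]
    calc _ = (L * |(k n : ℝ) / (L * (n : ℝ) ^ 2) - σ| +
          (L + m * V + 2 + 2 * m) * (1 / (n : ℝ))) * (n : ℝ) ^ 2 := by field_simp
      _ ≤ _ := by gcongr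
  obtain ⟨h, hh⟩ := exists_heights hf hL hn1 hm1 hx hN hQ ha hab hb hz hpa1 hpbQ hpau hpbl hW hk
    hρ0.le hρz (by
      rw [div_le_iff₀ (by linarith)] at h3
      nlinarith)
  have hv := spinOfSites_mem hn1 (heightSites_eq_zero_or_one n h) hh.mass
  have hQn : Q * n ≤ numSites L n := (Nat.div_mul_le_self _ _).trans (Nat.sub_le _ _)
  refine ⟨_, hv, ?_, ?_⟩
  · have hQ2 : numSites L n ≤ (Q + 1) * n := by
      have := Nat.lt_div_mul_add (a := numSites L n - 1) (b := n) (by omega)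
      rw [← hQ] at this
      rw [add_mul, one_mul]
      omega
    refine (hh.energy_le h7 hQ2).trans ?_
    have e1 : ((L * n + 1) / m + (2 * (ρ * n + 1) + 3)) / (n : ℝ) =
        L / m + 1 / n / m + 2 * ρ + 5 * (1 / n) := by
      field_simp
      ring
    have e2 : ((n : ℝ) * (b - a) + 2 * m + 1) / n = (b - a) + (2 * m + 1) * (1 / n) := by
      field_simp
      ring
    rw [e1, e2]
    linarith
  · refine le_trans (le_of_eq (Finset.sum_congr rfl fun q hq => ?_)) (hh.dist_le.trans ?_)
    · rw [integral_column_spinOfSites hn1 hQn hh.le hv (Finset.mem_range.1 hq)]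
    · refine le_trans (le_of_eq ?_) h6.le
      field_simp

/-! ### Weak convergence from convergence of the column means -/

/-- On each column `g` is replaced by its value at the left end, with error at most `ω`. The part
beyond the last counted column has length at most `2 / n`. -/
theorem abs_integral_mul_le {L C ω : ℝ} {n Q : ℕ} {d g : ℝ → ℝ} (hn : 1 ≤ n)
    (hQL : (Q : ℝ) / n ≤ L) (hQL' : L ≤ Q / n + 2 / n) (hd : Integrable d)
    (hd1 : ∀ᵐ x, x ∈ Ioo 0 L → |d x| ≤ 1) (hg : Continuous g) (hC0 : 0 ≤ C) (hC : ∀ x, |g x| ≤ C)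
    (hω0 : 0 ≤ ω) (hω : ∀ x y : ℝ, |x - y| ≤ 1 / (n : ℝ) → |g x - g y| ≤ ω) :
    |∫ x, d x * g x ∂(mu L)| ≤
      C * (∑ q ∈ Finset.range Q, |∫ x in (q / n : ℝ)..((q + 1) / n), d x|) + L * ω + 2 * C / n := by
  have hn0 : (0 : ℝ) < n := by exact_mod_cast hn
  have hQ0 : (0 : ℝ) ≤ (Q : ℝ) / n := by positivity
  have hdg : Integrable fun x => d x * g x := hd.mul_bdd (c := C) hg.aestronglyMeasurable
    (ae_of_all _ hC)
  have hi : ∀ a b : ℝ, IntervalIntegrable (fun x => d x * g x) volume a b := fun a b =>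
    hdg.intervalIntegrable
  have e1 : ∫ x, d x * g x ∂(mu L) = ∫ x in 0..L, d x * g x := by
    rw [intervalIntegral.integral_of_le (hQ0.trans hQL), integral_Ioc_eq_integral_Ioo]
  have e2 := intervalIntegral.integral_add_adjacent_intervals (hi 0 (Q / n)) (hi (Q / n) L)
  have e3 := sum_column_integrals (n := n) hdg (Nat.zero_le Q)
  rw [Nat.cast_zero, zero_div, ← Finset.range_eq_Ico] at e3
  have hbound : ∀ {s t B : ℝ} {ψ : ℝ → ℝ}, 0 ≤ s → s ≤ t → t ≤ L → 0 ≤ B →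
      (∀ x ∈ Ioc s t, |ψ x| ≤ B) → |∫ x in s..t, d x * ψ x| ≤ B * (t - s) := by
    intro s t B ψ hs hst ht hB hψ
    have h1 := intervalIntegral.norm_integral_le_of_norm_le_const_ae (a := s) (b := t)
      (f := fun x => d x * ψ x) (C := B) ?_
    · rwa [Real.norm_eq_abs, abs_of_nonneg (sub_nonneg.2 hst)] at h1
    · rw [uIoc_of_le hst]
      have h2 : ∀ᵐ x : ℝ, x ≠ L := by simp [ae_iff]
      filter_upwards [hd1, h2] with x hx hxL hx'
      rw [Real.norm_eq_abs, abs_mul]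
      have h3 := hx ⟨hs.trans_lt hx'.1, lt_of_le_of_ne (hx'.2.trans ht) hxL⟩
      calc |d x| * |ψ x| ≤ 1 * B := mul_le_mul h3 (hψ x hx') (abs_nonneg _) zero_le_one
        _ = B := one_mul B
  have hterm : ∀ q ∈ Finset.range Q, |∫ x in (q / n : ℝ)..((q + 1) / n), d x * g x| ≤
      C * |∫ x in (q / n : ℝ)..((q + 1) / n), d x| + ω * (1 / n) := by
    intro q hq
    have hq1 : ((q : ℝ) + 1) / n ≤ Q / n := by
      gcongr
      exact_mod_cast Finset.mem_range.1 hq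
    have hlen : ((q : ℝ) + 1) / n - q / n = 1 / n := by ring
    have hle : (q : ℝ) / n ≤ ((q : ℝ) + 1) / n := by gcongr; linarith
    have h1 : ∫ x in (q / n : ℝ)..((q + 1) / n), d x * g x =
        g (q / n) * (∫ x in (q / n : ℝ)..((q + 1) / n), d x) +
          ∫ x in (q / n : ℝ)..((q + 1) / n), d x * (g x - g (q / n)) := by
      have h2 : ∀ x, d x * (g x - g (q / n)) = d x * g x - d x * g (q / n) := fun x => mul_sub _ _ _
      simp_rw [h2]
      rw [intervalIntegral.integral_sub (hi _ _) (hd.mul_const _).intervalIntegrable,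
        intervalIntegral.integral_mul_const]
      ring
    rw [h1]
    refine (abs_add_le _ _).trans (add_le_add ?_ ?_)
    · rw [abs_mul]
      gcongr
      exact hC _
    · rw [← hlen]
      refine hbound (by positivity) hle (hq1.trans hQL) hω0 fun x hx => hω _ _ ?_
      rw [abs_of_nonneg (by linarith [hx.1])]
      linarith [hx.2]
  have htail : |∫ x in (Q / n : ℝ)..L, d x * g x| ≤ C * (2 / n) :=
    (hbound hQ0 hQL le_rfl hC0 fun x _ => hC x).trans (by gcongr; linarith)
  have hsum : |∫ x in (0 : ℝ)..(Q / n), d x * g x| ≤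
      C * (∑ q ∈ Finset.range Q, |∫ x in (q / n : ℝ)..((q + 1) / n), d x|) + ω * (Q / n) := by
    rw [← e3]
    refine (Finset.abs_sum_le_sum_abs _ _).trans ((Finset.sum_le_sum hterm).trans (le_of_eq ?_))
    rw [Finset.sum_add_distrib, ← Finset.mul_sum, Finset.sum_const, Finset.card_range, nsmul_eq_mul]
    ring
  rw [e1, ← e2]
  refine (abs_add_le _ _).trans ?_
  have h1 : ω * (Q / n) ≤ L * ω := by
    rw [mul_comm L]
    gcongr
  have h2 : C * (2 / n) = 2 * C / n := by ring
  linarith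

theorem columnCount_bounds {L : ℝ} (hL : 0 < L) {n : ℕ} (hn : 2 ≤ n) :
    (((numSites L n - 1) / n : ℕ) : ℝ) / n ≤ L ∧
      L ≤ (((numSites L n - 1) / n : ℕ) : ℝ) / n + 2 / n := by
  have hn0 : (2 : ℝ) ≤ n := by exact_mod_cast hn
  have hn1 : (0 : ℝ) < n := by linarith
  set Q := (numSites L n - 1) / n with hQ
  have h1 : Q * n ≤ numSites L n := (Nat.div_mul_le_self _ _).trans (Nat.sub_le _ _)
  have h2 : numSites L n ≤ Q * n + n := by
    have := Nat.lt_div_mul_add (a := numSites L n - 1) (b := n) (by omega)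
    rw [← hQ] at this
    omega
  have h3 : (Q : ℝ) * n ≤ numSites L n := by exact_mod_cast h1
  have h4 : (numSites L n : ℝ) ≤ Q * n + n := by exact_mod_cast h2
  have h5 := numSites_le hL.le n
  have h6 := lt_numSites_add_one L n
  constructor
  · rw [div_le_iff₀ hn1]
    have : (Q : ℝ) * n ≤ L * n * n := by nlinarith
    exact le_of_mul_le_mul_right this hn1
  · rw [← add_div, le_div_iff₀ hn1]
    have : L * n * n ≤ ((Q : ℝ) + 2) * n := by nlinarith
    exact le_of_mul_le_mul_right this hn1

/-- Bounded functions whose column means converge to those of `f` converge to `f` weakly. -/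
theorem testTendsto_of_columns {L : ℝ} (hL : 0 < L) {v : ℕ → ℝ → ℝ} {f : ℝ → ℝ}
    (hf : Integrable f) (hvi : ∀ᶠ n in atTop, Integrable (v n))
    (hd1 : ∀ᶠ n in atTop, ∀ᵐ x, x ∈ Ioo 0 L → |v n x - f x| ≤ 1)
    (hcol : ∀ ε > 0, ∀ᶠ n : ℕ in atTop, ∑ q ∈ Finset.range ((numSites L n - 1) / n),
      |(∫ y in (q / n : ℝ)..((q + 1) / n), v n y) - ∫ y in (q / n : ℝ)..((q + 1) / n), f y| ≤ ε) :
    ∀ g : ℝ → ℝ, Integrable g (mu L) →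
      Tendsto (fun n => ∫ x, (v n x - f x) * g x ∂(mu L)) atTop (𝓝 0) := by
  intro g hg
  rw [Metric.tendsto_atTop']
  suffices H : ∀ ε > 0, ∀ᶠ n : ℕ in atTop, |∫ x, (v n x - f x) * g x ∂(mu L)| < ε by
    intro ε hε
    obtain ⟨N, hN⟩ := eventually_atTop.1 (H ε hε)
    exact ⟨N, fun n hn => by simpa using hN n hn.le⟩
  intro ε hε
  -- Since `|v n - f| ≤ 1`, an `L¹`-small change of the test function is harmless; the approximant
  -- is uniformly continuous.
  obtain ⟨ψ, hψs, hψ, hψc, -⟩ := hg.exists_hasCompactSupport_integral_sub_le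
    (by positivity : 0 < ε / 4)
  obtain ⟨C, hC⟩ := hψs.exists_bound_of_continuous hψc
  have hC0 : 0 ≤ C := (norm_nonneg _).trans (hC 0)
  have huc := hψs.uniformContinuous_of_continuous hψc
  obtain ⟨δ, hδ, hδω⟩ := Metric.uniformContinuous_iff.1 huc (ε / (8 * L)) (by positivity)
  have ev1 : ∀ᶠ n : ℕ in atTop, 1 / (n : ℝ) < δ :=
    (tendsto_const_div_atTop_nhds_zero_nat 1).eventually (gt_mem_nhds hδ)
  have ev2 : ∀ᶠ n : ℕ in atTop, 2 * C / (n : ℝ) < ε / 8 :=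
    (tendsto_const_div_atTop_nhds_zero_nat (2 * C)).eventually (gt_mem_nhds (by positivity))
  filter_upwards [ev1, ev2, hvi, hd1, hcol (ε / (8 * (C + 1))) (by positivity),
    eventually_ge_atTop 2] with n h1 h2 h3 h4 h5 h6
  obtain ⟨hQ1, hQ2⟩ := columnCount_bounds hL h6
  have hdi : Integrable fun x => v n x - f x := h3.sub hf
  have e1 := abs_integral_mul_le (d := fun x => v n x - f x) (by omega : 1 ≤ n) hQ1 hQ2 hdi h4 hψc
    hC0 hC (by positivity : 0 ≤ ε / (8 * L)) fun x y hxy => (hδω (hxy.trans_lt h1)).le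
  have e2 : ∀ q : ℕ, ∫ x in (q / n : ℝ)..((q + 1) / n), (v n x - f x) =
      (∫ y in (q / n : ℝ)..((q + 1) / n), v n y) - ∫ y in (q / n : ℝ)..((q + 1) / n), f y :=
    fun q => intervalIntegral.integral_sub h3.intervalIntegrable hf.intervalIntegrable
  simp_rw [e2] at e1
  have e3 : C * (ε / (8 * (C + 1))) ≤ ε / 8 := by
    calc C * (ε / (8 * (C + 1))) ≤ (C + 1) * (ε / (8 * (C + 1))) := by gcongr; linarith
      _ = ε / 8 := by field_simp
  have e4 : L * (ε / (8 * L)) = ε / 8 := by field_simp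
  have e5 := mul_le_mul_of_nonneg_left h5 hC0
  have hae : ∀ᵐ x ∂(mu L), |v n x - f x| ≤ 1 := (ae_restrict_iff' measurableSet_Ioo).2 h4
  have hψi : Integrable ψ (mu L) := (hψc.integrable_of_hasCompactSupport hψs).restrict
  have hb : ∀ {χ : ℝ → ℝ}, Integrable χ (mu L) →
      Integrable (fun x => (v n x - f x) * χ x) (mu L) := fun hχ =>
    hχ.bdd_mul (c := 1) hdi.restrict.aestronglyMeasurable hae
  have e6 : |∫ x, (v n x - f x) * (g x - ψ x) ∂(mu L)| ≤ ε / 4 := by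
    refine le_trans ?_ hψ
    refine (abs_integral_le_integral_abs).trans (integral_mono_ae (hb (hg.sub hψi)).abs
      (hg.sub hψi).norm (hae.mono fun x hx => ?_))
    simp only [abs_mul, Real.norm_eq_abs]
    exact mul_le_of_le_one_left (abs_nonneg _) hx
  have e7 : ∫ x, (v n x - f x) * g x ∂(mu L) = (∫ x, (v n x - f x) * ψ x ∂(mu L)) +
      ∫ x, (v n x - f x) * (g x - ψ x) ∂(mu L) := by
    have h := integral_add (hb hψi) (hb (hg.sub hψi))
    simp only [Pi.sub_apply] at h
    rw [← h]
    congr 1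
    ext x
    ring
  rw [e7]
  refine (abs_add_le _ _).trans_lt ?_
  linarith

/-! ### The limsup inequality -/

/-- For each `n` take the largest `j ≤ n` for which the tolerance `1 / (j + 1)` can be met. For a
fixed tolerance this `j` is eventually large enough, and monotonicity in `ε` concludes. -/
theorem exists_diagonal {X : Type*} [Nonempty X] {P : ℝ → ℕ → X → Prop}
    (hmono : ∀ ε ε' n v, ε ≤ ε' → P ε n v → P ε' n v)
    (h : ∀ ε > 0, ∀ᶠ n in atTop, ∃ v, P ε n v) :
    ∃ v : ℕ → X, ∀ ε > 0, ∀ᶠ n in atTop, P ε n (v n) := by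
  classical
  let Q : ℕ → ℕ → Prop := fun n j => ∃ v, P (1 / ((j : ℝ) + 1)) n v
  have hex : ∀ n, ∃ v, Q n (Nat.findGreatest (Q n) n) →
      P (1 / ((Nat.findGreatest (Q n) n : ℝ) + 1)) n v := fun n => by
    by_cases hn : Q n (Nat.findGreatest (Q n) n)
    · obtain ⟨v, hv⟩ := hn
      exact ⟨v, fun _ => hv⟩
    · exact ⟨Classical.arbitrary X, fun h => absurd h hn⟩
  choose v hv using hex
  refine ⟨v, fun ε hε => ?_⟩
  obtain ⟨j, hj⟩ := exists_nat_one_div_lt hε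
  filter_upwards [h (1 / ((j : ℝ) + 1)) (by positivity), eventually_ge_atTop j] with n hn hjn
  refine hmono _ _ _ _ ?_ (hv n (Nat.findGreatest_spec (P := Q n) hjn hn))
  refine le_trans (Nat.one_div_le_one_div ?_) hj.le
  exact Nat.le_findGreatest hjn hn

theorem exists_recovery_sequence {L σ : ℝ} (hL : 0 < L) (hσ0 : 0 < σ) (hσ1 : σ < 1) {k : ℕ → ℕ}
    (hkσ : Tendsto (fun n : ℕ => (k n : ℝ) / (L * (n : ℝ) ^ 2)) atTop (𝓝 σ)) (u : LInfty L) :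
    ∃ w : ℕ → LInfty L, WeakStarTendsto L w u ∧
      limsup (fun n => discreteFunctional L n (k n) (w n)) atTop ≤ limitFunctional L σ u := by
  by_cases hcond : IsBV L (u : ℝ → ℝ) ∧
      (∀ᵐ x ∂(mu L), 0 ≤ (u : ℝ → ℝ) x ∧ (u : ℝ → ℝ) x ≤ 1) ∧ ∫ x, (u : ℝ → ℝ) x ∂(mu L) = L * σ
  swap
  -- The limit functional is infinite here, so the constant sequence serves.
  · refine ⟨fun _ => u, fun g _ => tendsto_const_nhds, ?_⟩
    rw [limitFunctional, if_neg hcond]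
    exact le_top
  obtain ⟨hBV, h01, hmean⟩ := hcond
  obtain ⟨G₀, hG₀, hG₀ae, hG₀V⟩ := exists_good_set hBV
  set f : ℝ → ℝ := (Ioo 0 L).indicator (u : ℝ → ℝ) with hfdef
  have hfu : ∀ x ∈ Ioo 0 L, f x = (u : ℝ → ℝ) x := fun x hx => indicator_of_mem hx _
  set V := (totalVar L (u : ℝ → ℝ)).toReal with hVdef
  have hVtop : ENNReal.ofReal V = totalVar L (u : ℝ → ℝ) := ENNReal.ofReal_toReal hBV.2.ne
  have hf : IsRegular L V f (G₀ ∩ {x | 0 ≤ (u : ℝ → ℝ) x ∧ (u : ℝ → ℝ) x ≤ 1}) :=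
    { integrable := (integrable_indicator_iff measurableSet_Ioo).2 hBV.1
      subset := inter_subset_left.trans hG₀
      ae_mem := by filter_upwards [hG₀ae, h01] with x h1 h2 using ⟨h1, h2⟩
      mem_Icc := fun x hx => by rw [hfu x (hG₀ hx.1)]; exact hx.2
      variation_le := by
        rw [hVtop, eVariationOn.eq_of_eqOn fun x hx => hfu x (hG₀ hx.1)]
        exact (eVariationOn.mono _ inter_subset_left).trans hG₀V
      nonneg := ENNReal.toReal_nonneg }
  have hint : ∫ y in 0..L, f y = L * σ := by
    rw [intervalIntegral.integral_of_le hL.le, integral_Ioc_eq_integral_Ioo, ← hmean]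
    exact setIntegral_congr_fun measurableSet_Ioo hfu
  set S := {x : ℝ | x ∈ Ioo 0 L ∧ 0 < (u : ℝ → ℝ) x ∧ (u : ℝ → ℝ) x < 1} with hS
  have hSf : {y | y ∈ Ioo 0 L ∧ 0 < f y ∧ f y < 1} = S := by
    ext y
    refine and_congr_right fun hy => ?_
    rw [hfu y hy]
  have hStop : volume S ≠ ∞ := ne_top_of_le_ne_top (by simp)
    (measure_mono (t := Ioo 0 L) fun x hx => hx.1)
  obtain ⟨v, hv⟩ := exists_diagonal (X := ℝ → ℝ) (P := fun ε n v => v ∈ spinFunctions L n (k n) ∧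
      energy L n v ≤ 2 * volume.real S + V + ε ∧
      ∑ q ∈ Finset.range ((numSites L n - 1) / n), |(∫ y in (q / n : ℝ)..((q + 1) / n), v y) -
        ∫ y in (q / n : ℝ)..((q + 1) / n), f y| ≤ ε)
    (fun ε ε' n v hε hP => ⟨hP.1, hP.2.1.trans (by linarith), hP.2.2.trans hε⟩)
    (fun ε hε => by
      have := eventually_exists_spin hf hL hσ0 hσ1 hint hkσ hε
      rw [hSf] at this
      exact this)
  have hspin : ∀ᶠ n in atTop, 1 ≤ n ∧ v n ∈ spinFunctions L n (k n) :=
    (eventually_ge_atTop 1).and ((hv 1 one_pos).mono fun n hn => hn.1)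
  classical
  -- The default 0 matters for finitely many `n` at most: `v n` is eventually a spin function, hence
  -- bounded and measurable.
  set w : ℕ → LInfty L := fun n => if h : MemLp (v n) ∞ (mu L) then h.toLp (v n) else 0 with hw
  have hwv : ∀ᶠ n in atTop, (w n : ℝ → ℝ) =ᵐ[mu L] v n := by
    filter_upwards [hspin] with n hn
    have hmem : MemLp (v n) ∞ (mu L) := by
      refine memLp_top_of_bound (measurable_spin hn.1 hn.2).aestronglyMeasurable 1
        (ae_of_all _ fun x => ?_)
      rw [Real.norm_of_nonneg (spin_nonneg hn.2 x)]
      exact spin_le_one hn.2 x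
    simp only [hw, dif_pos hmem]
    exact hmem.coeFn_toLp
  refine ⟨w, fun g hg => ?_, ?_⟩
  · have hfae : ∀ᵐ x, x ∈ Ioo 0 L → 0 ≤ f x ∧ f x ≤ 1 := by
      filter_upwards [hf.ae_of_subset le_rfl le_rfl] with x hx hx'
      exact hf.mem_Icc x (hx hx')
    have h0 := testTendsto_of_columns hL hf.integrable
      (hspin.mono fun n hn => integrable_spin hn.1 hn.2)
      (hspin.mono fun n hn => hfae.mono fun x hx hx' => by
        have h1 := hx hx'
        have h2 := spin_nonneg hn.2 x
        have h3 := spin_le_one hn.2 x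
        rw [abs_le]
        constructor <;> linarith)
      (fun ε hε => (hv ε hε).mono fun n hn => hn.2.2) g hg
    have hug : Integrable (fun x => (u : ℝ → ℝ) x * g x) (mu L) :=
      hg.bdd_mul (c := 1) hBV.1.aestronglyMeasurable (h01.mono fun x hx => by
        rw [Real.norm_of_nonneg hx.1]
        exact hx.2)
    have h1 := h0.add_const (∫ x, (u : ℝ → ℝ) x * g x ∂(mu L))
    rw [zero_add] at h1
    refine h1.congr' ?_
    filter_upwards [hspin, hwv] with n hn hwn
    have hvg : Integrable (fun x => v n x * g x) (mu L) :=
      hg.bdd_mul (c := 1) (measurable_spin hn.1 hn.2).aestronglyMeasurable (ae_of_all _ fun x => by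
        rw [Real.norm_of_nonneg (spin_nonneg hn.2 x)]
        exact spin_le_one hn.2 x)
    have e1 : ∫ x, (v n x - f x) * g x ∂(mu L) =
        ∫ x, (v n x * g x - (u : ℝ → ℝ) x * g x) ∂(mu L) :=
      integral_congr_ae (ae_mu_le.mono fun x hx => by
        simp only [hfu x hx]
        ring)
    have e2 : ∫ x, (w n : ℝ → ℝ) x * g x ∂(mu L) = ∫ x, v n x * g x ∂(mu L) :=
      integral_congr_ae (hwn.mono fun x hx => by simp only [hx])
    rw [e1, e2, integral_sub hvg hug, sub_add_cancel]
  · rw [limitFunctional, if_pos ⟨hBV, h01, hmean⟩]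
    refine ENNReal.le_of_forall_pos_le_add fun ε hε _ => ?_
    refine limsup_le_of_le (by isBoundedDefault) ?_
    filter_upwards [hv ε hε, hwv] with n hn hwn
    refine (iInf₂_le (v n) ⟨hn.1, hwn⟩).trans ((ENNReal.ofReal_le_ofReal hn.2.1).trans (le_of_eq ?_))
    rw [ENNReal.ofReal_add (by positivity) ε.coe_nonneg, ENNReal.ofReal_add (by positivity)
      ENNReal.toReal_nonneg, hVtop, ENNReal.ofReal_mul (by norm_num), Measure.real,
      ENNReal.ofReal_toReal hStop, ENNReal.ofReal_coe_nnreal]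
    rw [ENNReal.ofReal_ofNat]


end SpinChain

end

theorem mainTheorem2 (L : ℝ) (hL : 0 < L) (σ : ℝ) (hσ₀ : 0 < σ) (hσ₁ : σ < 1)
    (k : ℕ → ℕ) (hk : ∀ n : ℕ, 1 ≤ n → (k n : ℝ) ≤ L * (n : ℝ) ^ 2)
    (hkσ : Filter.Tendsto (fun n : ℕ => (k n : ℝ) / (L * (n : ℝ) ^ 2)) Filter.atTop (nhds σ)) :
    SpinChain.GammaConverges (SpinChain.WeakStarTendsto L)
      (fun n : ℕ => SpinChain.discreteFunctional L n (k n))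
      (SpinChain.limitFunctional L σ) :=
  ⟨fun _ _ hconv => SpinChain.limitFunctional_le_liminf hL hkσ hconv,
    fun u => SpinChain.exists_recovery_sequence hL hσ₀ hσ₁ hkσ u⟩
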